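/- A square-integrable process $\mathbf X=(X_t)_{t\in T}$, $T\subset(0,\infty)$, is a *quadratic harness* with real parameters $(\eta,\theta;\sigma,\tau;\gamma)$, written $\mathbf X\in QH(\eta,\theta;\sigma,\tau;\gamma)$, with respect to $\sigma$-fields $\mathcal F_{s,t}$ ($s<t$ in $T$) with $\mathcal F_{r,u}\subset\mathcal F_{s,t}$ for $r\le s<t\le u$, if $X_u$ is $\mathcal F_{s,t}$-measurable whenever $u\le s$ or $u\ge t$, if $E X_t=0$ and $E X_sX_t=\min\{s,t\}$, and if for all $s<t<u$ in $T$ $$E(X_t|\mathcal F_{s,u})=\tfrac{u-t}{u-s}X_s+\tfrac{t-s}{u-s}X_u,$$ $$\mathrm{Var}(X_t|\mathcal F_{s,u})=\frac{(u-t)(t-s)}{u(1+s\sigma)+\tau-s\gamma}\Big(1+\eta\widetilde\Delta+\theta\Delta+\sigma\widetilde\Delta^2+\tau\Delta^2-(1-\gamma)\Delta\widetilde\Delta\Big),$$ where $\Delta=\frac{X_u-X_s}{u-s}$ and $\widetilde\Delta=\frac{uX_s-sX_u}{u-s}$. A *$q$-Meixner process* is a quadratic harness on $(0,\infty)$ with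 $\eta=\sigma=0$ and $\gamma=q\in[-1,1]$. Let $\mathbf Z\in QH(\eta,\theta;\sigma,\tau;\gamma)$ on $(0,\infty)$ and let $V>0$. For $z\in\mathbb R$ let $\mathbf X^{z}=(X_t)_{0<t<V}$ denote the process $(Z_t)_{0<t<V}$ conditioned on $Z_V=z$ (a regular conditional distribution of the path given $Z_V$), let $\kappa_z\ge0$ with $\kappa_z^2=(1+\frac{\tau}{V})(1+\theta\frac{z}{V}+\tau\frac{z^2}{V^2})$, and let $$Y^z_t=\frac{1+\tau/V}{\kappa_z}\Big(\big(1+\tfrac tV\big)X^z_{t/(1+t/V)}-\tfrac tV z\Big),\qquad t>0.$$ Suppose that, for almost every $z$ with respect to the law of $Z_V$, $\kappa_z>0$ and $\mathbf Y^z$ is a $q$-Meixner process for some $q\in[-1,1]$ (the parameters of $\mathbf Y^z$, including $q$, may depend on $z$). Then exactly one of the following three cases occurs. 1. $\gamma=1$ and $\sigma=\tau=\eta=\theta=0$. Then, for almost every $z$, $\mathbf Y^z$ is (in law) the Wiener process. 2. $\gamma=1$, $\sigma=\tau=0$, $\eta\theta>0$ and $V=\theta/\eta$. Then, for almost every $z$,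 $1+\eta z>0$ and $\mathbf Y^z$ is (in law) a centered and rescaled Poisson process: with $\lambda_z=(1+\eta z)/\theta^2$, $\frac{\sqrt{1+\eta z}}{\theta}\,Y^z_t+\lambda_z t$ is a Poisson process with intensity $\lambda_z$. 3. $\sigma,\tau>0$, $\gamma=1+2\sqrt{\sigma\tau}>1$, $\eta\sqrt\tau=\theta\sqrt\sigma$ and $V=\sqrt{\tau/\sigma}$. Then, for almost every $z$, $\mathbf Y^z\in QH(0,\theta_Y;0,\tau_Y;1)$ (with respect to its natural $\sigma$-fields) with $\theta_Y=(\theta+2\tau z/V)/\kappa_z$ and $\tau_Y=V\tau/(V+\tau)$, and $\theta_Y^2-4\tau_Y$ has the same sign as $\theta^2-4\tau$. -/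

import Mathlib

open MeasureTheory ProbabilityTheory
open scoped NNReal

noncomputable section

namespace QHarness

/-! ### Quadratic harnesses -/

/-- The difference quotient `Δ_{s,u} = (x_u - x_s) / (u - s)`. -/
def delta (s u xs xu : ℝ) : ℝ := (xu - xs) / (u - s)

/-- `Δ̃_{s,u} = (u x_s - s x_u) / (u - s)`. -/
def deltaTilde (s u xs xu : ℝ) : ℝ := (u * xs - s * xu) / (u - s)

/-- The quadratic polynomial of the conditional variance, with `d` for `Δ` and `d'` for `Δ̃`. -/
def quadK (η θ σ τ γ d d' : ℝ) : ℝ :=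
  1 + η * d' + θ * d + σ * d' ^ 2 + τ * d ^ 2 - (1 - γ) * (d * d')

/-- The deterministic factor `F_{t,s,u}` of the conditional variance. -/
def factorF (σ τ γ t s u : ℝ) : ℝ :=
  (u - t) * (t - s) / (u * (1 + s * σ) + τ - s * γ)

/-- `X = (X_t)_{t ∈ T}` is a quadratic harness with parameters `(η, θ; σ, τ; γ)` with respect to the
two-parameter family `𝓕 s t`, `s < t`, of σ-fields. The field `𝓕 s t` carries (at least) the
information about `X` on the times `≤ s` and on the times `≥ t`, so it shrinks when the gap
`(s, t)` grows. -/
structure IsQuadraticHarness {Ω : Type*} {mΩ : MeasurableSpace Ω} (P : Measure Ω) {T : Set ℝ}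
    (𝓕 : T → T → MeasurableSpace Ω) (X : T → Ω → ℝ) (η θ σ τ γ : ℝ) : Prop where
  /-- the family consists of sub-σ-fields -/
  le : ∀ s t : T, s < t → 𝓕 s t ≤ mΩ
  /-- the family is monotone -/
  mono : ∀ r s t u : T, r ≤ s → s < t → t ≤ u → 𝓕 r u ≤ 𝓕 s t
  /-- adaptedness -/
  adapted : ∀ s t u : T, s < t → (u ≤ s ∨ t ≤ u) → Measurable[𝓕 s t] (X u)
  /-- square integrability -/
  memLp : ∀ t : T, MemLp (X t) 2 P
  /-- the process is centered -/
  mean : ∀ t : T, ∫ ω, X t ω ∂P = 0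
  /-- the covariance is `min s t` -/
  cov : ∀ s t : T, ∫ ω, X s ω * X t ω ∂P = min (s : ℝ) (t : ℝ)
  /-- the harness property -/
  harness : ∀ s t u : T, s < t → t < u →
    P[X t | 𝓕 s u] =ᵐ[P] fun ω =>
      ((u : ℝ) - t) / ((u : ℝ) - s) * X s ω + ((t : ℝ) - s) / ((u : ℝ) - s) * X u ω
  /-- the conditional variance is quadratic -/
  condVar : ∀ s t u : T, s < t → t < u →
    Var[X t; P | 𝓕 s u] =ᵐ[P] fun ω =>
      factorF σ τ γ t s u *
        quadK η θ σ τ γ (delta s u (X s ω) (X u ω)) (deltaTilde s u (X s ω) (X u ω))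

/-- The natural two-parameter family: `σ (X_r : r ≤ s or r ≥ t)`. -/
@[reducible]
def naturalFamily {Ω : Type*} {T : Set ℝ} (X : T → Ω → ℝ) (s t : T) : MeasurableSpace Ω :=
  ⨆ (r : T) (_ : r ≤ s ∨ t ≤ r), MeasurableSpace.comap (X r) inferInstance

/-- `Y = (Y_t)_{t > 0}` is a `q`-Meixner process for some `q ∈ [-1, 1]`: a quadratic harness on
`(0, ∞)` with `η = σ = 0` and `γ = q`. -/
def IsQMeixner {Ω : Type*} [MeasurableSpace Ω] (P : Measure Ω)
    (Y : Set.Ioi (0 : ℝ) → Ω → ℝ) : Prop :=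
  ∃ (𝓖 : Set.Ioi (0 : ℝ) → Set.Ioi (0 : ℝ) → MeasurableSpace Ω) (θ τ q : ℝ),
    -1 ≤ q ∧ q ≤ 1 ∧ IsQuadraticHarness P 𝓖 Y 0 θ 0 τ q

/-! ### The one-sided bridge and its transformation -/

/-- The joint law of `Z_V` and of the path `(Z_t)_{0 < t < V}`. A Markov kernel that disintegrates
it is a regular conditional distribution of the path given `Z_V`. -/
def jointLaw {Ω : Type*} [MeasurableSpace Ω] (P : Measure Ω) (Z : Set.Ioi (0 : ℝ) → Ω → ℝ)
    (V : ℝ) (hV : 0 < V) : Measure (ℝ × (Set.Ioo 0 V → ℝ)) :=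
  P.map fun ω => (Z ⟨V, hV⟩ ω, fun t : Set.Ioo 0 V => Z ⟨t, t.2.1⟩ ω)

/-- The time change `t ↦ t / (1 + t / V)` from `(0, ∞)` onto `(0, V)`. -/
def bridgeTime (V : ℝ) (hV : 0 < V) (t : Set.Ioi (0 : ℝ)) : Set.Ioo 0 V :=
  ⟨(t : ℝ) / (1 + (t : ℝ) / V), by
    have ht : (0 : ℝ) < t := t.2
    have h1 : 0 < 1 + (t : ℝ) / V := by positivity
    refine ⟨div_pos ht h1, ?_⟩
    rw [div_lt_iff₀ h1, mul_add, mul_one, mul_div_cancel₀ _ hV.ne']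
    linarith⟩

/-- The normalizing constant `κ`, with `κ² = (1 + τ/V) (1 + θ z/V + τ z²/V²)`. -/
def bridgeKappa (θ τ V z : ℝ) : ℝ :=
  √((1 + τ / V) * (1 + θ * (z / V) + τ * (z ^ 2 / V ^ 2)))

/-- The transformed process
`Y_t = ((1 + τ/V) / κ) * ((1 + t/V) X_{t/(1+t/V)} - (t/V) z)`, `t > 0`,
on the space of paths `X = (X_t)_{0 < t < V}`. -/
def bridgeTransform (θ τ V : ℝ) (hV : 0 < V) (z : ℝ) (t : Set.Ioi (0 : ℝ))
    (X : Set.Ioo 0 V → ℝ) : ℝ :=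
  (1 + τ / V) / bridgeKappa θ τ V z *
    ((1 + (t : ℝ) / V) * X (bridgeTime V hV t) - (t : ℝ) / V * z)

/-! ### Wiener and Poisson processes (in law) -/

/-- The process on `[0, ∞)` that starts at `0` and agrees with `Y` on `(0, ∞)`. -/
def extendZero {Ω : Type*} (Y : Set.Ioi (0 : ℝ) → Ω → ℝ) (t : ℝ≥0) (ω : Ω) : ℝ :=
  if h : 0 < (t : ℝ) then Y ⟨t, h⟩ ω else 0

/-- `N = (N_t)_{t ≥ 0}` is (in law) a Poisson process with intensity `l`. -/
structure IsPoissonProcess {Ω : Type*} [MeasurableSpace Ω] (P : Measure Ω) (l : ℝ≥0)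
    (N : ℝ≥0 → Ω → ℝ) : Prop where
  zero : ∀ᵐ ω ∂P, N 0 ω = 0
  indep : HasIndepIncrements N P
  law : ∀ s t : ℝ≥0, s ≤ t →
    HasLaw (fun ω => N t ω - N s ω) ((poissonMeasure (l * (t - s))).map (Nat.cast : ℕ → ℝ)) P

/-! ### The three cases -/

/-- First case (Wiener). -/
def WienerCase (η θ σ τ γ : ℝ) : Prop :=
  γ = 1 ∧ σ = 0 ∧ τ = 0 ∧ η = 0 ∧ θ = 0

/-- Second case (Poisson). -/
def PoissonCase (η θ σ τ γ V : ℝ) : Prop :=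
  γ = 1 ∧ σ = 0 ∧ τ = 0 ∧ 0 < η * θ ∧ V = θ / η

/-- Third case (`γ` maximal). -/
def MaximalCase (η θ σ τ γ V : ℝ) : Prop :=
  0 < σ ∧ 0 < τ ∧ γ = 1 + 2 * √(σ * τ) ∧ 1 < γ ∧ η * √τ = θ * √σ ∧ V = √(τ / σ)

end QHarness

end

namespace QHarness

open Filter Topology

/-! Let `Y` be a transformed bridge. For `u < V` the variable `Z_V` is measurable for `𝓕 s u`, so
conditioning on it leaves the conditional variances on `(0, V)` intact. The passage from bridge to
`Y` is affine in space and Möbius in time, so it carries chords to chords and the variance form of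
`Z` to a form with computable parameters `bridgeEta`, `bridgeTheta`, `bridgeSigma`, `bridgeTau`,
`bridgeGamma` (`varianceDefect_bridge`). This form and the assumed q-Meixner form both give the
conditional variance of `Y_t` given `(Y_s, Y_u)`, and both are functions of `(Y_s, Y_u)`; hence they
agree almost surely (`ae_bridge_condVar`).

Let `u → ∞` in this identity. Then `Δ → 0` and `Δ̃ → Y_s`, and what remains is `σ_Y Y_s² + η_Y Y_s =
σ_Y s`. If `σ_Y ≠ 0`, then `Y_s` takes at most two values, and a second limit, `s → 0`, turns the
relation into `Y_t² = t + θ_Y Y_t`. Eliminating between two times expresses `Z_V` through two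
earlier values of `Z`, which a martingale with nonzero increments forbids (`not_ae_bridge_sq_eq`).
So `σ_Y = 0`, and then `η_Y = 0` for almost every `z`. Since `κ η_Y` is affine in `z` and `Z_V` is
not constant, both of its coefficients vanish. The three resulting equations are `η = θ/V`, `σ =
τ/V²`, `γ = 1 + 2τ/V` (`parameters_of_isQMeixner`). They give `γ_Y = 1`; the trichotomy is the
alternative `τ = θ = 0`, `τ = 0 ≠ θ`, `τ > 0`.

If `τ = 0`, then `Y` is a harness with parameters `(0, θ_Y; 0, 0; 1)`, and its law has to be found
from second moments alone. Given the values outside an interval of length `H` over which the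
increment is `D`, the squared increments along a mesh of `n` steps have conditional expected sum
`D²/n + (1 - 1/n)(H + θ D)`. Hence the quadratic variation is predicted by `H + θ D`, as it is when
all jumps have size `θ`. Comparing fine, middle and coarse meshes with bounded Lipschitz weights
shows that only increments near `θ` contribute squared variation in the limit (`tendsto_meshSum`).
In the second order expansion of `exp(i l x)` the remainder may therefore be evaluated at `x = θ`,
and the conditional characteristic function obeys `G(r + δ) ≈ (1 + c δ) G(r)` with a constant `c`.
So the increments are independent with exponent `c` (`integral_past_mul_cexp`), which is Gaussian
for `θ = 0` and compensated Poisson for `θ ≠ 0`. -/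

/-- The value at time `t` of the chord through `(s, a)` and `(u, b)`. -/
noncomputable def chord (s t u a b : ℝ) : ℝ := (u - t) / (u - s) * a + (t - s) / (u - s) * b

/-- The normalizing denominator of the conditional variance. -/
def denom (σ τ γ s u : ℝ) : ℝ := u * (1 + s * σ) + τ - s * γ

theorem factorF_eq (σ τ γ t s u : ℝ) :
    factorF σ τ γ t s u = (u - t) * (t - s) / denom σ τ γ s u := rfl

/-! ### Conditional moments of a quadratic harness in integrated form -/

section CondExp

variable {Ω : Type*} {m mΩ : MeasurableSpace Ω} {P : Measure Ω}

theorem integral_mul_eq_integral_mul_condExp [IsFiniteMeasure P] (hm : m ≤ mΩ) {h g : Ω → ℝ}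
    (hh : Measurable[m] h) (hg : Integrable g P) (hhg : Integrable (fun ω => h ω * g ω) P) :
    ∫ ω, h ω * g ω ∂P = ∫ ω, h ω * (P[g | m]) ω ∂P := by
  have h1 : P[h * g | m] =ᵐ[P] h * P[g | m] :=
    condExp_mul_of_stronglyMeasurable_left hh.stronglyMeasurable hhg hg
  calc ∫ ω, h ω * g ω ∂P = ∫ ω, (P[h * g | m]) ω ∂P := (integral_condExp hm).symm
    _ = ∫ ω, h ω * (P[g | m]) ω ∂P := integral_congr_ae h1

theorem integral_lincomb {f g k : Ω → ℝ} (hf : Integrable f P) (hg : Integrable g P)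
    (hk : Integrable k P) (a b c : ℝ) :
    ∫ ω, (a * f ω + b * g ω + c * k ω) ∂P
      = a * ∫ ω, f ω ∂P + b * ∫ ω, g ω ∂P + c * ∫ ω, k ω ∂P := by
  rw [integral_add (f := fun ω => a * f ω + b * g ω) ((hf.const_mul a).add (hg.const_mul b))
    (hk.const_mul c), integral_add (hf.const_mul a) (hg.const_mul b)]
  simp only [integral_const_mul]

end CondExp

section Basic

variable {Ω : Type*} {mΩ : MeasurableSpace Ω} {P : Measure Ω}
  {𝓕 : Set.Ioi (0 : ℝ) → Set.Ioi (0 : ℝ) → MeasurableSpace Ω}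
  {X : Set.Ioi (0 : ℝ) → Ω → ℝ} {η θ σ τ γ : ℝ}

namespace IsQuadraticHarness

theorem measurable (hX : IsQuadraticHarness P 𝓕 X η θ σ τ γ) (t : Set.Ioi (0 : ℝ)) :
    Measurable (X t) := by
  have ht : t < ⟨(t : ℝ) + 1, add_pos (Set.mem_Ioi.1 t.2) one_pos⟩ := by
    rw [← Subtype.coe_lt_coe]; simp
  exact (hX.adapted t _ t ht (Or.inl le_rfl)).mono (hX.le _ _ ht) le_rfl

theorem integrable_mul (hX : IsQuadraticHarness P 𝓕 X η θ σ τ γ) (s t : Set.Ioi (0 : ℝ)) :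
    Integrable (fun ω => X s ω * X t ω) P :=
  (hX.memLp s).integrable_mul (hX.memLp t)

theorem integrable_sq (hX : IsQuadraticHarness P 𝓕 X η θ σ τ γ) (s : Set.Ioi (0 : ℝ)) :
    Integrable (fun ω => X s ω ^ 2) P := (hX.memLp s).integrable_sq

theorem integral_sq (hX : IsQuadraticHarness P 𝓕 X η θ σ τ γ) (s : Set.Ioi (0 : ℝ)) :
    ∫ ω, X s ω ^ 2 ∂P = s := by
  have := hX.cov s s
  simpa [sq] using this

theorem integrable [IsFiniteMeasure P] (hX : IsQuadraticHarness P 𝓕 X η θ σ τ γ)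
    (t : Set.Ioi (0 : ℝ)) : Integrable (X t) P := (hX.memLp t).integrable one_le_two

theorem cov_of_le (hX : IsQuadraticHarness P 𝓕 X η θ σ τ γ) {s t : Set.Ioi (0 : ℝ)} (h : s ≤ t) :
    ∫ ω, X s ω * X t ω ∂P = s := by
  rw [hX.cov, min_eq_left]; exact h

/-- Second moment of a linear combination of two values of the process. -/
theorem integral_linear_sq (hX : IsQuadraticHarness P 𝓕 X η θ σ τ γ) {s t : Set.Ioi (0 : ℝ)}
    (h : s ≤ t) (a b : ℝ) :
    ∫ ω, (a * X s ω + b * X t ω) ^ 2 ∂P = a ^ 2 * s + 2 * a * b * s + b ^ 2 * t := by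
  have e : ∀ ω, (a * X s ω + b * X t ω) ^ 2
      = a ^ 2 * X s ω ^ 2 + 2 * a * b * (X s ω * X t ω) + b ^ 2 * X t ω ^ 2 := fun ω => by ring
  simp_rw [e]
  rw [integral_lincomb (hX.integrable_sq s) (hX.integrable_mul s t) (hX.integrable_sq t)]
  simp only [hX.integral_sq, hX.cov_of_le h]

theorem integral_sub_sq (hX : IsQuadraticHarness P 𝓕 X η θ σ τ γ) (s t : Set.Ioi (0 : ℝ)) :
    ∫ ω, (X t ω - X s ω) ^ 2 ∂P = |(t : ℝ) - s| := by
  rcases le_total s t with h | h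
  · have := hX.integral_linear_sq h (-1) 1
    rw [abs_of_nonneg (sub_nonneg.2 (Subtype.coe_le_coe.2 h))]
    calc _ = ∫ ω, (-1 * X s ω + 1 * X t ω) ^ 2 ∂P := by congr with ω; ring
      _ = _ := by rw [this]; ring
  · have := hX.integral_linear_sq h 1 (-1)
    rw [abs_of_nonpos (sub_nonpos.2 (Subtype.coe_le_coe.2 h))]
    calc _ = ∫ ω, (1 * X t ω + -1 * X s ω) ^ 2 ∂P := by congr with ω; ring
      _ = _ := by rw [this]; ring

theorem memLp_chord (hX : IsQuadraticHarness P 𝓕 X η θ σ τ γ) (s t u : Set.Ioi (0 : ℝ)) (r : ℝ) :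
    MemLp (fun ω => X t ω - chord s r u (X s ω) (X u ω)) 2 P := by
  unfold chord
  exact (hX.memLp t).sub (((hX.memLp s).const_mul _).add ((hX.memLp u).const_mul _))

theorem memLp_delta (hX : IsQuadraticHarness P 𝓕 X η θ σ τ γ) (s u : Set.Ioi (0 : ℝ)) :
    MemLp (fun ω => delta s u (X s ω) (X u ω)) 2 P := by
  unfold delta
  simp_rw [div_eq_mul_inv]
  exact ((hX.memLp u).sub (hX.memLp s)).mul_const _

theorem memLp_deltaTilde (hX : IsQuadraticHarness P 𝓕 X η θ σ τ γ) (s u : Set.Ioi (0 : ℝ)) :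
    MemLp (fun ω => deltaTilde s u (X s ω) (X u ω)) 2 P := by
  unfold deltaTilde
  simp_rw [div_eq_mul_inv]
  exact (((hX.memLp s).const_mul _).sub ((hX.memLp u).const_mul _)).mul_const _

theorem integrable_quadK [IsFiniteMeasure P] (hX : IsQuadraticHarness P 𝓕 X η θ σ τ γ)
    (s u : Set.Ioi (0 : ℝ)) (η' θ' σ' τ' γ' : ℝ) :
    Integrable (fun ω => quadK η' θ' σ' τ' γ' (delta s u (X s ω) (X u ω))
      (deltaTilde s u (X s ω) (X u ω))) P := by
  unfold quadK
  have h1 := hX.memLp_delta s u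
  have h2 := hX.memLp_deltaTilde s u
  exact (((((integrable_const 1).add ((h2.integrable one_le_two).const_mul _)).add
    ((h1.integrable one_le_two).const_mul _)).add (h2.integrable_sq.const_mul _)).add
    (h1.integrable_sq.const_mul _)).sub ((h1.integrable_mul h2).const_mul _)

/-- The harness property, tested against square integrable functions. -/
theorem integral_mul_sub_chord [IsFiniteMeasure P] (hX : IsQuadraticHarness P 𝓕 X η θ σ τ γ)
    {s t u : Set.Ioi (0 : ℝ)} (hst : s < t) (htu : t < u) {h : Ω → ℝ}
    (hh : Measurable[𝓕 s u] h) (hL : MemLp h 2 P) :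
    ∫ ω, h ω * (X t ω - chord s t u (X s ω) (X u ω)) ∂P = 0 := by
  have hsu := hst.trans htu
  have hc : MemLp (fun ω => chord s t u (X s ω) (X u ω)) 2 P := by
    unfold chord; exact ((hX.memLp s).const_mul _).add ((hX.memLp u).const_mul _)
  have e : ∀ ω, h ω * (X t ω - chord s t u (X s ω) (X u ω))
      = h ω * X t ω - h ω * chord s t u (X s ω) (X u ω) := fun ω => by ring
  simp_rw [e]
  have i1 : Integrable (fun ω => h ω * X t ω) P := hL.integrable_mul (hX.memLp t)
  have i2 : Integrable (fun ω => h ω * chord s t u (X s ω) (X u ω)) P := hL.integrable_mul hc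
  rw [integral_sub i1 i2,
    integral_mul_eq_integral_mul_condExp (hX.le s u hsu) hh (hX.integrable t)
      (hL.integrable_mul (hX.memLp t)), sub_eq_zero]
  apply integral_congr_ae
  filter_upwards [hX.harness s t u hst htu] with ω hω
  rw [hω]; rfl

/-- The conditional variance, tested against bounded functions. -/
theorem integral_mul_sub_chord_sq [IsFiniteMeasure P] (hX : IsQuadraticHarness P 𝓕 X η θ σ τ γ)
    {s t u : Set.Ioi (0 : ℝ)} (hst : s < t) (htu : t < u) {h : Ω → ℝ}
    (hh : Measurable[𝓕 s u] h) {C : ℝ} (hC : ∀ ω, |h ω| ≤ C) :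
    ∫ ω, h ω * (X t ω - chord s t u (X s ω) (X u ω)) ^ 2 ∂P
      = factorF σ τ γ t s u * ∫ ω, h ω * quadK η θ σ τ γ (delta s u (X s ω) (X u ω))
          (deltaTilde s u (X s ω) (X u ω)) ∂P := by
  have hsu := hst.trans htu
  have hm := hX.le s u hsu
  have hH := hX.harness s t u hst htu
  have hI : Integrable ((X t - P[X t | 𝓕 s u]) ^ 2) P := by
    refine (hX.memLp_chord s t u t).integrable_sq.congr ?_
    filter_upwards [hH] with ω hω
    simp only [Pi.pow_apply, Pi.sub_apply, hω, chord]
  have hhm : AEStronglyMeasurable h P := (hh.mono hm le_rfl).aestronglyMeasurable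
  calc ∫ ω, h ω * (X t ω - chord s t u (X s ω) (X u ω)) ^ 2 ∂P
      = ∫ ω, h ω * ((X t - P[X t | 𝓕 s u]) ^ 2) ω ∂P := by
        apply integral_congr_ae
        filter_upwards [hH] with ω hω
        simp only [Pi.pow_apply, Pi.sub_apply, hω, chord]
    _ = ∫ ω, h ω * (Var[X t; P | 𝓕 s u]) ω ∂P :=
        integral_mul_eq_integral_mul_condExp hm hh hI
          (hI.bdd_mul hhm (Eventually.of_forall hC))
    _ = _ := by
        rw [← integral_const_mul]
        apply integral_congr_ae
        filter_upwards [hX.condVar s t u hst htu] with ω hω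
        rw [hω]; ring

theorem integral_delta_sq (hX : IsQuadraticHarness P 𝓕 X η θ σ τ γ)
    {s u : Set.Ioi (0 : ℝ)} (h : s < u) :
    ∫ ω, delta s u (X s ω) (X u ω) ^ 2 ∂P = 1 / ((u : ℝ) - s) := by
  have hlt : (s : ℝ) < u := h
  simp_rw [delta, div_pow, integral_div, hX.integral_sub_sq, abs_of_pos (sub_pos.2 hlt)]
  have : (u : ℝ) - s ≠ 0 := (sub_pos.2 hlt).ne'
  field_simp

/-- A midpoint of two times. -/
theorem exists_between {s u : Set.Ioi (0 : ℝ)} (h : s < u) :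
    ∃ t : Set.Ioi (0 : ℝ), s < t ∧ t < u := by
  have hs : (0 : ℝ) < s := s.2
  have hu : (0 : ℝ) < u := u.2
  have hlt : (s : ℝ) < u := h
  exact ⟨⟨((s : ℝ) + u) / 2, by simp only [Set.mem_Ioi]; positivity⟩,
    Subtype.coe_lt_coe.1 (show (s : ℝ) < (s + u) / 2 by linarith),
    Subtype.coe_lt_coe.1 (show ((s : ℝ) + u) / 2 < u by linarith)⟩

theorem integral_sub_chord_sq (hX : IsQuadraticHarness P 𝓕 X η θ σ τ γ)
    {s t u : Set.Ioi (0 : ℝ)} (hst : s < t) (htu : t < u) :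
    ∫ ω, (X t ω - chord s t u (X s ω) (X u ω)) ^ 2 ∂P
      = ((u : ℝ) - t) * (t - s) / (u - s) := by
  have h1 : (s : ℝ) < t := hst
  have h2 : (t : ℝ) < u := htu
  have hne : (u : ℝ) - s ≠ 0 := by linarith
  set a : ℝ := ((u : ℝ) - t) / (u - s)
  set b : ℝ := ((t : ℝ) - s) / (u - s)
  have e : ∀ ω, (X t ω - chord s t u (X s ω) (X u ω)) ^ 2
      = 1 * (X t ω ^ 2 + (a * X s ω + b * X u ω) ^ 2) + (-(2 * a)) * (X s ω * X t ω)
        + (-(2 * b)) * (X t ω * X u ω) := fun ω => by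
    simp only [chord, a, b]; ring
  have i1 : Integrable (fun ω => (a * X s ω + b * X u ω) ^ 2) P :=
    (((hX.memLp s).const_mul a).add ((hX.memLp u).const_mul b)).integrable_sq
  simp_rw [e]
  rw [integral_lincomb (f := fun ω => X t ω ^ 2 + (a * X s ω + b * X u ω) ^ 2)
    ((hX.integrable_sq t).add i1) (hX.integrable_mul s t)
    (hX.integrable_mul t u), integral_add (hX.integrable_sq t) i1]
  simp only [hX.integral_sq, hX.cov_of_le hst.le, hX.cov_of_le htu.le,
    hX.integral_linear_sq (hst.trans htu).le, a, b]
  field_simp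
  ring

/-- The mean of the conditional variance is `(u - t)(t - s)/(u - s) > 0` by the covariances, while a
zero denominator would make `factorF` zero by the convention `x / 0 = 0`. -/
theorem denom_ne_zero [IsProbabilityMeasure P] (hX : IsQuadraticHarness P 𝓕 X η θ σ τ γ)
    {s u : Set.Ioi (0 : ℝ)} (h : s < u) : denom σ τ γ s u ≠ 0 := by
  intro h0
  obtain ⟨t, hst, htu⟩ := exists_between h
  have h1 : (s : ℝ) < t := hst
  have h2 : (t : ℝ) < u := htu
  have := hX.integral_mul_sub_chord_sq hst htu (h := fun _ => 1) measurable_const (C := 1) (by simp)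
  simp only [one_mul, hX.integral_sub_chord_sq hst htu, factorF_eq, h0, div_zero, zero_mul] at this
  have h3 : 0 < ((u : ℝ) - t) * (t - s) / (u - s) :=
    div_pos (mul_pos (by linarith) (by linarith)) (by linarith)
  linarith

/-- For `τ < 0` and small `s`, the denominator, which is affine in `u`, has a root `u > s`; this
contradicts `denom_ne_zero`. -/
theorem tau_nonneg [IsProbabilityMeasure P] (hX : IsQuadraticHarness P 𝓕 X η θ σ τ γ) :
    0 ≤ τ := by
  by_contra! hτ
  -- The first bound gives `|s σ| ≤ 1/2`; the second makes `s γ - τ` at least `s |γ| + 4 s`, which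
  -- exceeds `s (1 + s σ)`.
  set s : ℝ := min (1 / (2 * (|σ| + 1))) (-τ / (2 * (|γ| + 2)))
  have hσ := abs_nonneg σ
  have hγ := abs_nonneg γ
  have hs : 0 < s := lt_min (by positivity) (div_pos (by linarith) (by positivity))
  have h1 : s * (2 * (|σ| + 1)) ≤ 1 := by
    rw [← le_div_iff₀ (by positivity)]; exact min_le_left _ _
  have h2 : s * (2 * (|γ| + 2)) ≤ -τ := by
    rw [← le_div_iff₀ (by positivity)]; exact min_le_right _ _
  have h3 : |s * σ| ≤ 1 / 2 := by
    rw [abs_mul, abs_of_pos hs]; nlinarith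
  have h4 : |s * γ| ≤ s * |γ| := by rw [abs_mul, abs_of_pos hs]
  have h5 := abs_le.1 h3
  have h6 := abs_le.1 h4
  have hpos : 0 < 1 + s * σ := by linarith
  set u : ℝ := (s * γ - τ) / (1 + s * σ)
  have hsu : s < u := by
    rw [lt_div_iff₀ hpos]; nlinarith
  refine hX.denom_ne_zero (s := ⟨s, hs⟩) (u := ⟨u, hs.trans hsu⟩) hsu ?_
  simp only [denom, u]
  field_simp
  ring

end IsQuadraticHarness

end Basic

/-! ### Increments: conditioning on both sides, on the past, and comparison of weights -/

section Increments

variable {Ω : Type*} {mΩ : MeasurableSpace Ω} {P : Measure Ω}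
  {𝓕 : Set.Ioi (0 : ℝ) → Set.Ioi (0 : ℝ) → MeasurableSpace Ω}
  {X : Set.Ioi (0 : ℝ) → Ω → ℝ} {η θ σ τ γ : ℝ}

/-- `h` is determined by the past of time `s`. -/
def IsPast (𝓕 : Set.Ioi (0 : ℝ) → Set.Ioi (0 : ℝ) → MeasurableSpace Ω) (s : Set.Ioi (0 : ℝ))
    {E : Type*} [MeasurableSpace E] (h : Ω → E) : Prop :=
  ∀ u, s < u → Measurable[𝓕 s u] h

theorem exists_gt (s : Set.Ioi (0 : ℝ)) : ∃ u : Set.Ioi (0 : ℝ), s < u :=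
  ⟨⟨(s : ℝ) + 1, add_pos (Set.mem_Ioi.1 s.2) one_pos⟩, by rw [← Subtype.coe_lt_coe]; simp⟩

theorem abs_integral_mul_le {h f : Ω → ℝ} {C : ℝ} (hC : ∀ ω, |h ω| ≤ C)
    (hf : Integrable f P) : |∫ ω, h ω * f ω ∂P| ≤ C * ∫ ω, |f ω| ∂P := by
  rw [← integral_const_mul, ← Real.norm_eq_abs]
  refine norm_integral_le_of_norm_le (hf.abs.const_mul C) (Eventually.of_forall fun ω => ?_)
  rw [Real.norm_eq_abs, abs_mul]
  exact mul_le_mul_of_nonneg_right (hC ω) (abs_nonneg _)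

theorem integral_abs_le_sqrt [IsProbabilityMeasure P] {f : Ω → ℝ} (hf : MemLp f 2 P) :
    ∫ ω, |f ω| ∂P ≤ √(∫ ω, f ω ^ 2 ∂P) := by
  apply Real.le_sqrt_of_sq_le
  have h1 : MemLp (fun ω => |f ω|) 2 P := hf.abs
  have := variance_nonneg (fun ω => |f ω|) P
  rw [variance_eq_sub h1] at this
  simp only [Pi.pow_apply, sq_abs] at this
  linarith

theorem integrable_bdd_mul {h f : Ω → ℝ} {C : ℝ} (hm : Measurable h) (hC : ∀ ω, |h ω| ≤ C)
    (hf : Integrable f P) : Integrable (fun ω => h ω * f ω) P :=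
  hf.bdd_mul hm.aestronglyMeasurable (Eventually.of_forall hC)

/-- Conditioning on the past is conditioning on the outside of `(s, s + H)` with `H → ∞`; the errors
are of order `1 / √H`. -/
theorem eq_zero_of_forall_abs_le_div_sqrt {A K H₀ : ℝ} (h : ∀ H ≥ H₀, |A| ≤ K / √H) : A = 0 := by
  have h1 : Tendsto (fun H : ℝ => K / √H) atTop (𝓝 0) :=
    Real.tendsto_sqrt_atTop.const_div_atTop K
  have h2 : |A| ≤ 0 := ge_of_tendsto h1 (eventually_atTop.2 ⟨H₀, h⟩)
  exact abs_nonpos_iff.1 h2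

namespace IsPast

theorem mono (hX : IsQuadraticHarness P 𝓕 X η θ σ τ γ) {E : Type*} [MeasurableSpace E]
    {h : Ω → E} {s t : Set.Ioi (0 : ℝ)} (hst : s ≤ t) (hh : IsPast 𝓕 s h) : IsPast 𝓕 t h :=
  fun u hu => (hh u (hst.trans_lt hu)).mono (hX.mono s t u u hst hu le_rfl) le_rfl

theorem measurable (hX : IsQuadraticHarness P 𝓕 X η θ σ τ γ) {E : Type*} [MeasurableSpace E]
    {h : Ω → E} {s : Set.Ioi (0 : ℝ)} (hh : IsPast 𝓕 s h) : Measurable h := by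
  obtain ⟨u, hu⟩ := exists_gt s
  exact (hh u hu).mono (hX.le s u hu) le_rfl

theorem eval (hX : IsQuadraticHarness P 𝓕 X η θ σ τ γ) {r s : Set.Ioi (0 : ℝ)} (h : r ≤ s) :
    IsPast 𝓕 s (X r) :=
  fun u hu => hX.adapted s u r hu (Or.inl h)

theorem comp {E F : Type*} [MeasurableSpace E] [MeasurableSpace F] {h : Ω → E} {f : E → F}
    {s : Set.Ioi (0 : ℝ)} (hf : Measurable f) (hh : IsPast 𝓕 s h) :
    IsPast 𝓕 s (fun ω => f (h ω)) :=
  fun u hu => hf.comp (hh u hu)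

end IsPast

namespace IsQuadraticHarness

theorem memLp_sub (hX : IsQuadraticHarness P 𝓕 X η θ σ τ γ) (s t : Set.Ioi (0 : ℝ)) :
    MemLp (fun ω => X t ω - X s ω) 2 P := (hX.memLp t).sub (hX.memLp s)

theorem measurable_sub (hX : IsQuadraticHarness P 𝓕 X η θ σ τ γ) (s t : Set.Ioi (0 : ℝ)) :
    Measurable (fun ω => X t ω - X s ω) := (hX.measurable t).sub (hX.measurable s)

theorem integral_abs_sub_le [IsProbabilityMeasure P] (hX : IsQuadraticHarness P 𝓕 X η θ σ τ γ)
    (s t : Set.Ioi (0 : ℝ)) : ∫ ω, |X t ω - X s ω| ∂P ≤ √|(t : ℝ) - s| := by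
  rw [← hX.integral_sub_sq s t]
  exact integral_abs_le_sqrt (hX.memLp_sub s t)

/-- By the harness property the conditional mean of an increment from `s` is proportional to elapsed
time. -/
theorem integral_mul_sub_left [IsProbabilityMeasure P] (hX : IsQuadraticHarness P 𝓕 X η θ σ τ γ)
    {s t u : Set.Ioi (0 : ℝ)} (hst : s < t) (htu : t < u) {h : Ω → ℝ} (hh : Measurable[𝓕 s u] h)
    {C : ℝ} (hC : ∀ ω, |h ω| ≤ C) :
    ∫ ω, h ω * (X t ω - X s ω) ∂P
      = ((t : ℝ) - s) / (u - s) * ∫ ω, h ω * (X u ω - X s ω) ∂P := by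
  have hsu := hst.trans htu
  have h1 : (s : ℝ) < u := hsu
  have hne : (u : ℝ) - s ≠ 0 := by linarith
  have hm := hh.mono (hX.le s u hsu) le_rfl
  have hL : MemLp h 2 P := MemLp.of_bound hm.aestronglyMeasurable C (Eventually.of_forall hC)
  have := hX.integral_mul_sub_chord hst htu hh hL
  have i1 : Integrable (fun ω => h ω * (X t ω - X s ω)) P :=
    hL.integrable_mul (hX.memLp_sub s t)
  have i2 : Integrable (fun ω => h ω * (X u ω - X s ω)) P :=
    hL.integrable_mul (hX.memLp_sub s u)
  have e : ∀ ω, h ω * (X t ω - chord s t u (X s ω) (X u ω)) = h ω * (X t ω - X s ω)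
      - ((t : ℝ) - s) / (u - s) * (h ω * (X u ω - X s ω)) := fun ω => by
    rw [chord]; field_simp; ring
  simp_rw [e] at this
  rw [integral_sub i1 (i2.const_mul _), integral_const_mul] at this
  linarith

/-- Second moments of the two pieces of an increment, with `h = 1 + θ Δ` as the quadratic form of
the conditional variance. -/
theorem integral_mul_chord_lincomb_sq [IsProbabilityMeasure P]
    (hX : IsQuadraticHarness P 𝓕 X 0 θ 0 0 1)
    {s t u : Set.Ioi (0 : ℝ)} (hst : s < t) (htu : t < u) {h : Ω → ℝ} (hh : Measurable[𝓕 s u] h)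
    {C : ℝ} (hC : ∀ ω, |h ω| ≤ C) (a b : ℝ) :
    ∫ ω, h ω * (a * (X t ω - chord s t u (X s ω) (X u ω)) + b * (X u ω - X s ω)) ^ 2 ∂P
      = b ^ 2 * ∫ ω, h ω * (X u ω - X s ω) ^ 2 ∂P
        + a ^ 2 * (((u : ℝ) - t) * (t - s) / (u - s) ^ 2) *
          ∫ ω, h ω * ((u - s) + θ * (X u ω - X s ω)) ∂P := by
  have hsu := hst.trans htu
  have h1 : (s : ℝ) < u := hsu
  have hne : (u : ℝ) - s ≠ 0 := by linarith
  have hm := hh.mono (hX.le s u hsu) le_rfl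
  have hd : Measurable[𝓕 s u] (fun ω => X u ω - X s ω) :=
    (hX.adapted s u u hsu (Or.inr le_rfl)).sub (hX.adapted s u s hsu (Or.inl le_rfl))
  have hhd : MemLp (fun ω => h ω * (X u ω - X s ω)) 2 P :=
    (hX.memLp_sub s u).of_le_mul (c := C)
      (hm.mul (hX.measurable_sub s u)).aestronglyMeasurable
      (Eventually.of_forall fun ω => by
        rw [norm_mul]; exact mul_le_mul_of_nonneg_right (hC ω) (norm_nonneg _))
  -- The cross term vanishes: `h (X_u - X_s)` is unbounded but square integrable, which is enough to
  -- test the harness property.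
  have e1 := hX.integral_mul_sub_chord hst htu (hh.mul hd) hhd
  have e2 := hX.integral_mul_sub_chord_sq hst htu hh hC
  have hc := hX.memLp_chord s t u t
  have i1 : Integrable (fun ω => h ω * (X t ω - chord s t u (X s ω) (X u ω)) ^ 2) P :=
    integrable_bdd_mul hm hC hc.integrable_sq
  have i2 : Integrable (fun ω => h ω * (X u ω - X s ω) *
      (X t ω - chord s t u (X s ω) (X u ω))) P := hhd.integrable_mul hc
  have i3 : Integrable (fun ω => h ω * (X u ω - X s ω) ^ 2) P :=
    integrable_bdd_mul hm hC (hX.memLp_sub s u).integrable_sq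
  have e : ∀ ω, h ω * (a * (X t ω - chord s t u (X s ω) (X u ω)) + b * (X u ω - X s ω)) ^ 2
      = a ^ 2 * (h ω * (X t ω - chord s t u (X s ω) (X u ω)) ^ 2)
        + 2 * a * b * (h ω * (X u ω - X s ω) * (X t ω - chord s t u (X s ω) (X u ω)))
        + b ^ 2 * (h ω * (X u ω - X s ω) ^ 2) := fun ω => by ring
  have e3 : ∫ ω, h ω * quadK 0 θ 0 0 1 (delta s u (X s ω) (X u ω))
      (deltaTilde s u (X s ω) (X u ω)) ∂P
      = 1 / ((u : ℝ) - s) * ∫ ω, h ω * ((u - s) + θ * (X u ω - X s ω)) ∂P := by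
    rw [← integral_const_mul]
    congr with ω
    rw [quadK, delta]; field_simp; ring
  simp_rw [e]
  rw [integral_lincomb i1 i2 i3, e2, e3]
  simp only [Pi.mul_apply] at e1
  have e4 : denom 0 0 1 s u = (u : ℝ) - s := by rw [denom]; ring
  rw [e1, factorF_eq, e4]
  generalize ∫ ω, h ω * ((u - s) + θ * (X u ω - X s ω)) ∂P = I₁
  generalize ∫ ω, h ω * (X u ω - X s ω) ^ 2 ∂P = I₂
  field_simp
  ring

/-- The conditional second moment of an increment `X_{t'} - X_t` given the values outside of a
larger interval `(s, u)`. -/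
theorem integral_mul_sub_sq [IsProbabilityMeasure P] (hX : IsQuadraticHarness P 𝓕 X 0 θ 0 0 1)
    {s t t' u : Set.Ioi (0 : ℝ)} (hst : s ≤ t) (htt : t < t') (htu : t' ≤ u) {h : Ω → ℝ}
    (hh : Measurable[𝓕 s u] h) {C : ℝ} (hC : ∀ ω, |h ω| ≤ C) :
    ∫ ω, h ω * (X t' ω - X t ω) ^ 2 ∂P
      = (((t' : ℝ) - t) / (u - s)) ^ 2 * ∫ ω, h ω * (X u ω - X s ω) ^ 2 ∂P
        + ((t' : ℝ) - t) * ((u - s) - (t' - t)) / (u - s) ^ 2 *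
          ∫ ω, h ω * ((u - s) + θ * (X u ω - X s ω)) ∂P := by
  have left : ∀ {s t u : Set.Ioi (0 : ℝ)}, s < t → t < u → ∀ {h : Ω → ℝ},
      Measurable[𝓕 s u] h → (∀ ω, |h ω| ≤ C) →
      ∫ ω, h ω * (X t ω - X s ω) ^ 2 ∂P
      = (((t : ℝ) - s) / (u - s)) ^ 2 * ∫ ω, h ω * (X u ω - X s ω) ^ 2 ∂P
        + ((u : ℝ) - t) * (t - s) / (u - s) ^ 2 *
          ∫ ω, h ω * ((u - s) + θ * (X u ω - X s ω)) ∂P := by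
    intro s t u hst htu h hh hC
    have h1 : (s : ℝ) < u := hst.trans htu
    have hne : (u : ℝ) - s ≠ 0 := by linarith
    have := hX.integral_mul_chord_lincomb_sq hst htu hh hC 1 (((t : ℝ) - s) / (u - s))
    rw [one_pow, one_mul] at this
    rw [← this]
    congr with ω
    rw [chord]; field_simp; ring
  have right : ∀ {s t u : Set.Ioi (0 : ℝ)}, s < t → t < u → ∀ {h : Ω → ℝ},
      Measurable[𝓕 s u] h → (∀ ω, |h ω| ≤ C) →
      ∫ ω, h ω * (X u ω - X t ω) ^ 2 ∂P
      = (((u : ℝ) - t) / (u - s)) ^ 2 * ∫ ω, h ω * (X u ω - X s ω) ^ 2 ∂P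
        + ((u : ℝ) - t) * (t - s) / (u - s) ^ 2 *
          ∫ ω, h ω * ((u - s) + θ * (X u ω - X s ω)) ∂P := by
    intro s t u hst htu h hh hC
    have h1 : (s : ℝ) < u := hst.trans htu
    have hne : (u : ℝ) - s ≠ 0 := by linarith
    have := hX.integral_mul_chord_lincomb_sq hst htu hh hC (-1) (((u : ℝ) - t) / (u - s))
    rw [neg_one_sq, one_mul] at this
    rw [← this]
    congr with ω
    rw [chord]; field_simp; ring
  -- The increment may touch either end of `(s, u)`. If it touches neither, it is the right-hand
  -- piece of `(s, t')`, and the moments of `X_{t'} - X_s` that then appear are those of the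
  -- left-hand piece of `(s, u)`.
  rcases hst.eq_or_lt with rfl | hst
  · rcases htu.eq_or_lt with rfl | htu
    · have h1 : (s : ℝ) < t' := htt
      have hne : (t' : ℝ) - s ≠ 0 := by linarith
      rw [sub_self, mul_zero, zero_div, zero_mul, add_zero, div_self hne, one_pow, one_mul]
    · rw [left htt htu hh hC]; ring
  · rcases htu.eq_or_lt with rfl | htu
    · rw [right hst htt hh hC]; ring
    · have hst' := hst.trans htt
      have hh' : Measurable[𝓕 s t'] h :=
        hh.mono (hX.mono s s t' u le_rfl hst' htu.le) le_rfl
      have hm := hh'.mono (hX.le s t' hst') le_rfl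
      have h1 : (s : ℝ) < t' := hst'
      have h2 : (t' : ℝ) < u := htu
      have hne : (t' : ℝ) - s ≠ 0 := by linarith
      have hne' : (u : ℝ) - s ≠ 0 := by linarith
      have spl : ∀ (v : Set.Ioi (0 : ℝ)) (H : ℝ), ∫ ω, h ω * (H + θ * (X v ω - X s ω)) ∂P
          = H * ∫ ω, h ω ∂P + θ * ∫ ω, h ω * (X v ω - X s ω) ∂P := by
        intro v H
        have e : ∀ ω, h ω * (H + θ * (X v ω - X s ω))
          = H * h ω + θ * (h ω * (X v ω - X s ω)) := fun ω => by ring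
        simp_rw [e]
        rw [integral_add ((Integrable.of_bound hm.aestronglyMeasurable C
          (Eventually.of_forall hC)).const_mul H) ((integrable_bdd_mul hm hC
          ((hX.memLp_sub s v).integrable one_le_two)).const_mul θ), integral_const_mul,
          integral_const_mul]
      rw [right hst htt hh' hC, left hst' htu hh hC, spl, spl,
        hX.integral_mul_sub_left hst' htu hh hC]
      field_simp
      ring

theorem abs_integral_mul_sub_le [IsProbabilityMeasure P]
    (hX : IsQuadraticHarness P 𝓕 X η θ σ τ γ) {h : Ω → ℝ} {C : ℝ} (hC : ∀ ω, |h ω| ≤ C)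
    (s u : Set.Ioi (0 : ℝ)) :
    |∫ ω, h ω * (X u ω - X s ω) ∂P| ≤ C * √|(u : ℝ) - s| := by
  obtain ⟨ω₀⟩ := P.nonempty_of_neZero
  have hC0 : 0 ≤ C := (abs_nonneg _).trans (hC ω₀)
  exact (abs_integral_mul_le hC ((hX.memLp_sub s u).integrable one_le_two)).trans
    (mul_le_mul_of_nonneg_left (hX.integral_abs_sub_le s u) hC0)

theorem abs_integral_mul_sub_sq_le (hX : IsQuadraticHarness P 𝓕 X η θ σ τ γ) {h : Ω → ℝ} {C : ℝ}
    (hC : ∀ ω, |h ω| ≤ C) (s u : Set.Ioi (0 : ℝ)) :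
    |∫ ω, h ω * (X u ω - X s ω) ^ 2 ∂P| ≤ C * |(u : ℝ) - s| := by
  refine (abs_integral_mul_le hC (hX.memLp_sub s u).integrable_sq).trans (le_of_eq ?_)
  simp_rw [abs_pow, sq_abs, hX.integral_sub_sq]

/-- The process is a martingale. -/
theorem integral_past_mul_sub [IsProbabilityMeasure P] (hX : IsQuadraticHarness P 𝓕 X η θ σ τ γ)
    {s t : Set.Ioi (0 : ℝ)} (hst : s < t) {h : Ω → ℝ} (hh : IsPast 𝓕 s h) {C : ℝ}
    (hC : ∀ ω, |h ω| ≤ C) : ∫ ω, h ω * (X t ω - X s ω) ∂P = 0 := by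
  have h1 : (s : ℝ) < t := hst
  have hs0 : (0 : ℝ) < s := s.2
  refine eq_zero_of_forall_abs_le_div_sqrt (H₀ := t) (K := (t - s) * C) fun H hH => ?_
  -- The mean of the increment on `(s, t)` is the fraction `(t - s)/H` of a quantity of size at most
  -- `C √H`.
  set u : Set.Ioi (0 : ℝ) := ⟨s + H, Set.mem_Ioi.2 (by linarith)⟩
  have hu : (u : ℝ) - s = H := by simp [u]
  have htu : t < u := Subtype.coe_lt_coe.1 (show (t : ℝ) < s + H by linarith)
  have hHpos : 0 < H := by linarith
  rw [hX.integral_mul_sub_left hst htu (hh u (hst.trans htu)) hC, abs_mul, hu,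
    abs_of_nonneg (div_nonneg (by linarith) hHpos.le)]
  have := hX.abs_integral_mul_sub_le hC s u
  rw [hu, abs_of_pos hHpos] at this
  calc (t - s) / H * |∫ ω, h ω * (X u ω - X s ω) ∂P| ≤ (t - s) / H * (C * √H) :=
        mul_le_mul_of_nonneg_left this (div_nonneg (by linarith) hHpos.le)
    _ = (t - s) * C / √H := by
        nth_rewrite 1 [← Real.mul_self_sqrt hHpos.le]
        have := (Real.sqrt_pos.2 hHpos).ne'
        field_simp

/-- The increments have conditional variance `t - s` given the past. -/
theorem integral_past_mul_sub_sq [IsProbabilityMeasure P]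
    (hX : IsQuadraticHarness P 𝓕 X 0 θ 0 0 1)
    {s t : Set.Ioi (0 : ℝ)} (hst : s < t) {h : Ω → ℝ} (hh : IsPast 𝓕 s h) {C : ℝ}
    (hC : ∀ ω, |h ω| ≤ C) :
    ∫ ω, h ω * (X t ω - X s ω) ^ 2 ∂P = ((t : ℝ) - s) * ∫ ω, h ω ∂P := by
  have h1 : (s : ℝ) < t := hst
  have hs0 : (0 : ℝ) < s := s.2
  obtain ⟨ω₀⟩ := P.nonempty_of_neZero
  have hC0 : 0 ≤ C := (abs_nonneg _).trans (hC ω₀)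
  have hm := hh.measurable hX
  rw [← sub_eq_zero]
  refine eq_zero_of_forall_abs_le_div_sqrt (H₀ := t + 1) (K := 2 * (t - s) ^ 2 * C)
    fun H hH => ?_
  set u : Set.Ioi (0 : ℝ) := ⟨s + H, Set.mem_Ioi.2 (by linarith)⟩
  have hu : (u : ℝ) - s = H := by simp [u]
  have htu : t < u := Subtype.coe_lt_coe.1 (show (t : ℝ) < s + H by linarith)
  have hHpos : 0 < H := by linarith
  have e : ∀ ω, h ω * (H + θ * (X u ω - X s ω))
      = H * h ω + θ * (h ω * (X u ω - X s ω)) := fun ω => by ring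
  have b1 := hX.abs_integral_mul_sub_sq_le hC s u
  rw [hu, abs_of_pos hHpos] at b1
  have b2 : |∫ ω, h ω ∂P| ≤ C := by
    have := abs_integral_mul_le (P := P) (f := fun _ => (1 : ℝ)) hC (integrable_const _)
    simpa using this
  have b3 := hX.integral_past_mul_sub (hst.trans htu) hh hC
  rw [hX.integral_mul_sub_sq le_rfl hst htu.le (hh u (hst.trans htu)) hC, hu]
  simp_rw [e]
  rw [integral_add ((Integrable.of_bound hm.aestronglyMeasurable C
          (Eventually.of_forall hC)).const_mul H) ((integrable_bdd_mul hm hC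
          ((hX.memLp_sub s u).integrable one_le_two)).const_mul θ), integral_const_mul,
          integral_const_mul, b3]
  set A := ∫ ω, h ω * (X u ω - X s ω) ^ 2 ∂P
  set B := ∫ ω, h ω ∂P
  -- The martingale property kills the `θ` term. Both remaining terms are `O(1/H)`, because `A` is
  -- at most `C H`.
  have e2 : (((t : ℝ) - s) / H) ^ 2 * A + ((t : ℝ) - s) * (H - (t - s)) / H ^ 2 * (H * B + θ * 0)
      - (t - s) * B = (t - s) ^ 2 / H ^ 2 * A - (t - s) ^ 2 / H * B := by
    field_simp; ring
  rw [e2]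
  have hsq : √H ≤ H := by
    rw [Real.sqrt_le_left hHpos.le]; nlinarith
  calc |((t : ℝ) - s) ^ 2 / H ^ 2 * A - (t - s) ^ 2 / H * B|
      ≤ |((t : ℝ) - s) ^ 2 / H ^ 2 * A| + |((t : ℝ) - s) ^ 2 / H * B| := abs_sub _ _
    _ = ((t : ℝ) - s) ^ 2 / H ^ 2 * |A| + ((t : ℝ) - s) ^ 2 / H * |B| := by
        rw [abs_mul, abs_mul, abs_of_nonneg (by positivity : 0 ≤ ((t : ℝ) - s) ^ 2 / H ^ 2),
          abs_of_nonneg (by positivity : 0 ≤ ((t : ℝ) - s) ^ 2 / H)]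
    _ ≤ ((t : ℝ) - s) ^ 2 / H ^ 2 * (C * H) + ((t : ℝ) - s) ^ 2 / H * C := by
        gcongr
    _ = 2 * ((t : ℝ) - s) ^ 2 * C / H := by field_simp; ring
    _ ≤ 2 * ((t : ℝ) - s) ^ 2 * C / √H := by
        apply div_le_div_of_nonneg_left (by positivity) (Real.sqrt_pos.2 hHpos) hsq

/-- An increment stays almost independent of its neighbours: the effect of replacing, in a bounded
Lipschitz weight, an increment by a larger one. -/
theorem abs_integral_weight_sub_le [IsProbabilityMeasure P]
    (hX : IsQuadraticHarness P 𝓕 X 0 θ 0 0 1)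
    {s t t' u : Set.Ioi (0 : ℝ)} (hst : s ≤ t) (htt : t < t') (htu : t' ≤ u) {g : ℝ → ℝ}
    (hg : Measurable g) {C : ℝ} (hC : ∀ x, |g x| ≤ C)
    (hL : ∀ x y, |g x - g y| ≤ C * min 1 |x - y|) :
    |∫ ω, g (X t' ω - X t ω) * (X t' ω - X t ω) ^ 2 ∂P
      - ∫ ω, g (X u ω - X s ω) * (X t' ω - X t ω) ^ 2 ∂P|
      ≤ 2 * C * √((u : ℝ) - s) * (t' - t) := by
  have h1 : (s : ℝ) ≤ t := hst
  have h2 : (t : ℝ) < t' := htt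
  have h3 : (t' : ℝ) ≤ u := htu
  have hC0 : 0 ≤ C := (abs_nonneg _).trans (hC 0)
  set H : ℝ := (u : ℝ) - s with hH
  have hHpos : 0 < H := by simp only [hH]; linarith
  have hHs : 0 < √H := Real.sqrt_pos.2 hHpos
  have hξ := (hX.memLp_sub t t').integrable_sq
  have hξm := hX.measurable_sub t t'
  have mp := hX.measurable_sub s t
  have mf := hX.measurable_sub t' u
  have bd : ∀ x : ℝ, |min 1 (|x|)| ≤ 1 := fun x => by
    rw [abs_of_nonneg (le_min zero_le_one (abs_nonneg _))]; exact min_le_left _ _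
  have mm : Measurable fun x : ℝ => min 1 |x| := by fun_prop
  have ip : Integrable (fun ω => min 1 |X t ω - X s ω| * (X t' ω - X t ω) ^ 2) P :=
    integrable_bdd_mul (mm.comp mp) (fun ω => bd _) hξ
  have iF : Integrable (fun ω => min 1 |X u ω - X t' ω| * (X t' ω - X t ω) ^ 2) P :=
    integrable_bdd_mul (mm.comp mf) (fun ω => bd _) hξ
  -- The past increment is known at time `t`, so the squared increment contributes its conditional
  -- mean `t' - t`, and `E|X_t - X_s| ≤ √H`.
  have past : ∫ ω, min 1 |X t ω - X s ω| * (X t' ω - X t ω) ^ 2 ∂P ≤ (t' - t) * √H := by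
    have hp : IsPast 𝓕 t (fun ω => min 1 |X t ω - X s ω|) := fun v hv =>
      mm.comp ((IsPast.eval hX le_rfl v hv).sub (IsPast.eval hX hst v hv))
    rw [hX.integral_past_mul_sub_sq htt hp (fun ω => bd _)]
    refine mul_le_mul_of_nonneg_left ?_ (by linarith)
    calc ∫ ω, min 1 |X t ω - X s ω| ∂P ≤ ∫ ω, |X t ω - X s ω| ∂P := by
          refine integral_mono_of_nonneg (Eventually.of_forall fun ω =>
            le_min zero_le_one (abs_nonneg _)) ((hX.memLp_sub s t).integrable one_le_two).abs
            (Eventually.of_forall fun ω => min_le_right _ _)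
      _ ≤ √|(t : ℝ) - s| := hX.integral_abs_sub_le s t
      _ ≤ √H := by
          apply Real.sqrt_le_sqrt; rw [abs_of_nonneg (by linarith)]; linarith
  have future : ∫ ω, min 1 |X u ω - X t' ω| * (X t' ω - X t ω) ^ 2 ∂P ≤ (t' - t) * √H := by
    -- Here the squared increment plays the role of the past. It is truncated at `N`, since only
    -- bounded variables may multiply the future; dominated convergence removes the truncation.
    have step : ∀ N : ℕ, ∫ ω, min 1 |X u ω - X t' ω| * min ((X t' ω - X t ω) ^ 2) N ∂P
        ≤ (t' - t) * √H := by
      intro N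
      have b0 : ∀ ω, 0 ≤ min ((X t' ω - X t ω) ^ 2) (N : ℝ) := fun ω =>
        le_min (sq_nonneg _) (Nat.cast_nonneg N)
      have bN : ∀ ω, |min ((X t' ω - X t ω) ^ 2) (N : ℝ)| ≤ N := fun ω => by
        rw [abs_of_nonneg (b0 ω)]; exact min_le_right _ _
      have hp : IsPast 𝓕 t' (fun ω => min ((X t' ω - X t ω) ^ 2) (N : ℝ)) := fun v hv =>
        (((IsPast.eval hX le_rfl v hv).sub (IsPast.eval hX htt.le v hv)).pow_const 2).min
          measurable_const
      have hm := hp.measurable hX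
      have i1 : Integrable (fun ω => min ((X t' ω - X t ω) ^ 2) (N : ℝ)) P :=
        Integrable.of_bound hm.aestronglyMeasurable N (Eventually.of_forall bN)
      have i2 : Integrable (fun ω => min ((X t' ω - X t ω) ^ 2) (N : ℝ) *
          (X u ω - X t' ω) ^ 2) P :=
        integrable_bdd_mul hm bN (hX.memLp_sub t' u).integrable_sq
      have e1 : ∫ ω, min ((X t' ω - X t ω) ^ 2) (N : ℝ) ∂P ≤ t' - t := by
        calc _ ≤ ∫ ω, (X t' ω - X t ω) ^ 2 ∂P :=
              integral_mono i1 hξ fun ω => min_le_left _ _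
          _ = t' - t := by rw [hX.integral_sub_sq, abs_of_pos (by linarith)]
      have e2 : ∫ ω, min ((X t' ω - X t ω) ^ 2) (N : ℝ) * (X u ω - X t' ω) ^ 2 ∂P
          = ((u : ℝ) - t') * ∫ ω, min ((X t' ω - X t ω) ^ 2) (N : ℝ) ∂P := by
        rcases htu.eq_or_lt with rfl | htu
        · simp
        · exact hX.integral_past_mul_sub_sq htu hp bN
      have e0 : 0 ≤ ∫ ω, min ((X t' ω - X t ω) ^ 2) (N : ℝ) ∂P := integral_nonneg b0
      calc ∫ ω, min 1 |X u ω - X t' ω| * min ((X t' ω - X t ω) ^ 2) N ∂P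
          ≤ ∫ ω, (√H / 2 * min ((X t' ω - X t ω) ^ 2) (N : ℝ)
            + 1 / (2 * √H) * (min ((X t' ω - X t ω) ^ 2) (N : ℝ) * (X u ω - X t' ω) ^ 2)) ∂P := by
            refine integral_mono (integrable_bdd_mul (mm.comp mf) (fun ω => bd _) i1)
              ((i1.const_mul _).add (i2.const_mul _)) fun ω => ?_
            -- Inequality of arithmetic and geometric means, balanced at `√H` because the future
            -- increment has conditional second moment `u - t' ≤ H`.
            have k : min 1 |X u ω - X t' ω|
                ≤ √H / 2 + 1 / (2 * √H) * (X u ω - X t' ω) ^ 2 := by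
              refine (min_le_right _ _).trans ?_
              rw [← sq_abs (X u ω - X t' ω)]
              set x := |X u ω - X t' ω|
              have : √H / 2 + 1 / (2 * √H) * x ^ 2 - x = (√H - x) ^ 2 / (2 * √H) := by
                field_simp; ring
              have h0 : 0 ≤ (√H - x) ^ 2 / (2 * √H) := by positivity
              linarith
            calc min 1 |X u ω - X t' ω| * min ((X t' ω - X t ω) ^ 2) (N : ℝ)
                ≤ _ := mul_le_mul_of_nonneg_right k (b0 ω)
              _ = _ := by ring
        _ = √H / 2 * ∫ ω, min ((X t' ω - X t ω) ^ 2) (N : ℝ) ∂P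
            + 1 / (2 * √H) * (((u : ℝ) - t') * ∫ ω, min ((X t' ω - X t ω) ^ 2) (N : ℝ) ∂P) := by
            rw [integral_add (i1.const_mul _) (i2.const_mul _), integral_const_mul,
              integral_const_mul, e2]
        _ ≤ √H / 2 * ∫ ω, min ((X t' ω - X t ω) ^ 2) (N : ℝ) ∂P
            + 1 / (2 * √H) * (H * ∫ ω, min ((X t' ω - X t ω) ^ 2) (N : ℝ) ∂P) := by
            gcongr
            simp only [hH]; linarith
        _ = (∫ ω, min ((X t' ω - X t ω) ^ 2) (N : ℝ) ∂P) * √H := by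
            nth_rewrite 3 [← Real.mul_self_sqrt hHpos.le]
            field_simp; ring
        _ ≤ (t' - t) * √H := by gcongr
    have lim : Tendsto (fun N : ℕ => ∫ ω, min 1 |X u ω - X t' ω| *
        min ((X t' ω - X t ω) ^ 2) N ∂P) atTop
        (𝓝 (∫ ω, min 1 |X u ω - X t' ω| * (X t' ω - X t ω) ^ 2 ∂P)) := by
      refine tendsto_integral_of_dominated_convergence (fun ω => (X t' ω - X t ω) ^ 2)
        (fun N => ?_) hξ (fun N => Eventually.of_forall fun ω => ?_)
        (Eventually.of_forall fun ω => ?_)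
      · exact ((mm.comp mf).mul ((hξm.pow_const 2).min measurable_const)).aestronglyMeasurable
      · rw [Real.norm_eq_abs, abs_mul,
          abs_of_nonneg (le_min (sq_nonneg (X t' ω - X t ω)) (Nat.cast_nonneg N))]
        calc _ ≤ 1 * (X t' ω - X t ω) ^ 2 :=
              mul_le_mul (bd _) (min_le_left _ _) (le_min (sq_nonneg _) (Nat.cast_nonneg N))
                zero_le_one
          _ = _ := one_mul _
      · refine tendsto_const_nhds.mul (tendsto_const_nhds.congr' ?_)
        obtain ⟨N₀, hN₀⟩ := exists_nat_ge ((X t' ω - X t ω) ^ 2)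
        filter_upwards [eventually_ge_atTop N₀] with N hN
        rw [min_eq_left (hN₀.trans (Nat.cast_le.2 hN))]
    exact le_of_tendsto' lim step
  have i1 : Integrable (fun ω => g (X t' ω - X t ω) * (X t' ω - X t ω) ^ 2) P :=
    integrable_bdd_mul (hg.comp hξm) (fun ω => hC _) hξ
  have i2 : Integrable (fun ω => g (X u ω - X s ω) * (X t' ω - X t ω) ^ 2) P :=
    integrable_bdd_mul (hg.comp (hX.measurable_sub s u)) (fun ω => hC _) hξ
  rw [← integral_sub i1 i2, ← Real.norm_eq_abs]
  calc ‖∫ ω, (g (X t' ω - X t ω) * (X t' ω - X t ω) ^ 2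
        - g (X u ω - X s ω) * (X t' ω - X t ω) ^ 2) ∂P‖
      ≤ ∫ ω, (C * (min 1 |X t ω - X s ω| * (X t' ω - X t ω) ^ 2)
        + C * (min 1 |X u ω - X t' ω| * (X t' ω - X t ω) ^ 2)) ∂P := by
        refine norm_integral_le_of_norm_le ((ip.const_mul _).add (iF.const_mul _))
          (Eventually.of_forall fun ω => ?_)
        rw [← sub_mul, Real.norm_eq_abs, abs_mul, abs_of_nonneg (sq_nonneg (X t' ω - X t ω)),
          ← mul_add, ← add_mul, ← mul_assoc]
        refine mul_le_mul_of_nonneg_right ((hL _ _).trans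
          (mul_le_mul_of_nonneg_left ?_ hC0)) (sq_nonneg _)
        have tri : |X t' ω - X t ω - (X u ω - X s ω)| ≤ |X t ω - X s ω| + |X u ω - X t' ω| := by
          have : X t' ω - X t ω - (X u ω - X s ω) = -(X t ω - X s ω) - (X u ω - X t' ω) := by ring
          rw [this]
          exact (abs_sub _ _).trans (by rw [abs_neg])
        have n1 := abs_nonneg (X t ω - X s ω)
        have n2 := abs_nonneg (X u ω - X t' ω)
        rcases le_total 1 |X t ω - X s ω| with q | q
        · rw [min_eq_left q]
          exact (min_le_left _ _).trans (by linarith [le_min zero_le_one n2])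
        · rcases le_total 1 |X u ω - X t' ω| with q' | q'
          · rw [min_eq_left q']
            exact (min_le_left _ _).trans (by linarith [le_min zero_le_one n1])
          · rw [min_eq_right q, min_eq_right q']
            exact (min_le_right _ _).trans tri
    _ ≤ C * ((t' - t) * √H) + C * ((t' - t) * √H) := by
        rw [integral_add (ip.const_mul _) (iF.const_mul _), integral_const_mul,
          integral_const_mul]
        gcongr
    _ = 2 * C * √H * (t' - t) := by ring

end IsQuadraticHarness

end Increments

/-! ### Weights used to localize the jump size -/

/-- Bounded Lipschitz weights. -/
structure IsWeight (C : ℝ) (g : ℝ → ℝ) : Prop where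
  measurable : Measurable g
  bound : ∀ x, |g x| ≤ C
  lipschitz : ∀ x y, |g x - g y| ≤ C * min 1 |x - y|

namespace IsWeight

theorem nonneg {C : ℝ} {g : ℝ → ℝ} (hg : IsWeight C g) : 0 ≤ C := (abs_nonneg _).trans (hg.bound 0)

theorem mono {C D : ℝ} {g : ℝ → ℝ} (hg : IsWeight C g) (h : C ≤ D) : IsWeight D g :=
  ⟨hg.measurable, fun x => (hg.bound x).trans h, fun x y => (hg.lipschitz x y).trans
    (mul_le_mul_of_nonneg_right h (le_min zero_le_one (abs_nonneg _)))⟩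

theorem of_lipschitz {C : ℝ} {g : ℝ → ℝ} (hm : Measurable g) (hb : ∀ x, |g x| ≤ C)
    (hl : ∀ x y, |g x - g y| ≤ C * |x - y|) : IsWeight (2 * C) g := by
  have h0 : 0 ≤ C := (abs_nonneg _).trans (hb 0)
  refine ⟨hm, fun x => (hb x).trans (by linarith), fun x y => ?_⟩
  rcases le_total 1 |x - y| with h | h
  · rw [min_eq_left h]
    calc |g x - g y| ≤ |g x| + |g y| := abs_sub _ _
      _ ≤ 2 * C * 1 := by linarith [hb x, hb y]
  · rw [min_eq_right h]
    have := hl x y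
    have h1 := mul_nonneg h0 (abs_nonneg (x - y))
    linarith

theorem add {C D : ℝ} {g k : ℝ → ℝ} (hg : IsWeight C g) (hk : IsWeight D k) :
    IsWeight (C + D) (fun x => g x + k x) := by
  refine ⟨hg.measurable.add hk.measurable, fun x => (abs_add_le _ _).trans
    (add_le_add (hg.bound x) (hk.bound x)), fun x y => ?_⟩
  have : g x + k x - (g y + k y) = (g x - g y) + (k x - k y) := by ring
  rw [this, add_mul]
  exact (abs_add_le _ _).trans (add_le_add (hg.lipschitz x y) (hk.lipschitz x y))

theorem const_mul {C : ℝ} {g : ℝ → ℝ} (hg : IsWeight C g) (a : ℝ) :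
    IsWeight (|a| * C) (fun x => a * g x) := by
  refine ⟨hg.measurable.const_mul a, fun x => ?_, fun x y => ?_⟩
  · rw [abs_mul]; exact mul_le_mul_of_nonneg_left (hg.bound x) (abs_nonneg a)
  · rw [← mul_sub, abs_mul, mul_assoc]
    exact mul_le_mul_of_nonneg_left (hg.lipschitz x y) (abs_nonneg a)

end IsWeight

/-- The weight `y / (1 + y²)`, centered at `c`. -/
noncomputable def cauchyWeight (c x : ℝ) : ℝ := (x - c) / (1 + (x - c) ^ 2)

theorem isWeight_cauchyWeight (c : ℝ) : IsWeight 2 (cauchyWeight c) := by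
  have hm : Measurable (cauchyWeight c) := by unfold cauchyWeight; fun_prop
  rw [show (2 : ℝ) = 2 * 1 by norm_num]
  refine IsWeight.of_lipschitz hm (fun x => ?_) (fun x y => ?_)
  · have h : 0 < 1 + (x - c) ^ 2 := by positivity
    rw [cauchyWeight, abs_div, abs_of_pos h, div_le_one h, ← sq_abs (x - c)]
    nlinarith [sq_nonneg (|x - c| - 1), abs_nonneg (x - c)]
  · have hx : 0 < 1 + (x - c) ^ 2 := by positivity
    have hy : 0 < 1 + (y - c) ^ 2 := by positivity
    -- The difference quotient of `y / (1 + y²)` is explicit and bounded by one in absolute value.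
    have e : cauchyWeight c x - cauchyWeight c y
        = (1 - (x - c) * (y - c)) / ((1 + (x - c) ^ 2) * (1 + (y - c) ^ 2)) * (x - y) := by
      rw [cauchyWeight, cauchyWeight]; field_simp; ring
    rw [e, abs_mul, abs_div, abs_of_pos (mul_pos hx hy)]
    refine mul_le_mul_of_nonneg_right ?_ (abs_nonneg _)
    rw [div_le_one (mul_pos hx hy), abs_le]
    constructor <;>
      nlinarith [sq_nonneg ((x - c) + (y - c)), sq_nonneg ((x - c) - (y - c)),
        mul_nonneg (sq_nonneg (x - c)) (sq_nonneg (y - c))]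

theorem isWeight_id_mul_cauchyWeight (c : ℝ) :
    IsWeight (2 + |c| * 2) (fun x => x * cauchyWeight c x) := by
  have h1 : IsWeight 2 (fun x => (x - c) * cauchyWeight c x) := by
    have hm : Measurable (fun x => (x - c) * cauchyWeight c x) :=
      (measurable_id.sub_const c).mul (isWeight_cauchyWeight c).measurable
    rw [show (2 : ℝ) = 2 * 1 by norm_num]
    refine IsWeight.of_lipschitz hm (fun x => ?_) (fun x y => ?_)
    · have h : 0 < 1 + (x - c) ^ 2 := by positivity
      have e : (x - c) * cauchyWeight c x = (x - c) ^ 2 / (1 + (x - c) ^ 2) := by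
        rw [cauchyWeight]; ring
      rw [e, abs_of_nonneg (by positivity), div_le_one h]
      linarith
    · have hx : 0 < 1 + (x - c) ^ 2 := by positivity
      have hy : 0 < 1 + (y - c) ^ 2 := by positivity
      have e : (x - c) * cauchyWeight c x - (y - c) * cauchyWeight c y
          = ((x - c) + (y - c)) / ((1 + (x - c) ^ 2) * (1 + (y - c) ^ 2)) * (x - y) := by
        rw [cauchyWeight, cauchyWeight]; field_simp; ring
      rw [e, abs_mul, abs_div, abs_of_pos (mul_pos hx hy)]
      refine mul_le_mul_of_nonneg_right ?_ (abs_nonneg _)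
      rw [div_le_one (mul_pos hx hy), abs_le]
      constructor <;>
        nlinarith [sq_nonneg ((x - c) + 1), sq_nonneg ((x - c) - 1), sq_nonneg ((y - c) + 1),
          sq_nonneg ((y - c) - 1), mul_nonneg (sq_nonneg (x - c)) (sq_nonneg (y - c))]
  have h2 := h1.add ((isWeight_cauchyWeight c).const_mul c)
  have e : (fun x => x * cauchyWeight c x)
      = fun x => (x - c) * cauchyWeight c x + c * cauchyWeight c x := by
    funext x; ring
  rw [e]; exact h2

/-! ### Weighted quadratic variation on three scales -/

section MeshSums

variable {Ω : Type*} {mΩ : MeasurableSpace Ω}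

/-- The expected sum of squared increments along `t 0, …, t N`, weighted by `g`. -/
noncomputable def meshSum (P : Measure Ω) (X : Set.Ioi (0 : ℝ) → Ω → ℝ) (g : ℝ → ℝ)
    (t : ℕ → Set.Ioi (0 : ℝ)) (N : ℕ) : ℝ :=
  ∑ k ∈ Finset.range N,
    ∫ ω, g (X (t (k + 1)) ω - X (t k) ω) * (X (t (k + 1)) ω - X (t k) ω) ^ 2 ∂P

/-- The expected weighted sum of the (predicted) quadratic variation `H + θ d` over the increments
`d` along `t 0, …, t N`. -/
noncomputable def coarseSum (P : Measure Ω) (X : Set.Ioi (0 : ℝ) → Ω → ℝ) (θ H : ℝ) (g : ℝ → ℝ)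
    (t : ℕ → Set.Ioi (0 : ℝ)) (N : ℕ) : ℝ :=
  ∑ k ∈ Finset.range N,
    ∫ ω, g (X (t (k + 1)) ω - X (t k) ω) * (H + θ * (X (t (k + 1)) ω - X (t k) ω)) ∂P

theorem sum_range_mul_blocks (f : ℕ → ℝ) (M n : ℕ) :
    ∑ i ∈ Finset.range (M * n), f i
      = ∑ k ∈ Finset.range M, ∑ j ∈ Finset.range n, f (n * k + j) := by
  induction M with
  | zero => simp
  | succ M ih =>
    rw [Nat.succ_mul, Finset.sum_range_add, Finset.sum_range_succ, ih, Nat.mul_comm n M]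

variable {P : Measure Ω}
  {𝓕 : Set.Ioi (0 : ℝ) → Set.Ioi (0 : ℝ) → MeasurableSpace Ω}
  {X : Set.Ioi (0 : ℝ) → Ω → ℝ} {θ : ℝ}

namespace IsQuadraticHarness

/-- One block of `n` steps. Replacing the weight of each small increment by that of the block
increment costs the first error term; after that the conditional second moments are exact, and the
second error term is the `1/n` part of `A/n + (1 - 1/n) B`. -/
theorem abs_block_sub_le [IsProbabilityMeasure P] (hX : IsQuadraticHarness P 𝓕 X 0 θ 0 0 1)
    {C : ℝ} {g : ℝ → ℝ}
    (hg : IsWeight C g) {t : ℕ → Set.Ioi (0 : ℝ)} {δ : ℝ} (hδ : 0 < δ)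
    (ht : ∀ k, (t k : ℝ) = t 0 + k * δ) (m : ℕ) {n : ℕ} (hn : 0 < n) :
    |∑ j ∈ Finset.range n, ∫ ω, g (X (t (m + j + 1)) ω - X (t (m + j)) ω) *
        (X (t (m + j + 1)) ω - X (t (m + j)) ω) ^ 2 ∂P
      - ∫ ω, g (X (t (m + n)) ω - X (t m) ω) *
        (n * δ + θ * (X (t (m + n)) ω - X (t m) ω)) ∂P|
      ≤ 2 * C * (n * δ) * √(n * δ) + C / n * (2 * (n * δ) + |θ| * √(n * δ)) := by
  have hn' : (0 : ℝ) < n := Nat.cast_pos.2 hn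
  have hC0 := hg.nonneg
  set s := t m
  set u := t (m + n)
  set H : ℝ := n * δ with hH
  have hHpos : 0 < H := by positivity
  have hu : (u : ℝ) - s = H := by
    simp only [u, s, ht (m + n), ht m, hH]; push_cast; ring
  have hsu : s < u := Subtype.coe_lt_coe.1 (by linarith)
  have hlt : ∀ j, t (m + j) < t (m + j + 1) := fun j => Subtype.coe_lt_coe.1 (by
    rw [ht (m + j), ht (m + j + 1)]; push_cast; linarith)
  have hst : ∀ j, s ≤ t (m + j) := fun j => Subtype.coe_le_coe.1 (by
    have : (0 : ℝ) ≤ j * δ := by positivity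
    simp only [s]
    rw [ht m, ht (m + j)]; push_cast; linarith)
  have htu : ∀ j ∈ Finset.range n, t (m + j + 1) ≤ u := fun j hj => Subtype.coe_le_coe.1 (by
    have h1 : (j : ℝ) + 1 ≤ n := by exact_mod_cast Finset.mem_range.1 hj
    have : (j + 1 : ℝ) * δ ≤ n * δ := by gcongr
    simp only [u]
    rw [ht (m + n), ht (m + j + 1)]; push_cast; linarith)
  have hd : Measurable[𝓕 s u] (fun ω => g (X u ω - X s ω)) :=
    hg.measurable.comp ((hX.adapted s u u hsu (Or.inr le_rfl)).sub
      (hX.adapted s u s hsu (Or.inl le_rfl)))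
  set A := ∫ ω, g (X u ω - X s ω) * (X u ω - X s ω) ^ 2 ∂P
  set B := ∫ ω, g (X u ω - X s ω) * (H + θ * (X u ω - X s ω)) ∂P
  have hfine : ∀ j ∈ Finset.range n,
      ∫ ω, g (X u ω - X s ω) * (X (t (m + j + 1)) ω - X (t (m + j)) ω) ^ 2 ∂P
        = (1 / n) ^ 2 * A + (1 / n) * (1 - 1 / n) * B := by
    intro j hj
    rw [hX.integral_mul_sub_sq (hst j) (hlt j) (htu j hj) hd (fun ω => hg.bound _), hu]
    have : (t (m + j + 1) : ℝ) - t (m + j) = δ := by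
      rw [ht (m + j), ht (m + j + 1)]; push_cast; ring
    rw [this, hH]
    congr 1
    · congr 1; field_simp
    · congr 1; field_simp
  have hA : |A| ≤ C * H := by
    have := hX.abs_integral_mul_sub_sq_le (h := fun ω => g (X u ω - X s ω)) (fun ω => hg.bound _)
      s u
    rwa [hu, abs_of_pos hHpos] at this
  have hB : |B| ≤ C * (H + |θ| * √H) := by
    have i0 := ((hX.memLp_sub s u).integrable one_le_two)
    refine (abs_integral_mul_le (f := fun ω => H + θ * (X u ω - X s ω)) (fun ω => hg.bound _)
      ((integrable_const H).add (i0.const_mul θ))).trans ?_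
    refine mul_le_mul_of_nonneg_left ?_ hC0
    calc ∫ ω, |H + θ * (X u ω - X s ω)| ∂P
        ≤ ∫ ω, (H + |θ| * |X u ω - X s ω|) ∂P := by
          refine integral_mono ((integrable_const H).add (i0.const_mul θ)).abs
            ((integrable_const H).add (i0.abs.const_mul _)) fun ω => ?_
          refine (abs_add_le H _).trans (le_of_eq ?_)
          rw [abs_of_pos hHpos, abs_mul θ]
      _ = H + |θ| * ∫ ω, |X u ω - X s ω| ∂P := by
          rw [integral_add (integrable_const H) (i0.abs.const_mul _),
            integral_const_mul |θ|, integral_const,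
            probReal_univ, one_smul]
      _ ≤ H + |θ| * √H := by
          have := hX.integral_abs_sub_le s u
          rw [hu, abs_of_pos hHpos] at this
          gcongr
  have hstep : |∑ j ∈ Finset.range n, ∫ ω, g (X (t (m + j + 1)) ω - X (t (m + j)) ω) *
        (X (t (m + j + 1)) ω - X (t (m + j)) ω) ^ 2 ∂P
      - ∑ j ∈ Finset.range n, ∫ ω, g (X u ω - X s ω) *
        (X (t (m + j + 1)) ω - X (t (m + j)) ω) ^ 2 ∂P| ≤ 2 * C * H * √H := by
    rw [← Finset.sum_sub_distrib]
    refine (Finset.abs_sum_le_sum_abs _ _).trans ?_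
    calc _ ≤ ∑ j ∈ Finset.range n, 2 * C * √H * δ := by
          refine Finset.sum_le_sum fun j hj => ?_
          have := hX.abs_integral_weight_sub_le (hst j) (hlt j) (htu j hj) hg.measurable hg.bound
            hg.lipschitz
          have e : (t (m + j + 1) : ℝ) - t (m + j) = δ := by
            rw [ht (m + j), ht (m + j + 1)]; push_cast; ring
          rwa [hu, e] at this
      _ = 2 * C * H * √H := by
          rw [Finset.sum_const, Finset.card_range, nsmul_eq_mul, hH]; ring
  rw [Finset.sum_congr rfl hfine, Finset.sum_const, Finset.card_range, nsmul_eq_mul] at hstep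
  set S := ∑ j ∈ Finset.range n, ∫ ω, g (X (t (m + j + 1)) ω - X (t (m + j)) ω) *
        (X (t (m + j + 1)) ω - X (t (m + j)) ω) ^ 2 ∂P
  have e : S - B = (S - n * ((1 / n) ^ 2 * A + (1 / n) * (1 - 1 / n) * B)) + 1 / n * (A - B) := by
    field_simp; ring
  rw [e]
  refine (abs_add_le _ _).trans (add_le_add hstep ?_)
  rw [abs_mul, abs_of_pos (by positivity : (0 : ℝ) < 1 / n)]
  calc 1 / (n : ℝ) * |A - B| ≤ 1 / n * (C * H + C * (H + |θ| * √H)) := by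
        gcongr
        exact (abs_sub _ _).trans (add_le_add hA hB)
    _ = C / n * (2 * H + |θ| * √H) := by ring

/-- The `1/n` error occurs once in each of the `M` blocks; `M ≤ n` keeps its total bounded by a
block-size quantity that tends to zero. -/
theorem abs_meshSum_sub_coarseSum_le [IsProbabilityMeasure P] (hX : IsQuadraticHarness P 𝓕 X 0 θ 0 0 1)
    {C : ℝ}
    {g : ℝ → ℝ} (hg : IsWeight C g) {t : ℕ → Set.Ioi (0 : ℝ)} {δ : ℝ} (hδ : 0 < δ)
    (ht : ∀ k, (t k : ℝ) = t 0 + k * δ) {M n : ℕ} (hn : 0 < n) (hMn : M ≤ n) {x : ℝ} (hx : 0 ≤ x)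
    (hxH : n * δ ≤ x ^ 2) :
    |meshSum P X g t (M * n) - coarseSum P X θ (n * δ) g (fun k => t (n * k)) M|
      ≤ 2 * C * (M * n * δ) * x + C * (2 * x ^ 2 + |θ| * x) := by
  have hn' : (0 : ℝ) < n := Nat.cast_pos.2 hn
  have hC0 := hg.nonneg
  have hsq : √(n * δ) ≤ x := by rw [Real.sqrt_le_left hx]; exact hxH
  have hMn' : (M : ℝ) / n ≤ 1 := by
    rw [div_le_one hn']; exact_mod_cast hMn
  rw [meshSum, sum_range_mul_blocks, coarseSum, ← Finset.sum_sub_distrib]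
  refine (Finset.abs_sum_le_sum_abs _ _).trans ?_
  calc _ ≤ ∑ k ∈ Finset.range M,
        (2 * C * (n * δ) * √(n * δ) + C / n * (2 * (n * δ) + |θ| * √(n * δ))) := by
        refine Finset.sum_le_sum fun k _ => ?_
        have := hX.abs_block_sub_le hg hδ ht (n * k) hn
        rwa [show n * k + n = n * (k + 1) by ring] at this
    _ = 2 * C * (M * n * δ) * √(n * δ)
        + (M / n) * (C * (2 * (n * δ) + |θ| * √(n * δ))) := by
        rw [Finset.sum_const, Finset.card_range, nsmul_eq_mul]; ring
    _ ≤ 2 * C * (M * n * δ) * x + 1 * (C * (2 * x ^ 2 + |θ| * x)) := by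
        gcongr
    _ = _ := by rw [one_mul]

/-- For a weight `y k(y)` the prediction reads `k(y) (H y + θ y²)`. The term with `H y` is
negligible, as `E|y| ≤ √H`, so the factor `y` has been exchanged for `θ`. -/
theorem abs_coarseSum_sub_meshSum_le [IsProbabilityMeasure P] (hX : IsQuadraticHarness P 𝓕 X 0 θ 0 0 1)
    {C : ℝ}
    {k : ℝ → ℝ} (hk : IsWeight C k) {t : ℕ → Set.Ioi (0 : ℝ)} {H : ℝ} (hH : 0 < H)
    (ht : ∀ i, (t i : ℝ) = t 0 + i * H) (M : ℕ) {x : ℝ} (hx : 0 ≤ x) (hxH : H ≤ x ^ 2) :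
    |coarseSum P X θ H (fun y => y * k y) t M - θ * meshSum P X k t M| ≤ C * (M * H) * x := by
  have hC0 := hk.nonneg
  have hsq : √H ≤ x := by rw [Real.sqrt_le_left hx]; exact hxH
  rw [coarseSum, meshSum, Finset.mul_sum, ← Finset.sum_sub_distrib]
  refine (Finset.abs_sum_le_sum_abs _ _).trans ?_
  calc _ ≤ ∑ i ∈ Finset.range M, C * H * x := by
        refine Finset.sum_le_sum fun i _ => ?_
        have hm := hk.measurable.comp (hX.measurable_sub (t i) (t (i + 1)))
        have i1 : Integrable (fun ω => k (X (t (i + 1)) ω - X (t i) ω) *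
            (X (t (i + 1)) ω - X (t i) ω)) P :=
          integrable_bdd_mul hm (fun ω => hk.bound _)
            ((hX.memLp_sub (t i) (t (i + 1))).integrable one_le_two)
        have i2 : Integrable (fun ω => k (X (t (i + 1)) ω - X (t i) ω) *
            (X (t (i + 1)) ω - X (t i) ω) ^ 2) P :=
          integrable_bdd_mul hm (fun ω => hk.bound _)
            (hX.memLp_sub (t i) (t (i + 1))).integrable_sq
        have e : ∀ ω, (X (t (i + 1)) ω - X (t i) ω) * k (X (t (i + 1)) ω - X (t i) ω) *
            (H + θ * (X (t (i + 1)) ω - X (t i) ω))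
            = H * (k (X (t (i + 1)) ω - X (t i) ω) * (X (t (i + 1)) ω - X (t i) ω))
              + θ * (k (X (t (i + 1)) ω - X (t i) ω) * (X (t (i + 1)) ω - X (t i) ω) ^ 2) :=
          fun ω => by ring
        simp_rw [e]
        rw [integral_add (i1.const_mul _) (i2.const_mul _), integral_const_mul,
          integral_const_mul, add_sub_cancel_right, abs_mul, abs_of_pos hH]
        have := hX.abs_integral_mul_sub_le
          (h := fun ω => k (X (t (i + 1)) ω - X (t i) ω)) (fun ω => hk.bound _) (t i) (t (i + 1))
        have e2 : (t (i + 1) : ℝ) - t i = H := by rw [ht i, ht (i + 1)]; push_cast; ring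
        rw [e2, abs_of_pos hH] at this
        calc _ ≤ H * (C * √H) := mul_le_mul_of_nonneg_left this hH.le
          _ ≤ H * (C * x) := by gcongr
          _ = C * H * x := by ring
    _ = C * (M * H) * x := by
        rw [Finset.sum_const, Finset.card_range, nsmul_eq_mul]; ring

theorem meshSum_sub (hX : IsQuadraticHarness P 𝓕 X 0 θ 0 0 1) {C : ℝ} {g k : ℝ → ℝ}
    (hg : IsWeight C g) (hk : IsWeight C k) (c : ℝ) (t : ℕ → Set.Ioi (0 : ℝ)) (N : ℕ) :
    meshSum P X (fun y => g y - c * k y) t N = meshSum P X g t N - c * meshSum P X k t N := by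
  rw [meshSum, meshSum, meshSum, Finset.mul_sum, ← Finset.sum_sub_distrib]
  refine Finset.sum_congr rfl fun i _ => ?_
  have hd := hX.measurable_sub (t i) (t (i + 1))
  have hL := (hX.memLp_sub (t i) (t (i + 1))).integrable_sq
  have i1 : Integrable (fun ω => g (X (t (i + 1)) ω - X (t i) ω) *
      (X (t (i + 1)) ω - X (t i) ω) ^ 2) P :=
    integrable_bdd_mul (hg.measurable.comp hd) (fun ω => hg.bound _) hL
  have i2 : Integrable (fun ω => k (X (t (i + 1)) ω - X (t i) ω) *
      (X (t (i + 1)) ω - X (t i) ω) ^ 2) P :=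
    integrable_bdd_mul (hk.measurable.comp hd) (fun ω => hk.bound _) hL
  rw [← integral_const_mul, ← integral_sub i1 (i2.const_mul c)]
  congr with ω
  ring

/-- The squared increments of size away from `θ` are negligible: three scales. -/
theorem abs_meshSum_le [IsProbabilityMeasure P] (hX : IsQuadraticHarness P 𝓕 X 0 θ 0 0 1)
    {C : ℝ} {k : ℝ → ℝ}
    (hk : IsWeight C k) (hxk : IsWeight C (fun y => y * k y)) {t : ℕ → Set.Ioi (0 : ℝ)}
    {L : ℝ} (hL : 0 < L) {j : ℕ} (hj : 0 < j) (ht : ∀ i, (t i : ℝ) = t 0 + i * (L / j ^ 4)) :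
    |meshSum P X (fun y => y * k y - θ * k y) t (j ^ 4)|
      ≤ (1 + 2 * |θ|) * (2 * C * L * √(L / j) + C * (2 * √(L / j) ^ 2 + |θ| * √(L / j)))
        + C * L * √(L / j) := by
  have hj' : (0 : ℝ) < j := Nat.cast_pos.2 hj
  have hj1 : (1 : ℝ) ≤ j := Nat.one_le_cast.2 hj
  set x := √(L / j) with hx
  have hx0 : 0 ≤ x := Real.sqrt_nonneg _
  have hx2 : x ^ 2 = L / j := Real.sq_sqrt (by positivity)
  have hδ : 0 < L / (j : ℝ) ^ 4 := by positivity
  have hj3 : j ≤ j ^ 3 := Nat.le_self_pow (by norm_num) j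
  have hmid : ∀ i, (t (j ^ 2 * i) : ℝ) = t (j ^ 2 * 0) + i * (L / j ^ 2) := fun i => by
    rw [ht (j ^ 2 * i), mul_zero]; push_cast; field_simp
  have hle : L / (j : ℝ) ^ 2 ≤ x ^ 2 := by
    rw [hx2]
    exact div_le_div_of_nonneg_left hL.le hj' (by nlinarith)
  have c1 : ((j ^ 2 : ℕ) : ℝ) * (L / j ^ 4) = L / j ^ 2 := by push_cast; field_simp
  have c2 : ((j ^ 3 : ℕ) : ℝ) * (L / j ^ 4) = L / j := by push_cast; field_simp
  have c3 : (j : ℝ) * (L / j ^ 2) = L / j := by field_simp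
  -- The steps are `L/j⁴`, `L/j²` and `L/j`. The chain runs from the fine sum of `y k` to its middle
  -- prediction, which is `θ` times the middle sum of `k`; then the middle and the fine sums of `k`
  -- are compared through their common coarse prediction. In each comparison there are at most as
  -- many blocks as steps in a block, and every block has length at most `x² = L/j`.
  have e1 := hX.abs_meshSum_sub_coarseSum_le hxk hδ ht (M := j ^ 2) (n := j ^ 2) (by positivity)
    le_rfl hx0 (by rw [c1]; exact hle)
  have e2 := hX.abs_coarseSum_sub_meshSum_le hk (t := fun i => t (j ^ 2 * i)) (H := L / j ^ 2)
    (by positivity) hmid (j ^ 2) hx0 hle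
  have e3 := hX.abs_meshSum_sub_coarseSum_le hk (t := fun i => t (j ^ 2 * i)) (δ := L / j ^ 2)
    (by positivity) hmid (M := j) (n := j) hj le_rfl hx0 (by rw [c3, hx2])
  have e4 := hX.abs_meshSum_sub_coarseSum_le hk hδ ht (M := j) (n := j ^ 3) (by positivity)
    hj3 hx0 (by rw [c2, hx2])
  rw [c1, mul_assoc ((j ^ 2 : ℕ) : ℝ), c1] at e1
  rw [c3, mul_assoc (j : ℝ), c3] at e3
  rw [c2, mul_assoc (j : ℝ), c2] at e4
  have d1 : ((j ^ 2 : ℕ) : ℝ) * (L / j ^ 2) = L := by push_cast; field_simp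
  have d2 : (j : ℝ) * (L / j) = L := by field_simp
  rw [d1] at e1 e2
  rw [d2] at e3 e4
  rw [show j ^ 2 * j ^ 2 = j ^ 4 by ring] at e1
  rw [show j * j ^ 3 = j ^ 4 by ring] at e4
  rw [show j * j = j ^ 2 by ring] at e3
  have e5 : (fun i => t (j ^ 2 * (j * i))) = fun i => t (j ^ 3 * i) := by
    funext i; congr 1; ring
  simp only [e5] at e3
  rw [hX.meshSum_sub hxk hk]
  set S₁ := meshSum P X (fun y => y * k y) t (j ^ 4)
  set S₂ := meshSum P X k t (j ^ 4)
  set S₃ := meshSum P X k (fun i => t (j ^ 2 * i)) (j ^ 2)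
  set R₁ := coarseSum P X θ (L / j ^ 2) (fun y => y * k y) (fun i => t (j ^ 2 * i)) (j ^ 2)
  set R₂ := coarseSum P X θ (L / j) k (fun i => t (j ^ 3 * i)) j
  set E := 2 * C * L * x + C * (2 * x ^ 2 + |θ| * x)
  have key : S₁ - θ * S₂ = (S₁ - R₁) + (R₁ - θ * S₃) + (θ * (S₃ - R₂) - θ * (S₂ - R₂)) := by ring
  rw [key]
  calc _ ≤ |S₁ - R₁| + |R₁ - θ * S₃| + (|θ| * |S₃ - R₂| + |θ| * |S₂ - R₂|) := by
        refine (abs_add_le _ _).trans (add_le_add (abs_add_le _ _) ?_)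
        refine (abs_sub _ _).trans (le_of_eq ?_)
        rw [abs_mul, abs_mul]
    _ ≤ E + C * L * x + (|θ| * E + |θ| * E) := by gcongr
    _ = _ := by ring

/-- The equally spaced times `a, a + δ, a + 2 δ, …`. -/
def mesh (a : Set.Ioi (0 : ℝ)) (δ : ℝ≥0) (k : ℕ) : Set.Ioi (0 : ℝ) :=
  ⟨(a : ℝ) + k * δ, Set.mem_Ioi.2 (add_pos_of_pos_of_nonneg (Set.mem_Ioi.1 a.2) (by positivity))⟩

theorem mesh_zero (a : Set.Ioi (0 : ℝ)) (δ : ℝ≥0) : mesh a δ 0 = a := by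
  simp [mesh]

/-- In the limit, all the squared variation comes from increments close to `θ`. -/
theorem tendsto_meshSum [IsProbabilityMeasure P] (hX : IsQuadraticHarness P 𝓕 X 0 θ 0 0 1)
    (a : Set.Ioi (0 : ℝ)) {L : ℝ≥0}
    (hL : 0 < L) :
    Tendsto (fun j : ℕ => meshSum P X (fun y => (y - θ) ^ 2 / (1 + (y - θ) ^ 2))
      (mesh a (L / j ^ 4)) (j ^ 4)) atTop (𝓝 0) := by
  set C : ℝ := 2 + |θ| * 2
  have hk : IsWeight C (cauchyWeight θ) :=
    (isWeight_cauchyWeight θ).mono (by simp only [C]; linarith [abs_nonneg θ])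
  have hxk : IsWeight C (fun y => y * cauchyWeight θ y) := isWeight_id_mul_cauchyWeight θ
  have hx : Tendsto (fun j : ℕ => √((L : ℝ) / j)) atTop (𝓝 0) := by
    have := (tendsto_const_div_atTop_nhds_zero_nat (L : ℝ)).sqrt
    rwa [Real.sqrt_zero] at this
  have hφ : Tendsto (fun x : ℝ => (1 + 2 * |θ|) * (2 * C * L * x + C * (2 * x ^ 2 + |θ| * x))
        + C * L * x) (𝓝 0) (𝓝 0) := by
    have : Continuous (fun x : ℝ => (1 + 2 * |θ|) *
      (2 * C * L * x + C * (2 * x ^ 2 + |θ| * x)) + C * L * x) := by fun_prop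
    have h := this.tendsto 0
    simpa using h
  refine squeeze_zero_norm' ?_ (hφ.comp hx)
  filter_upwards [eventually_gt_atTop 0] with j hj
  -- Taking `k(y) = (y - θ)/(1 + (y - θ)²)` makes `y k - θ k` nonnegative, zero only at `θ`.
  have e : (fun y => (y - θ) ^ 2 / (1 + (y - θ) ^ 2))
      = fun y => y * cauchyWeight θ y - θ * cauchyWeight θ y := by
    funext y; rw [cauchyWeight]; ring
  rw [e, Real.norm_eq_abs]
  refine hX.abs_meshSum_le hk hxk (NNReal.coe_pos.2 hL) hj fun i => ?_
  simp [mesh]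

end IsQuadraticHarness

end MeshSums

/-! ### The Lévy exponent and a discrete Gronwall inequality -/

/-- `(e^{ilx} - 1 - ilx) / x²`, extended continuously to `x = 0`: as a function of `l`, the
exponent of a process with independent increments whose jumps have size `x`. -/
noncomputable def levyKernel (l x : ℝ) : ℂ :=
  -(l : ℂ) ^ 2 * ∫ v in (0 : ℝ)..1, (1 - (v : ℂ)) * Complex.exp (v * (l * x * Complex.I))

/-- Taylor's formula of order two with integral remainder. In this form the quotient by `x²` makes
sense at `x = 0`. -/
theorem levyKernel_mul_sq (l x : ℝ) :
    levyKernel l x * (x : ℂ) ^ 2 = Complex.exp (l * x * Complex.I) - 1 - l * x * Complex.I := by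
  set z : ℂ := l * x * Complex.I with hz
  have hz2 : z ^ 2 = -((l : ℂ) ^ 2 * (x : ℂ) ^ 2) := by
    rw [hz, mul_pow, mul_pow, Complex.I_sq]; ring
  have key : z ^ 2 * ∫ v in (0 : ℝ)..1, (1 - (v : ℂ)) * Complex.exp (v * z)
      = Complex.exp z - 1 - z := by
    by_cases h0 : z = 0
    · simp [h0]
    · have hd : ∀ v ∈ Set.uIcc (0 : ℝ) 1, HasDerivAt
          (fun v : ℝ => (1 - (v : ℂ)) * Complex.exp (v * z) / z + Complex.exp (v * z) / z ^ 2)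
          ((1 - (v : ℂ)) * Complex.exp (v * z)) v := by
        intro v _
        have h1 : HasDerivAt (fun v : ℝ => (v : ℂ)) 1 v := Complex.ofRealCLM.hasDerivAt
        have h2 : HasDerivAt (fun v : ℝ => Complex.exp (v * z))
            (Complex.exp (v * z) * (1 * z)) v := (h1.mul_const z).cexp
        have h3 := (((h1.const_sub 1).mul h2).div_const z).add (h2.div_const (z ^ 2))
        convert! h3 using 1
        field_simp
        ring
      have hc : Continuous fun v : ℝ => (1 - (v : ℂ)) * Complex.exp (v * z) := by fun_prop
      rw [intervalIntegral.integral_eq_sub_of_hasDerivAt hd (hc.intervalIntegrable _ _)]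
      simp
      field_simp
      ring
  rw [levyKernel, ← key, hz2]
  ring

/-- Under the integral, `exp(i v l x)` is bounded by one and Lipschitz with constant at most `|l|`.
The error made by putting jump size `θ` for `x` is thus controlled by `min 1 |x - θ|`. -/
theorem norm_levyKernel_sub_le (l x y : ℝ) :
    ‖levyKernel l x - levyKernel l y‖ ≤ l ^ 2 * (2 + |l|) * min 1 |x - y| := by
  have hn : ∀ x v : ℝ, ‖Complex.exp (v * (l * x * Complex.I))‖ = 1 := fun x v => by
    rw [show (v : ℂ) * (l * x * Complex.I) = ((v * (l * x) : ℝ) : ℂ) * Complex.I by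
      push_cast; ring, Complex.norm_exp_ofReal_mul_I]
  have hi : ∀ x : ℝ, IntervalIntegrable (fun v : ℝ => (1 - (v : ℂ)) *
      Complex.exp (v * (l * x * Complex.I))) volume 0 1 := fun x =>
    Continuous.intervalIntegrable (by fun_prop) _ _
  have hd : ∀ v ∈ Set.uIoc (0 : ℝ) 1, ‖(1 - (v : ℂ)) * Complex.exp (v * (l * x * Complex.I))
      - (1 - (v : ℂ)) * Complex.exp (v * (l * y * Complex.I))‖ ≤ (2 + |l|) * min 1 |x - y| := by
    intro v hv
    rw [Set.uIoc_of_le zero_le_one] at hv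
    have h1 : ‖(1 - (v : ℂ))‖ ≤ 1 := by
      rw [show (1 - (v : ℂ)) = ((1 - v : ℝ) : ℂ) by push_cast; ring, Complex.norm_real,
        Real.norm_eq_abs, abs_le]
      constructor <;> linarith [hv.1, hv.2]
    have h2 : ‖Complex.exp (v * (l * x * Complex.I)) - Complex.exp (v * (l * y * Complex.I))‖
        ≤ |l| * |x - y| := by
      have e : Complex.exp (v * (l * x * Complex.I)) - Complex.exp (v * (l * y * Complex.I))
          = Complex.exp (v * (l * y * Complex.I)) *
            (Complex.exp (Complex.I * ((v * (l * (x - y)) : ℝ) : ℂ)) - 1) := by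
        rw [mul_sub, mul_one, ← Complex.exp_add]
        congr 2
        push_cast; ring
      rw [e, norm_mul, hn, one_mul]
      refine Real.norm_exp_I_mul_ofReal_sub_one_le.trans ?_
      rw [Real.norm_eq_abs, abs_mul, abs_mul, abs_of_pos hv.1]
      calc v * (|l| * |x - y|) ≤ 1 * (|l| * |x - y|) :=
            mul_le_mul_of_nonneg_right hv.2 (by positivity)
        _ = _ := one_mul _
    have h3 : ‖Complex.exp (v * (l * x * Complex.I)) - Complex.exp (v * (l * y * Complex.I))‖
        ≤ 2 := by
      refine (norm_sub_le _ _).trans ?_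
      rw [hn, hn]; norm_num
    rw [← mul_sub, norm_mul]
    refine (mul_le_mul_of_nonneg_right h1 (norm_nonneg _)).trans ?_
    rw [one_mul]
    have hl := abs_nonneg l
    have hxy := abs_nonneg (x - y)
    rcases le_total 1 |x - y| with h | h
    · rw [min_eq_left h]; linarith
    · rw [min_eq_right h]; nlinarith
  rw [levyKernel, levyKernel, ← mul_sub, ← intervalIntegral.integral_sub (hi x) (hi y), norm_mul]
  have := intervalIntegral.norm_integral_le_of_norm_le_const hd
  have hl : ‖-(l : ℂ) ^ 2‖ = l ^ 2 := by
    rw [norm_neg, norm_pow, Complex.norm_real, Real.norm_eq_abs, sq_abs]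
  rw [hl, mul_assoc (l ^ 2)]
  refine mul_le_mul_of_nonneg_left (this.trans (le_of_eq ?_)) (sq_nonneg l)
  simp

theorem levyKernel_zero (l : ℝ) : levyKernel l 0 = -(l : ℂ) ^ 2 / 2 := by
  have hd : ∀ v ∈ Set.uIcc (0 : ℝ) 1, HasDerivAt
      (fun v : ℝ => (v : ℂ) - (v : ℂ) ^ 2 / 2) (1 - (v : ℂ)) v := by
    intro v _
    have h1 : HasDerivAt (fun v : ℝ => (v : ℂ)) 1 v := Complex.ofRealCLM.hasDerivAt
    convert! h1.sub ((h1.pow 2).div_const 2) using 1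
    simp
  have hc : Continuous fun v : ℝ => 1 - (v : ℂ) := by fun_prop
  have := intervalIntegral.integral_eq_sub_of_hasDerivAt hd (hc.intervalIntegrable _ _)
  simp only [levyKernel, Complex.ofReal_zero, mul_zero, zero_mul, Complex.exp_zero, mul_one, this]
  simp
  ring

/-- Discrete Gronwall: the one-step errors of a linear recursion add up, amplified by at most `r ^
n`. -/
theorem norm_sub_pow_mul_le {G : ℕ → ℂ} {e : ℕ → ℝ} {z : ℂ} {r : ℝ} (hz : ‖z‖ ≤ r)
    (hr : 1 ≤ r) (he : ∀ k, 0 ≤ e k) (h : ∀ k, ‖G (k + 1) - z * G k‖ ≤ e k) (n : ℕ) :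
    ‖G n - z ^ n * G 0‖ ≤ r ^ n * ∑ k ∈ Finset.range n, e k := by
  induction n with
  | zero => simp
  | succ n ih =>
    have e1 : G (n + 1) - z ^ (n + 1) * G 0
        = (G (n + 1) - z * G n) + z * (G n - z ^ n * G 0) := by ring
    have hr0 : 0 ≤ r := zero_le_one.trans hr
    calc ‖G (n + 1) - z ^ (n + 1) * G 0‖
        ≤ ‖G (n + 1) - z * G n‖ + ‖z‖ * ‖G n - z ^ n * G 0‖ := by
          rw [e1, ← norm_mul]; exact norm_add_le _ _
      _ ≤ e n + r * (r ^ n * ∑ k ∈ Finset.range n, e k) := by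
          gcongr
          exact h n
      _ ≤ r ^ (n + 1) * e n + r * (r ^ n * ∑ k ∈ Finset.range n, e k) := by
          gcongr
          exact le_mul_of_one_le_left (he n) (one_le_pow₀ hr)
      _ = r ^ (n + 1) * ∑ k ∈ Finset.range (n + 1), e k := by
          rw [Finset.sum_range_succ]; ring

/-! ### Conditional characteristic functions of the increments -/

section CharFun

variable {Ω : Type*} {mΩ : MeasurableSpace Ω} {P : Measure Ω}
  {𝓕 : Set.Ioi (0 : ℝ) → Set.Ioi (0 : ℝ) → MeasurableSpace Ω}
  {X : Set.Ioi (0 : ℝ) → Ω → ℝ} {θ : ℝ}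

theorem integral_mul_ofReal_eq {B : Ω → ℂ} {f : Ω → ℝ} (hB : Measurable B) (hb : ∀ ω, ‖B ω‖ ≤ 1)
    (hf : Integrable f P) :
    ∫ ω, B ω * (f ω : ℂ) ∂P
      = (∫ ω, (B ω).re * f ω ∂P : ℝ) + (∫ ω, (B ω).im * f ω ∂P : ℝ) * Complex.I := by
  have i1 : Integrable (fun ω => (B ω).re * f ω) P :=
    integrable_bdd_mul (Complex.measurable_re.comp hB)
      (fun ω => (Complex.abs_re_le_norm _).trans (hb ω)) hf
  have i2 : Integrable (fun ω => (B ω).im * f ω) P :=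
    integrable_bdd_mul (Complex.measurable_im.comp hB)
      (fun ω => (Complex.abs_im_le_norm _).trans (hb ω)) hf
  rw [← integral_complex_ofReal, ← integral_complex_ofReal, ← integral_mul_const,
    ← integral_add i1.ofReal (i2.ofReal.mul_const _)]
  congr with ω
  conv_lhs => rw [← Complex.re_add_im (B ω)]
  push_cast
  ring

namespace IsQuadraticHarness

/-- This restates `tendsto_meshSum` with the weight that bounds the error in the Lévy kernel. The
new weight is at most `ε` plus a multiple of the old one, and `ε` contributes only `ε L`, since the
mean squared increments add up to `L`. -/
theorem tendsto_meshSum_min [IsProbabilityMeasure P] (hX : IsQuadraticHarness P 𝓕 X 0 θ 0 0 1)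
    (a : Set.Ioi (0 : ℝ)) {L : ℝ≥0} (hL : 0 < L) :
    Tendsto (fun j : ℕ => meshSum P X (fun y => min 1 |y - θ|) (mesh a (L / j ^ 4)) (j ^ 4))
      atTop (𝓝 0) := by
  set w : ℝ → ℝ := fun y => (y - θ) ^ 2 / (1 + (y - θ) ^ 2)
  have hw : Measurable w := by simp only [w]; fun_prop
  have hwb : ∀ y, |w y| ≤ 1 := fun y => by
    simp only [w]
    rw [abs_of_nonneg (by positivity), div_le_one (by positivity)]
    linarith
  have hm : Measurable (fun y : ℝ => min 1 |y - θ|) := by fun_prop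
  have hmb : ∀ y : ℝ, |min 1 (|y - θ|)| ≤ 1 := fun y => by
    rw [abs_of_nonneg (le_min zero_le_one (abs_nonneg _))]; exact min_le_left _ _
  have hpt : ∀ ε : ℝ, 0 < ε → ε ≤ 1 → ∀ y, min 1 |y - θ| ≤ ε + 2 / ε ^ 2 * w y := by
    intro ε hε hε1 y
    have hw0 : 0 ≤ w y := by simp only [w]; positivity
    rcases le_total |y - θ| ε with h | h
    · exact (min_le_right _ _).trans (h.trans (le_add_of_nonneg_right (by positivity)))
    · refine (min_le_left _ _).trans ?_
      have h2 : ε ^ 2 ≤ (y - θ) ^ 2 := by rw [← sq_abs (y - θ)]; gcongr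
      have h3 : ε ^ 2 / 2 ≤ w y := by
        simp only [w]
        rw [div_le_div_iff₀ (by norm_num) (by positivity)]
        have h1 : ε ^ 2 ≤ 1 := pow_le_one₀ hε.le hε1
        nlinarith [mul_le_mul_of_nonneg_right h1 (sq_nonneg (y - θ))]
      have h4 : 1 ≤ 2 / ε ^ 2 * w y := by
        calc (1 : ℝ) = 2 / ε ^ 2 * (ε ^ 2 / 2) := by field_simp
          _ ≤ _ := by gcongr
      linarith
  have hnn : ∀ t N, 0 ≤ meshSum P X (fun y => min 1 |y - θ|) t N := fun t N =>
    Finset.sum_nonneg fun k _ => integral_nonneg fun ω =>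
      mul_nonneg (le_min zero_le_one (abs_nonneg _)) (sq_nonneg _)
  have hbound : ∀ ε : ℝ, 0 < ε → ε ≤ 1 → ∀ j : ℕ, 0 < j →
      meshSum P X (fun y => min 1 |y - θ|) (mesh a (L / j ^ 4)) (j ^ 4)
        ≤ ε * L + 2 / ε ^ 2 * meshSum P X w (mesh a (L / j ^ 4)) (j ^ 4) := by
    intro ε hε hε1 j hj
    have hj' : (0 : ℝ) < j := Nat.cast_pos.2 hj
    have : ε * (L : ℝ) = ∑ k ∈ Finset.range (j ^ 4), ε * (L / j ^ 4) := by
      rw [Finset.sum_const, Finset.card_range, nsmul_eq_mul]; push_cast; field_simp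
    rw [this, meshSum, meshSum, Finset.mul_sum, ← Finset.sum_add_distrib]
    refine Finset.sum_le_sum fun k _ => ?_
    set s := mesh a (L / j ^ 4) k
    set t := mesh a (L / j ^ 4) (k + 1)
    have hst : (t : ℝ) - s = L / j ^ 4 := by simp [s, t, mesh]; ring
    have hd := hX.measurable_sub s t
    have hI := (hX.memLp_sub s t).integrable_sq
    have i1 : Integrable (fun ω => w (X t ω - X s ω) * (X t ω - X s ω) ^ 2) P :=
      integrable_bdd_mul (hw.comp hd) (fun ω => hwb _) hI
    have e : ε * (L / j ^ 4) = ∫ ω, ε * (X t ω - X s ω) ^ 2 ∂P := by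
      rw [integral_const_mul, hX.integral_sub_sq, hst, abs_of_nonneg (by positivity)]
    rw [e, ← integral_const_mul, ← integral_add (hI.const_mul ε) (i1.const_mul _)]
    refine integral_mono (integrable_bdd_mul (hm.comp hd) (fun ω => hmb _) hI)
      ((hI.const_mul ε).add (i1.const_mul _)) fun ω => ?_
    calc _ ≤ (ε + 2 / ε ^ 2 * w (X t ω - X s ω)) * (X t ω - X s ω) ^ 2 :=
          mul_le_mul_of_nonneg_right (hpt ε hε hε1 _) (sq_nonneg _)
      _ = _ := by ring
  have hL' : (0 : ℝ) < L := NNReal.coe_pos.2 hL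
  rw [Metric.tendsto_atTop]
  intro e he
  set ε : ℝ := min 1 (e / (2 * L))
  have hε : 0 < ε := lt_min one_pos (by positivity)
  have hεL : ε * L ≤ e / 2 := by
    calc ε * L ≤ e / (2 * L) * L := by gcongr; exact min_le_right _ _
      _ = e / 2 := by field_simp
  have ht := (hX.tendsto_meshSum a hL).const_mul (2 / ε ^ 2)
  rw [mul_zero] at ht
  have hev := (ht.eventually_lt_const (half_pos he)).and (eventually_gt_atTop 0)
  obtain ⟨N, hN⟩ := eventually_atTop.1 hev
  refine ⟨N, fun j hj => ?_⟩
  rw [Real.dist_eq, sub_zero, abs_of_nonneg (hnn _ _)]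
  have h1 := hbound ε hε (min_le_left _ _) j (hN j hj).2
  have h2 := (hN j hj).1
  linarith

/-- The characteristic function of the increments given the past. -/
theorem integral_past_mul_cexp [IsProbabilityMeasure P] (hX : IsQuadraticHarness P 𝓕 X 0 θ 0 0 1)
    {s t : Set.Ioi (0 : ℝ)} (hst : s < t) {A : Ω → ℂ} (hA : IsPast 𝓕 s A) (hA1 : ∀ ω, ‖A ω‖ ≤ 1)
    (l : ℝ) :
    ∫ ω, A ω * Complex.exp (l * (X t ω - X s ω : ℝ) * Complex.I) ∂P
      = Complex.exp (((t : ℝ) - s : ℝ) * levyKernel l θ) * ∫ ω, A ω ∂P := by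
  have hlt : (s : ℝ) < t := hst
  set L : ℝ≥0 := ⟨(t : ℝ) - s, by linarith⟩
  have hL : 0 < L := NNReal.coe_pos.1 (show (0 : ℝ) < (t : ℝ) - s by linarith)
  have hLr : (L : ℝ) = (t : ℝ) - s := rfl
  set c : ℂ := levyKernel l θ with hc
  set K : ℝ := l ^ 2 * (2 + |l|)
  have hK : 0 ≤ K := by positivity
  set G : Set.Ioi (0 : ℝ) → ℂ := fun r =>
    ∫ ω, A ω * Complex.exp (l * (X r ω - X s ω : ℝ) * Complex.I) ∂P
  have hexp1 : ∀ x : ℝ, ‖Complex.exp (l * x * Complex.I)‖ = 1 := fun x => by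
    rw [show (l : ℂ) * x * Complex.I = ((l * x : ℝ) : ℂ) * Complex.I by push_cast; ring,
      Complex.norm_exp_ofReal_mul_I]
  -- One Euler step. Given the past, the increment has mean `0` and second moment `r' - r`;
  -- expanding the exponential with the kernel frozen at `θ` gives the factor `1 + c (r' - r)`, and
  -- the error is the weighted squared increment.
  have hstep : ∀ r r' : Set.Ioi (0 : ℝ), s ≤ r → r < r' →
      ‖G r' - (1 + c * ((r' : ℝ) - r : ℝ)) * G r‖
        ≤ K * ∫ ω, min 1 |X r' ω - X r ω - θ| * (X r' ω - X r ω) ^ 2 ∂P := by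
    intro r r' hr hrr
    set B : Ω → ℂ := fun ω => A ω * Complex.exp (l * (X r ω - X s ω : ℝ) * Complex.I) with hB
    have hBp : IsPast 𝓕 r B := fun u hu => by
      have h1 := (IsPast.eval hX le_rfl u hu).sub (IsPast.eval hX hr u hu)
      have h2 : Measurable (fun x : ℝ => Complex.exp (l * x * Complex.I)) := by fun_prop
      exact ((hA.mono hX hr) u hu).mul (h2.comp h1)
    have hBm := hBp.measurable hX
    have hB1 : ∀ ω, ‖B ω‖ ≤ 1 := fun ω => by
      simp only [hB]; rw [norm_mul, hexp1, mul_one]; exact hA1 ω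
    have hre : ∀ ω, |(B ω).re| ≤ 1 := fun ω => (Complex.abs_re_le_norm _).trans (hB1 ω)
    have him : ∀ ω, |(B ω).im| ≤ 1 := fun ω => (Complex.abs_im_le_norm _).trans (hB1 ω)
    have hBre : IsPast 𝓕 r (fun ω => (B ω).re) := hBp.comp Complex.measurable_re
    have hBim : IsPast 𝓕 r (fun ω => (B ω).im) := hBp.comp Complex.measurable_im
    have hξ := (hX.memLp_sub r r').integrable one_le_two
    have hξ2 := (hX.memLp_sub r r').integrable_sq
    have m1 : ∫ ω, B ω * ((X r' ω - X r ω : ℝ) : ℂ) ∂P = 0 := by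
      rw [integral_mul_ofReal_eq hBm hB1 hξ, hX.integral_past_mul_sub hrr hBre hre,
        hX.integral_past_mul_sub hrr hBim him]
      simp
    have m0 : ∫ ω, B ω ∂P = (∫ ω, (B ω).re ∂P : ℝ) + (∫ ω, (B ω).im ∂P : ℝ) * Complex.I := by
      have := integral_mul_ofReal_eq (P := P) (f := fun _ => 1) hBm hB1 (integrable_const _)
      simpa using this
    have m2 : ∫ ω, B ω * (((X r' ω - X r ω) ^ 2 : ℝ) : ℂ) ∂P
        = ((r' : ℝ) - r : ℝ) * ∫ ω, B ω ∂P := by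
      rw [integral_mul_ofReal_eq hBm hB1 hξ2, hX.integral_past_mul_sub_sq hrr hBre hre,
        hX.integral_past_mul_sub_sq hrr hBim him, m0]
      push_cast; ring
    have hI1 : Integrable (fun ω => B ω * ((X r' ω - X r ω : ℝ) : ℂ)) P :=
      hξ.ofReal.bdd_mul hBm.aestronglyMeasurable (Eventually.of_forall hB1)
    have hI2 : Integrable (fun ω => B ω * (((X r' ω - X r ω) ^ 2 : ℝ) : ℂ)) P :=
      hξ2.ofReal.bdd_mul hBm.aestronglyMeasurable (Eventually.of_forall hB1)
    have hI0 : Integrable B P :=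
      Integrable.of_bound hBm.aestronglyMeasurable 1 (Eventually.of_forall hB1)
    have hexpm : Measurable (fun ω => Complex.exp (l * (X r' ω - X r ω : ℝ) * Complex.I)) := by
      have h2 : Measurable (fun x : ℝ => Complex.exp (l * x * Complex.I)) := by fun_prop
      exact h2.comp (hX.measurable_sub r r')
    have hI3 : Integrable (fun ω => B ω * Complex.exp (l * (X r' ω - X r ω : ℝ) * Complex.I)) P :=
      Integrable.of_bound (hBm.mul hexpm).aestronglyMeasurable 1 (Eventually.of_forall fun ω => by
        rw [norm_mul, hexp1, mul_one]; exact hB1 ω)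
    have eG : G r' = ∫ ω, B ω * Complex.exp (l * (X r' ω - X r ω : ℝ) * Complex.I) ∂P := by
      simp only [G, hB]
      congr with ω
      rw [mul_assoc (A ω), ← Complex.exp_add]
      congr 2
      push_cast; ring
    have eD : G r' - (1 + c * ((r' : ℝ) - r : ℝ)) * G r
        = ∫ ω, B ω * (Complex.exp (l * (X r' ω - X r ω : ℝ) * Complex.I) - 1
          - l * (X r' ω - X r ω : ℝ) * Complex.I - c * ((X r' ω - X r ω : ℝ) : ℂ) ^ 2) ∂P := by
      have e : ∀ ω, B ω * (Complex.exp (l * (X r' ω - X r ω : ℝ) * Complex.I) - 1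
          - l * (X r' ω - X r ω : ℝ) * Complex.I - c * ((X r' ω - X r ω : ℝ) : ℂ) ^ 2)
          = B ω * Complex.exp (l * (X r' ω - X r ω : ℝ) * Complex.I) - B ω
            - (l * Complex.I) * (B ω * ((X r' ω - X r ω : ℝ) : ℂ))
            - c * (B ω * (((X r' ω - X r ω) ^ 2 : ℝ) : ℂ)) := fun ω => by push_cast; ring
      have hI5 := hI3.sub hI0
      have hI6 := hI5.sub (hI1.const_mul (l * Complex.I))
      simp only [Pi.sub_def] at hI5 hI6
      simp_rw [e]
      rw [integral_sub hI6 (hI2.const_mul _),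
        integral_sub hI5 (hI1.const_mul _), integral_sub hI3 hI0,
        integral_const_mul, integral_const_mul, m1, m2, eG]
      simp only [G, hB]
      ring
    rw [eD, ← integral_const_mul]
    have mm : Measurable fun x : ℝ => min 1 |x - θ| := by fun_prop
    have hmb : ∀ y : ℝ, |min 1 (|y - θ|)| ≤ 1 := fun y => by
      rw [abs_of_nonneg (le_min zero_le_one (abs_nonneg _))]; exact min_le_left _ _
    have hI4 : Integrable (fun ω => min 1 |X r' ω - X r ω - θ| * (X r' ω - X r ω) ^ 2) P :=
      integrable_bdd_mul (mm.comp (hX.measurable_sub r r')) (fun ω => hmb _) hξ2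
    refine norm_integral_le_of_norm_le (hI4.const_mul K) (Eventually.of_forall fun ω => ?_)
    clear_value B
    rw [norm_mul, ← levyKernel_mul_sq, ← sub_mul, norm_mul (_ - _)]
    set x := X r' ω - X r ω
    have hx2 : ‖(x : ℂ) ^ 2‖ = x ^ 2 := by
      rw [norm_pow, Complex.norm_real, Real.norm_eq_abs, sq_abs]
    rw [hx2]
    calc _ ≤ 1 * (K * min 1 |x - θ| * x ^ 2) := by
          gcongr
          · exact hB1 ω
          · exact norm_levyKernel_sub_le l x θ
      _ = _ := by ring
  have hmain : ∀ j : ℕ, 0 < j → ‖G t - (1 + c * (L : ℝ) / ((j ^ 4 : ℕ) : ℂ)) ^ (j ^ 4) * G s‖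
      ≤ Real.exp (‖c‖ * L) * (K * meshSum P X (fun y => min 1 |y - θ|)
          (mesh s (L / j ^ 4)) (j ^ 4)) := by
    intro j hj
    have hj' : (0 : ℝ) < j := Nat.cast_pos.2 hj
    set δ : ℝ≥0 := L / j ^ 4
    have hδ : (δ : ℝ) = L / j ^ 4 := by simp [δ]
    have hδpos : (0 : ℝ) < δ := by rw [hδ]; have := NNReal.coe_pos.2 hL; positivity
    have hdiff : ∀ k, ((mesh s δ (k + 1) : ℝ) - mesh s δ k) = δ := fun k => by
      simp [mesh]; ring
    have hz : ‖1 + c * (δ : ℝ)‖ ≤ Real.exp (‖c‖ * δ) := by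
      calc ‖1 + c * (δ : ℝ)‖ ≤ 1 + ‖c‖ * δ := by
            refine (norm_add_le _ _).trans ?_
            rw [norm_one, norm_mul, Complex.norm_real, Real.norm_of_nonneg hδpos.le]
        _ ≤ _ := by rw [add_comm]; exact Real.add_one_le_exp _
    have hrec := norm_sub_pow_mul_le (G := fun k => G (mesh s δ k))
      (e := fun k => K * ∫ ω, min 1 |X (mesh s δ (k + 1)) ω - X (mesh s δ k) ω - θ| *
        (X (mesh s δ (k + 1)) ω - X (mesh s δ k) ω) ^ 2 ∂P) hz
      (Real.one_le_exp (by positivity))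
      (fun k => mul_nonneg hK (integral_nonneg fun ω =>
        mul_nonneg (le_min zero_le_one (abs_nonneg _)) (sq_nonneg _)))
      (fun k => by
        have := hstep (mesh s δ k) (mesh s δ (k + 1))
          (Subtype.coe_le_coe.1 (by simp only [mesh]; exact le_add_of_nonneg_right (by positivity)))
          (Subtype.coe_lt_coe.1 (by linarith [hdiff k]))
        rwa [hdiff k] at this) (j ^ 4)
    have e1 : mesh s δ (j ^ 4) = t := by
      apply Subtype.ext
      simp only [mesh, hδ, hLr]; push_cast; field_simp; ring
    rw [e1, mesh_zero, ← Finset.mul_sum, ← Real.exp_nat_mul] at hrec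
    have e2 : ((j ^ 4 : ℕ) : ℝ) * (‖c‖ * δ) = ‖c‖ * L := by
      rw [hδ]; push_cast; field_simp
    have e3 : c * ((δ : ℝ) : ℂ) = c * (L : ℝ) / ((j ^ 4 : ℕ) : ℂ) := by
      rw [hδ]; push_cast; ring
    rw [e2, e3] at hrec
    exact hrec
  -- With `j⁴` steps the Euler factors multiply to `(1 + c L / j⁴) ^ j⁴`, a subsequence of the usual
  -- approximation of the exponential.
  have hlim1 : Tendsto (fun j : ℕ => (1 + c * (L : ℝ) / ((j ^ 4 : ℕ) : ℂ)) ^ (j ^ 4) * G s) atTop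
      (𝓝 (Complex.exp (c * (L : ℝ)) * G s)) :=
    ((Complex.tendsto_one_add_div_pow_exp (c * (L : ℝ))).comp
      (tendsto_pow_atTop (by norm_num : 4 ≠ 0))).mul_const _
  have hlim2 : Tendsto (fun j : ℕ => (1 + c * (L : ℝ) / ((j ^ 4 : ℕ) : ℂ)) ^ (j ^ 4) * G s) atTop
      (𝓝 (G t)) := by
    rw [tendsto_iff_norm_sub_tendsto_zero]
    have h0 := ((hX.tendsto_meshSum_min s hL).const_mul K).const_mul (Real.exp (‖c‖ * L))
    rw [mul_zero, mul_zero] at h0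
    refine squeeze_zero' (Eventually.of_forall fun j => norm_nonneg _) ?_ h0
    filter_upwards [eventually_gt_atTop 0] with j hj
    rw [norm_sub_rev]
    exact hmain j hj
  have hfin := tendsto_nhds_unique hlim2 hlim1
  have hGs : G s = ∫ ω, A ω ∂P := by simp [G]
  rw [hGs, hLr, mul_comm c] at hfin
  exact hfin

end IsQuadraticHarness

end CharFun

/-! ### Wiener and Poisson processes -/

section Laws

variable {Ω : Type*} {mΩ : MeasurableSpace Ω} {P : Measure Ω}
  {𝓕 : Set.Ioi (0 : ℝ) → Set.Ioi (0 : ℝ) → MeasurableSpace Ω}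
  {X : Set.Ioi (0 : ℝ) → Ω → ℝ} {θ : ℝ}

theorem extendZero_zero (X : Set.Ioi (0 : ℝ) → Ω → ℝ) (ω : Ω) : extendZero X 0 ω = 0 := by
  simp [extendZero]

theorem extendZero_of_pos (X : Set.Ioi (0 : ℝ) → Ω → ℝ) {t : ℝ≥0} (h : 0 < (t : ℝ)) :
    extendZero X t = X ⟨t, h⟩ := by
  funext ω; simp [extendZero, h]

namespace IsQuadraticHarness

theorem measurable_extendZero (hX : IsQuadraticHarness P 𝓕 X 0 θ 0 0 1) (t : ℝ≥0) :
    Measurable (extendZero X t) := by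
  by_cases h : 0 < (t : ℝ)
  · rw [extendZero_of_pos X h]; exact hX.measurable _
  · have : extendZero X t = fun _ => 0 := by funext ω; simp [extendZero, h]
    rw [this]; exact measurable_const

theorem isPast_extendZero (hX : IsQuadraticHarness P 𝓕 X 0 θ 0 0 1) {t : ℝ≥0}
    {s : Set.Ioi (0 : ℝ)} (hts : (t : ℝ) ≤ s) : IsPast 𝓕 s (extendZero X t) := by
  by_cases h : 0 < (t : ℝ)
  · rw [extendZero_of_pos X h]; exact IsPast.eval hX (Subtype.coe_le_coe.1 hts)
  · have : extendZero X t = fun _ => 0 := by funext ω; simp [extendZero, h]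
    rw [this]; exact fun u _ => measurable_const

/-- Time zero is not an index of the process, so the starting value enters through `s → 0`, using
`E|X_s| ≤ √s`. -/
theorem integral_cexp_eval [IsProbabilityMeasure P] (hX : IsQuadraticHarness P 𝓕 X 0 θ 0 0 1)
    (t : Set.Ioi (0 : ℝ)) (l : ℝ) :
    ∫ ω, Complex.exp (l * (X t ω : ℝ) * Complex.I) ∂P
      = Complex.exp ((t : ℝ) * levyKernel l θ) := by
  have ht : (0 : ℝ) < t := t.2
  set s : ℕ → Set.Ioi (0 : ℝ) := fun n => ⟨(t : ℝ) / (n + 2), Set.mem_Ioi.2 (by positivity)⟩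
  have hs0 : Tendsto (fun n => (s n : ℝ)) atTop (𝓝 0) := by
    have := (tendsto_const_div_atTop_nhds_zero_nat (t : ℝ)).comp (tendsto_add_atTop_nat 2)
    refine this.congr fun n => ?_
    simp [s]
  have hst : ∀ n, s n < t := fun n => Subtype.coe_lt_coe.1 (by
    simp only [s]
    rw [div_lt_iff₀ (by positivity)]
    have : (0 : ℝ) ≤ n := Nat.cast_nonneg n
    nlinarith)
  have h1 : ∀ n, ∫ ω, Complex.exp (l * (X t ω - X (s n) ω : ℝ) * Complex.I) ∂P
      = Complex.exp (((t : ℝ) - s n : ℝ) * levyKernel l θ) := fun n => by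
    have := hX.integral_past_mul_cexp (hst n) (A := fun _ => 1) (fun u _ => measurable_const)
      (by simp) l
    simpa using this
  have hexp : ∀ x : ℝ, ‖Complex.exp (l * x * Complex.I)‖ = 1 := fun x => by
    rw [show (l : ℂ) * x * Complex.I = ((l * x : ℝ) : ℂ) * Complex.I by push_cast; ring,
      Complex.norm_exp_ofReal_mul_I]
  have hm : Measurable (fun x : ℝ => Complex.exp (l * x * Complex.I)) := by fun_prop
  have hint : ∀ f : Ω → ℝ, Measurable f →
      Integrable (fun ω => Complex.exp (l * (f ω : ℝ) * Complex.I)) P := fun f hf =>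
    Integrable.of_bound (hm.comp hf).aestronglyMeasurable 1
      (Eventually.of_forall fun ω => (hexp _).le)
  have hlim1 : Tendsto (fun n => ∫ ω, Complex.exp (l * (X t ω - X (s n) ω : ℝ) * Complex.I) ∂P)
      atTop (𝓝 (∫ ω, Complex.exp (l * (X t ω : ℝ) * Complex.I) ∂P)) := by
    rw [tendsto_iff_norm_sub_tendsto_zero]
    have h0 : Tendsto (fun n => |l| * √(s n : ℝ)) atTop (𝓝 0) := by
      have := (hs0.sqrt).const_mul |l|
      simpa using this
    refine squeeze_zero (fun n => norm_nonneg _) (fun n => ?_) h0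
    rw [← integral_sub (hint (fun ω => X t ω - X (s n) ω) (hX.measurable_sub (s n) t))
      (hint _ (hX.measurable t))]
    have hXs := (hX.integrable (s n)).abs.const_mul |l|
    refine (norm_integral_le_of_norm_le hXs (Eventually.of_forall fun ω => ?_)).trans ?_
    · have e : Complex.exp (l * (X t ω - X (s n) ω : ℝ) * Complex.I)
          - Complex.exp (l * (X t ω : ℝ) * Complex.I)
          = Complex.exp (l * (X t ω : ℝ) * Complex.I) *
            (Complex.exp (Complex.I * ((l * (-X (s n) ω) : ℝ) : ℂ)) - 1) := by
        rw [mul_sub, mul_one, ← Complex.exp_add]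
        congr 2
        push_cast; ring
      rw [e, norm_mul, hexp, one_mul]
      refine Real.norm_exp_I_mul_ofReal_sub_one_le.trans ?_
      rw [Real.norm_eq_abs, abs_mul, abs_neg]
    · rw [integral_const_mul]
      refine mul_le_mul_of_nonneg_left ?_ (abs_nonneg _)
      rw [← hX.integral_sq (s n)]
      exact integral_abs_le_sqrt (hX.memLp (s n))
  have hlim2 : Tendsto (fun n => ∫ ω, Complex.exp (l * (X t ω - X (s n) ω : ℝ) * Complex.I) ∂P)
      atTop (𝓝 (Complex.exp ((t : ℝ) * levyKernel l θ))) := by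
    simp_rw [h1]
    have hc : Continuous fun x : ℝ => Complex.exp (((t : ℝ) - x : ℝ) * levyKernel l θ) := by
      fun_prop
    have := (hc.tendsto 0).comp hs0
    rw [sub_zero] at this
    exact this
  exact tendsto_nhds_unique hlim1 hlim2

/-- The last increment is split off by conditioning on the past, which contains all the earlier
factors. -/
theorem integral_prod_cexp_increments [IsProbabilityMeasure P]
    (hX : IsQuadraticHarness P 𝓕 X 0 θ 0 0 1) (n : ℕ) (t : Fin (n + 1) → ℝ≥0) (ht : Monotone t)
    (l : Fin n → ℝ) :
    ∫ ω, ∏ i, Complex.exp (l i *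
        (extendZero X (t i.succ) ω - extendZero X (t i.castSucc) ω : ℝ) * Complex.I) ∂P
      = ∏ i, Complex.exp (((t i.succ : ℝ) - t i.castSucc : ℝ) * levyKernel (l i) θ) := by
  induction n with
  | zero => simp
  | succ n ih =>
    have ih' := ih (fun i => t i.castSucc) (fun i j h => ht (Fin.castSucc_le_castSucc_iff.2 h))
      (fun i => l i.castSucc)
    simp only [Fin.prod_univ_castSucc]
    set A : Ω → ℂ := fun ω => ∏ i : Fin n, Complex.exp (l i.castSucc *
      (extendZero X (t i.castSucc.succ) ω - extendZero X (t i.castSucc.castSucc) ω : ℝ) *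
      Complex.I) with hA
    have ihA : ∫ ω, A ω ∂P = ∏ i : Fin n, Complex.exp
        (((t i.castSucc.succ : ℝ) - t i.castSucc.castSucc : ℝ) * levyKernel (l i.castSucc) θ) := by
      simpa only [hA, Fin.succ_castSucc] using ih'
    rw [← ihA, Fin.succ_last]
    change ∫ ω, A ω * Complex.exp (l (Fin.last n) * (extendZero X (t (Fin.last (n + 1))) ω
      - extendZero X (t (Fin.last n).castSucc) ω : ℝ) * Complex.I) ∂P = _
    set x := t (Fin.last n).castSucc
    set y := t (Fin.last (n + 1))
    set c := l (Fin.last n)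
    have hxy : x ≤ y := ht (Fin.le_last _)
    have hle : ∀ i : Fin (n + 1), t i.castSucc ≤ x := fun i =>
      ht (Fin.castSucc_le_castSucc_iff.2 (Fin.le_last i))
    rcases hxy.eq_or_lt with hxy | hxy
    · simp [hxy]
    have hy : 0 < (y : ℝ) := NNReal.coe_pos.2 (lt_of_le_of_lt (zero_le) hxy)
    -- If the last increment starts at time zero, there is no past to condition on; by monotonicity
    -- all earlier times are zero and their factors equal one.
    by_cases hx : 0 < (x : ℝ)
    · have hA1 : ∀ ω, ‖A ω‖ ≤ 1 := fun ω => by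
        simp only [hA]
        rw [norm_prod]
        refine (Finset.prod_eq_one fun i _ => ?_).le
        rw [show ∀ a b : ℝ, (a : ℂ) * b * Complex.I = ((a * b : ℝ) : ℂ) * Complex.I from
          fun a b => by push_cast; ring, Complex.norm_exp_ofReal_mul_I]
      have hAp : IsPast 𝓕 ⟨x, hx⟩ A := fun u hu => by
        refine Finset.measurable_prod _ fun i _ => ?_
        have h2 : Measurable (fun z : ℝ => Complex.exp (l i.castSucc * z * Complex.I)) := by
          fun_prop
        refine h2.comp (Measurable.sub ?_ ?_)
        · rw [Fin.succ_castSucc]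
          exact hX.isPast_extendZero (NNReal.coe_le_coe.2 (hle i.succ)) u hu
        · exact hX.isPast_extendZero (NNReal.coe_le_coe.2 (hle i.castSucc)) u hu
      have := hX.integral_past_mul_cexp (s := ⟨x, hx⟩) (t := ⟨y, hy⟩)
        (Subtype.coe_lt_coe.1 (NNReal.coe_lt_coe.2 hxy)) hAp hA1 c
      rw [extendZero_of_pos X hx, extendZero_of_pos X hy, this, mul_comm]
    · have hx0 : x = 0 := by
        apply le_antisymm _ zero_le
        exact_mod_cast not_lt.1 hx
      have h0 : ∀ i : Fin (n + 1), t i.castSucc = 0 := fun i =>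
        le_antisymm ((hle i).trans hx0.le) zero_le
      have hA1 : A = fun _ => 1 := by
        funext ω
        simp only [hA]
        refine Finset.prod_eq_one fun i _ => ?_
        rw [Fin.succ_castSucc, h0, h0]
        simp
      rw [hA1, hx0, extendZero_of_pos X hy]
      simp only [extendZero_zero, sub_zero, one_mul, NNReal.coe_zero]
      rw [hX.integral_cexp_eval ⟨y, hy⟩ c]
      simp

theorem integral_cexp_increment [IsProbabilityMeasure P] (hX : IsQuadraticHarness P 𝓕 X 0 θ 0 0 1)
    {s t : ℝ≥0} (hst : s ≤ t) (l : ℝ) :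
    ∫ ω, Complex.exp (l * (extendZero X t ω - extendZero X s ω : ℝ) * Complex.I) ∂P
      = Complex.exp (((t : ℝ) - s : ℝ) * levyKernel l θ) := by
  have hm : Monotone (![s, t] : Fin 2 → ℝ≥0) := by
    intro i j hij
    fin_cases i <;> fin_cases j <;> simp_all
  simpa using hX.integral_prod_cexp_increments 1 ![s, t] hm (fun _ => l)

theorem hasIndepIncrements [IsProbabilityMeasure P] (hX : IsQuadraticHarness P 𝓕 X 0 θ 0 0 1) :
    HasIndepIncrements (extendZero X) P := by
  intro n t ht
  have hm : ∀ i : Fin n, Measurable (fun ω => extendZero X (t i.succ) ω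
      - extendZero X (t i.castSucc) ω) := fun i =>
    (hX.measurable_extendZero _).sub (hX.measurable_extendZero _)
  rw [iIndepFun_iff_charFun_pi fun i => (hm i).aemeasurable]
  intro l
  have h1 : Measurable fun ω => WithLp.toLp 2 (fun i : Fin n => extendZero X (t i.succ) ω
      - extendZero X (t i.castSucc) ω) :=
    (WithLp.measurable_toLp 2 _).comp (measurable_pi_lambda _ hm)
  rw [charFun_apply, integral_map h1.aemeasurable (by fun_prop)]
  have h2 := hX.integral_prod_cexp_increments n t ht (fun i => l i)
  calc _ = ∫ ω, ∏ i, Complex.exp (l i *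
        (extendZero X (t i.succ) ω - extendZero X (t i.castSucc) ω : ℝ) * Complex.I) ∂P := by
        congr with ω
        rw [← Complex.exp_sum, PiLp.inner_apply, Complex.ofReal_sum, Finset.sum_mul]
        congr 1
        refine Finset.sum_congr rfl fun i _ => ?_
        simp
    _ = _ := by
        rw [h2]
        refine Finset.prod_congr rfl fun i _ => ?_
        rw [charFun_apply, integral_map (hm i).aemeasurable (by fun_prop),
          ← hX.integral_cexp_increment (ht (Fin.castSucc_le_succ i)) (l i)]
        congr with ω
        simp

theorem isPreBrownianReal [IsProbabilityMeasure P] (hX : IsQuadraticHarness P 𝓕 X 0 0 0 0 1) :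
    IsPreBrownianReal (extendZero X) P := by
  refine HasIndepIncrements.isPreBrownianReal_of_hasLaw (fun t => ?_) hX.hasIndepIncrements
  refine ⟨(hX.measurable_extendZero t).aemeasurable, ?_⟩
  have : IsProbabilityMeasure (P.map (extendZero X t)) :=
    Measure.isProbabilityMeasure_map (hX.measurable_extendZero t).aemeasurable
  refine Measure.ext_of_charFun ?_
  funext l
  rw [charFun_apply, integral_map (hX.measurable_extendZero t).aemeasurable (by fun_prop),
    charFun_gaussianReal]
  have h := hX.integral_cexp_increment (zero_le : 0 ≤ t) l
  simp only [extendZero_zero, sub_zero, levyKernel_zero] at h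
  calc _ = ∫ ω, Complex.exp (l * (extendZero X t ω : ℝ) * Complex.I) ∂P := by
        congr with ω
        simp
    _ = _ := by
        rw [h]; congr 1; push_cast; ring

/-- With `l / θ` for `l`, the exponent at jump size `θ` is `(exp(i l) - 1 - i l)/θ²`: a Poisson
exponent of intensity `1/θ²` whose compensator is cancelled by the added drift. -/
theorem isPoissonProcess [IsProbabilityMeasure P] (hX : IsQuadraticHarness P 𝓕 X 0 θ 0 0 1)
    (hθ : θ ≠ 0) :
    IsPoissonProcess P (Real.toNNReal (1 / θ ^ 2))
      (fun t ω => 1 / θ * extendZero X t ω + 1 / θ ^ 2 * (t : ℝ)) where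
  zero := Eventually.of_forall fun ω => by simp [extendZero_zero]
  indep := by
    intro n t ht
    have h := (hX.hasIndepIncrements n t ht).comp
      (fun i x => 1 / θ * x + 1 / θ ^ 2 * ((t i.succ : ℝ) - t i.castSucc))
      (fun i => by fun_prop)
    convert! h using 1
    funext i ω
    simp only [Function.comp]
    ring
  law := by
    intro s t hst
    have hm : Measurable fun ω => (1 / θ * extendZero X t ω + 1 / θ ^ 2 * (t : ℝ))
        - (1 / θ * extendZero X s ω + 1 / θ ^ 2 * (s : ℝ)) :=
      (((hX.measurable_extendZero t).const_mul _).add_const _).sub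
        (((hX.measurable_extendZero s).const_mul _).add_const _)
    refine ⟨hm.aemeasurable, ?_⟩
    have : IsProbabilityMeasure (P.map fun ω => (1 / θ * extendZero X t ω + 1 / θ ^ 2 * (t : ℝ))
        - (1 / θ * extendZero X s ω + 1 / θ ^ 2 * (s : ℝ))) :=
      Measure.isProbabilityMeasure_map hm.aemeasurable
    refine Measure.ext_of_charFun ?_
    funext l
    rw [charFun_apply, integral_map hm.aemeasurable (by fun_prop), charFun_map_cast_poissonMeasure]
    have h := hX.integral_cexp_increment hst (l / θ)
    have hθ' : (θ : ℂ) ≠ 0 := by exact_mod_cast hθ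
    have hk := levyKernel_mul_sq (l / θ) θ
    have e1 : ((l / θ : ℝ) : ℂ) * θ = l := by push_cast; field_simp
    rw [e1] at hk
    have hst' : (s : ℝ) ≤ t := hst
    have e2 : (((1 / θ ^ 2).toNNReal * (t - s) : ℝ≥0) : ℂ)
        = 1 / (θ : ℂ) ^ 2 * ((t : ℝ) - s : ℝ) := by
      have : (((1 / θ ^ 2).toNNReal * (t - s) : ℝ≥0) : ℝ) = 1 / θ ^ 2 * ((t : ℝ) - s) := by
        rw [NNReal.coe_mul, Real.coe_toNNReal _ (by positivity), NNReal.coe_sub hst]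
      have h3 : (((1 / θ ^ 2).toNNReal * (t - s) : ℝ≥0) : ℂ)
          = ((((1 / θ ^ 2).toNNReal * (t - s) : ℝ≥0) : ℝ) : ℂ) := rfl
      rw [h3, this]; push_cast; ring
    calc _ = ∫ ω, Complex.exp (l * (1 / θ ^ 2 * ((t : ℝ) - s) : ℝ) * Complex.I) *
          Complex.exp ((l / θ : ℝ) * (extendZero X t ω - extendZero X s ω : ℝ) * Complex.I) ∂P := by
          congr with ω
          rw [← Complex.exp_add]
          congr 1
          simp only [Real.inner_apply]
          push_cast
          ring
      _ = Complex.exp (l * (1 / θ ^ 2 * ((t : ℝ) - s) : ℝ) * Complex.I) *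
          Complex.exp (((t : ℝ) - s : ℝ) * levyKernel (l / θ) θ) := by
          rw [integral_const_mul, h]
      _ = _ := by
          rw [← Complex.exp_add, e2]
          congr 1
          have hk2 : levyKernel (l / θ) θ
              = (Complex.exp (l * Complex.I) - 1 - l * Complex.I) / (θ : ℂ) ^ 2 := by
            rw [← hk]; field_simp
          rw [hk2]
          push_cast
          field_simp
          ring

end IsQuadraticHarness

end Laws

/-! ### Limits `u → ∞` and `s → 0` in an identity of two variance forms -/

section Limits

variable {Ω : Type*} {mΩ : MeasurableSpace Ω} {P : Measure Ω}
  {𝓖 : Set.Ioi (0 : ℝ) → Set.Ioi (0 : ℝ) → MeasurableSpace Ω}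
  {Y : Set.Ioi (0 : ℝ) → Ω → ℝ} {η θ σ τ γ η' θ' σ' τ' γ' : ℝ}

theorem exists_subseq_tendsto_zero {f : ℕ → Ω → ℝ} (hf : ∀ n, Integrable (f n) P)
    (h : Tendsto (fun n => ∫ ω, |f n ω| ∂P) atTop (𝓝 0)) :
    ∃ ns : ℕ → ℕ, StrictMono ns ∧ ∀ᵐ ω ∂P, Tendsto (fun k => f (ns k) ω) atTop (𝓝 0) := by
  have h1 : Tendsto (fun n => eLpNorm (f n - fun _ => 0) 1 P) atTop (𝓝 0) := by
    have e : ∀ n, eLpNorm (f n - fun _ => 0) 1 P = ENNReal.ofReal (∫ ω, |f n ω| ∂P) := by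
      intro n
      rw [eLpNorm_one_eq_lintegral_enorm, ← ofReal_integral_norm_eq_lintegral_enorm]
      · simp
      · exact (hf n).sub (integrable_zero _ _ _)
    simp_rw [e]
    simpa using ENNReal.tendsto_ofReal h
  exact (tendstoInMeasure_of_tendsto_eLpNorm one_ne_zero (fun n => (hf n).aestronglyMeasurable)
    aestronglyMeasurable_const h1).exists_seq_tendsto_ae

namespace IsQuadraticHarness

theorem tendsto_integral_abs_sub [IsProbabilityMeasure P]
    (hY : IsQuadraticHarness P 𝓖 Y η θ σ τ γ) {s : Set.Ioi (0 : ℝ)}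
    {sn : ℕ → Set.Ioi (0 : ℝ)} (hs : Tendsto (fun n => (sn n : ℝ)) atTop (𝓝 s)) :
    Tendsto (fun n => ∫ ω, |Y (sn n) ω - Y s ω| ∂P) atTop (𝓝 0) := by
  have h0 : Tendsto (fun n => √|(sn n : ℝ) - s|) atTop (𝓝 0) := by
    have h1 : Tendsto (fun n => (sn n : ℝ) - s) atTop (𝓝 0) := by
      simpa using hs.sub_const (s : ℝ)
    simpa using h1.abs.sqrt
  exact squeeze_zero (fun n => integral_nonneg fun ω => abs_nonneg _)
    (fun n => hY.integral_abs_sub_le s (sn n)) h0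

/-- Identities between two values of the process that hold at rational times hold at all times. -/
theorem ae_eq_zero_of_rat [IsProbabilityMeasure P] (hY : IsQuadraticHarness P 𝓖 Y η θ σ τ γ)
    {Ψ : ℝ → ℝ → ℝ → ℝ → ℝ}
    (hΨ : ∀ s u a b : ℝ, 0 < s → s < u →
      ContinuousAt (fun p : ℝ × ℝ × ℝ × ℝ => Ψ p.1 p.2.1 p.2.2.1 p.2.2.2) (s, u, a, b))
    (h : ∀ s u : Set.Ioi (0 : ℝ), s < u → (∃ p : ℚ, (s : ℝ) = p) → (∃ p : ℚ, (u : ℝ) = p) →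
      ∀ᵐ ω ∂P, Ψ s u (Y s ω) (Y u ω) = 0)
    {s u : Set.Ioi (0 : ℝ)} (hsu : s < u) : ∀ᵐ ω ∂P, Ψ s u (Y s ω) (Y u ω) = 0 := by
  have hs0 : (0 : ℝ) < s := s.2
  have hlt : (s : ℝ) < u := hsu
  -- Both times are approximated from the right, with `s_n` staying below `u` so that `s_n < u_n`.
  -- Convergence of the values holds in mean, hence almost surely along a subsequence.
  have ex1 : ∀ n : ℕ, ∃ p : ℚ, (s : ℝ) < p ∧ (p : ℝ) < s + (u - s) / (n + 1) := fun n =>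
    exists_rat_btwn (by
      have : 0 < ((u : ℝ) - s) / (n + 1) := div_pos (by linarith) (by positivity)
      linarith)
  have ex2 : ∀ n : ℕ, ∃ p : ℚ, (u : ℝ) < p ∧ (p : ℝ) < u + 1 / (n + 1) := fun n =>
    exists_rat_btwn (by
      have : (0 : ℝ) < 1 / (n + 1) := by positivity
      linarith)
  choose p hp1 hp2 using ex1
  choose q hq1 hq2 using ex2
  set sn : ℕ → Set.Ioi (0 : ℝ) := fun n => ⟨p n, Set.mem_Ioi.2 (hs0.trans (hp1 n))⟩
  set un : ℕ → Set.Ioi (0 : ℝ) := fun n => ⟨q n, Set.mem_Ioi.2 ((hs0.trans hlt).trans (hq1 n))⟩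
  have hinv : Tendsto (fun n : ℕ => (1 : ℝ) / (n + 1)) atTop (𝓝 0) :=
    tendsto_one_div_add_atTop_nhds_zero_nat
  have hsn : Tendsto (fun n => (sn n : ℝ)) atTop (𝓝 s) := by
    refine tendsto_of_tendsto_of_tendsto_of_le_of_le tendsto_const_nhds ?_
      (fun n => (hp1 n).le) (fun n => (hp2 n).le)
    have := (hinv.const_mul ((u : ℝ) - s)).const_add (s : ℝ)
    simpa [div_eq_mul_inv] using this
  have hun : Tendsto (fun n => (un n : ℝ)) atTop (𝓝 u) := by
    refine tendsto_of_tendsto_of_tendsto_of_le_of_le tendsto_const_nhds ?_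
      (fun n => (hq1 n).le) (fun n => (hq2 n).le)
    simpa using hinv.const_add (u : ℝ)
  have hsun : ∀ n, sn n < un n := fun n => Subtype.coe_lt_coe.1 (by
    have h1 : ((u : ℝ) - s) / (n + 1) ≤ u - s := div_le_self (by linarith) (by
      have : (0 : ℝ) ≤ n := Nat.cast_nonneg n
      linarith)
    have := hp2 n
    have := hq1 n
    simp only [sn, un]
    linarith)
  have hI : ∀ n, Integrable (fun ω => |Y (sn n) ω - Y s ω| + |Y (un n) ω - Y u ω|) P := fun n =>
    ((hY.memLp_sub s (sn n)).integrable one_le_two).abs.add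
      ((hY.memLp_sub u (un n)).integrable one_le_two).abs
  have hlim : Tendsto (fun n => ∫ ω, |(|Y (sn n) ω - Y s ω| + |Y (un n) ω - Y u ω|)| ∂P) atTop
      (𝓝 0) := by
    have := (hY.tendsto_integral_abs_sub hsn).add (hY.tendsto_integral_abs_sub hun)
    rw [add_zero] at this
    refine this.congr fun n => ?_
    rw [← integral_add ((hY.memLp_sub s (sn n)).integrable one_le_two).abs
      ((hY.memLp_sub u (un n)).integrable one_le_two).abs]
    congr with ω
    exact (abs_of_nonneg (add_nonneg (abs_nonneg _) (abs_nonneg _))).symm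
  obtain ⟨ns, hns, hae⟩ := exists_subseq_tendsto_zero hI hlim
  have hall : ∀ᵐ ω ∂P, ∀ n, Ψ (sn n) (un n) (Y (sn n) ω) (Y (un n) ω) = 0 :=
    ae_all_iff.2 fun n => h (sn n) (un n) (hsun n) ⟨p n, rfl⟩ ⟨q n, rfl⟩
  filter_upwards [hae, hall] with ω h1 h2
  have t1 : Tendsto (fun k => Y (sn (ns k)) ω) atTop (𝓝 (Y s ω)) := by
    rw [tendsto_iff_norm_sub_tendsto_zero]
    exact squeeze_zero (fun k => norm_nonneg _)
      (fun k => le_add_of_nonneg_right (abs_nonneg _)) h1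
  have t2 : Tendsto (fun k => Y (un (ns k)) ω) atTop (𝓝 (Y u ω)) := by
    rw [tendsto_iff_norm_sub_tendsto_zero]
    exact squeeze_zero (fun k => norm_nonneg _)
      (fun k => le_add_of_nonneg_left (abs_nonneg _)) h1
  have t3 := (hsn.comp hns.tendsto_atTop).prodMk_nhds ((hun.comp hns.tendsto_atTop).prodMk_nhds
    (t1.prodMk_nhds t2))
  have t4 := (hΨ s u (Y s ω) (Y u ω) hs0 hlt).tendsto.comp t3
  have t5 : Tendsto (fun _ : ℕ => (0 : ℝ)) atTop (𝓝 (Ψ s u (Y s ω) (Y u ω))) :=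
    t4.congr fun k => h2 (ns k)
  exact tendsto_nhds_unique t5 tendsto_const_nhds |>.symm ▸ rfl

/-- Letting `u → ∞` in an identity between two conditional variances. -/
theorem ae_quadratic_eq [IsProbabilityMeasure P] (hY : IsQuadraticHarness P 𝓖 Y 0 θ' 0 τ' γ')
    (hD : ∀ s u : Set.Ioi (0 : ℝ), s < u → denom σ τ γ s u ≠ 0)
    (h : ∀ s u : Set.Ioi (0 : ℝ), s < u → ∀ᵐ ω ∂P,
      quadK η θ σ τ γ (delta s u (Y s ω) (Y u ω)) (deltaTilde s u (Y s ω) (Y u ω))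
          / denom σ τ γ s u
        = quadK 0 θ' 0 τ' γ' (delta s u (Y s ω) (Y u ω)) (deltaTilde s u (Y s ω) (Y u ω))
          / denom 0 τ' γ' s u) (s : Set.Ioi (0 : ℝ)) :
    ∀ᵐ ω ∂P, σ * Y s ω ^ 2 + η * Y s ω = σ * s := by
  have hs0 : (0 : ℝ) < s := s.2
  set un : ℕ → Set.Ioi (0 : ℝ) := fun n => ⟨(s : ℝ) + (n + 1), Set.mem_Ioi.2 (by positivity)⟩
  have hsun : ∀ n, s < un n := fun n => Subtype.coe_lt_coe.1 (by
    simp only [un]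
    have : (0 : ℝ) ≤ n := Nat.cast_nonneg n
    linarith)
  have hdu : ∀ n, (un n : ℝ) - s = n + 1 := fun n => by simp [un]
  have hinv : Tendsto (fun n : ℕ => (1 : ℝ) / (n + 1)) atTop (𝓝 0) :=
    tendsto_one_div_add_atTop_nhds_zero_nat
  have hlim : Tendsto (fun n => ∫ ω, |delta s (un n) (Y s ω) (Y (un n) ω)| ∂P) atTop (𝓝 0) := by
    refine squeeze_zero (fun n => integral_nonneg fun ω => abs_nonneg _)
      (fun n => integral_abs_le_sqrt (hY.memLp_delta s (un n))) ?_
    simp_rw [hY.integral_delta_sq (hsun _), hdu]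
    simpa using hinv.sqrt
  obtain ⟨ns, hns, hae⟩ := exists_subseq_tendsto_zero
    (fun n => (hY.memLp_delta s (un n)).integrable one_le_two) hlim
  have hall : ∀ᵐ ω ∂P, ∀ n, _ := ae_all_iff.2 fun n => h s (un n) (hsun n)
  filter_upwards [hae, hall] with ω h1 h2
  set d : ℕ → ℝ := fun k => delta s (un (ns k)) (Y s ω) (Y (un (ns k)) ω) with hd
  -- Since `Δ̃ = Y_s - s Δ`, only `Δ → 0` is needed, and `E Δ² = 1/(u - s)` yields it along a
  -- subsequence.
  have hdt : ∀ k, deltaTilde s (un (ns k)) (Y s ω) (Y (un (ns k)) ω) = Y s ω - s * d k := by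
    intro k
    have : (un (ns k) : ℝ) - s ≠ 0 := by rw [hdu]; positivity
    simp only [hd, delta, deltaTilde]
    field_simp
    ring
  have hr : Tendsto (fun k => 1 / ((un (ns k) : ℝ))) atTop (𝓝 0) := by
    have h3 : Tendsto (fun n => 1 / ((un n : ℝ))) atTop (𝓝 0) := by
      refine squeeze_zero (fun n => by simp only [un]; positivity) (fun n => ?_) hinv
      simp only [un]
      exact one_div_le_one_div_of_le (by positivity) (by linarith)
    exact h3.comp hns.tendsto_atTop
  -- Clear denominators and divide by `u`: the denominators become `1 + O(1/u)` and `1 + s σ +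
  -- O(1/u)`.
  have heq : ∀ k, quadK η θ σ τ γ (d k) (Y s ω - s * d k)
        * (1 + (τ' - s * γ') * (1 / (un (ns k) : ℝ)))
      = quadK 0 θ' 0 τ' γ' (d k) (Y s ω - s * d k)
        * ((1 + s * σ) + (τ - s * γ) * (1 / (un (ns k) : ℝ))) := by
    intro k
    have h3 := h2 (ns k)
    have hu0 : (0 : ℝ) < un (ns k) := (un (ns k)).2
    rw [hdt, div_eq_div_iff (hD s _ (hsun _)) (hY.denom_ne_zero (hsun _))] at h3
    change quadK η θ σ τ γ (d k) (Y s ω - s * d k) * denom 0 τ' γ' s (un (ns k))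
      = quadK 0 θ' 0 τ' γ' (d k) (Y s ω - s * d k) * denom σ τ γ s (un (ns k)) at h3
    have e1 : 1 + (τ' - s * γ') * (1 / (un (ns k) : ℝ))
        = denom 0 τ' γ' s (un (ns k)) / un (ns k) := by
      rw [denom]; field_simp; ring
    have e2 : (1 + s * σ) + (τ - s * γ) * (1 / (un (ns k) : ℝ))
        = denom σ τ γ s (un (ns k)) / un (ns k) := by
      rw [denom]; field_simp; ring
    rw [e1, e2, ← mul_div_assoc, ← mul_div_assoc, h3]
  have hq : ∀ η θ σ τ γ : ℝ, Tendsto (fun k => quadK η θ σ τ γ (d k) (Y s ω - s * d k)) atTop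
      (𝓝 (quadK η θ σ τ γ 0 (Y s ω - s * 0))) := by
    intro η θ σ τ γ
    have hc : Continuous fun x : ℝ => quadK η θ σ τ γ x (Y s ω - s * x) := by
      unfold quadK; fun_prop
    exact (hc.tendsto 0).comp h1
  have hl := (hq η θ σ τ γ).mul ((hr.const_mul (τ' - s * γ')).const_add 1)
  have hrr := (hq 0 θ' 0 τ' γ').mul ((hr.const_mul (τ - s * γ)).const_add (1 + s * σ))
  have := tendsto_nhds_unique (hl.congr heq) hrr
  simp only [quadK] at this
  ring_nf at this ⊢
  linarith

/-- A two-valued harness: if `Y_t² = t - ρ Y_t` then the conditional variances determine `ρ`. -/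
theorem eq_neg_of_ae_sq_eq [IsProbabilityMeasure P] (hY : IsQuadraticHarness P 𝓖 Y 0 θ' 0 τ' γ')
    (hτ : 0 ≤ τ)
    (h : ∀ s u : Set.Ioi (0 : ℝ), s < u → ∀ᵐ ω ∂P,
      quadK η θ σ τ γ (delta s u (Y s ω) (Y u ω)) (deltaTilde s u (Y s ω) (Y u ω))
          / denom σ τ γ s u
        = quadK 0 θ' 0 τ' γ' (delta s u (Y s ω) (Y u ω)) (deltaTilde s u (Y s ω) (Y u ω))
          / denom 0 τ' γ' s u) {ρ : ℝ}
    (hρ : ∀ t : Set.Ioi (0 : ℝ), ∀ᵐ ω ∂P, Y t ω ^ 2 = t - ρ * Y t ω) : θ = -ρ := by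
  -- As `Y_t²` is affine in `Y_t`, its conditional mean is known from the harness property, which
  -- gives a second formula for the conditional variance.
  have hvar : ∀ s t u : Set.Ioi (0 : ℝ), s < t → t < u → ∀ᵐ ω ∂P,
      ((u : ℝ) - t) * (t - s) * (quadK η θ σ τ γ (delta s u (Y s ω) (Y u ω))
        (deltaTilde s u (Y s ω) (Y u ω)) / denom σ τ γ s u)
        = t - ρ * chord s t u (Y s ω) (Y u ω) - chord s t u (Y s ω) (Y u ω) ^ 2 := by
    intro s t u hst htu
    have hsu := hst.trans htu
    have hm := hY.le s u hsu
    have e1 := condVar_ae_eq_condExp_sq_sub_sq_condExp hm (hY.memLp t)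
    have e2 : P[Y t ^ 2 | 𝓖 s u] =ᵐ[P] P[(fun _ => (t : ℝ)) - ρ • Y t | 𝓖 s u] :=
      condExp_congr_ae (by
        filter_upwards [hρ t] with ω hω
        simpa using hω)
    have e3 := condExp_sub (integrable_const (μ := P) (t : ℝ)) ((hY.integrable t).smul ρ) (𝓖 s u)
    have e4 := condExp_smul (μ := P) ρ (Y t) (𝓖 s u)
    rw [condExp_const hm] at e3
    filter_upwards [e1, e2, e3, e4, hY.harness s t u hst htu, hY.condVar s t u hst htu, h s u hsu]
      with ω h1 h2 h3 h4 h5 h6 h7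
    rw [h7]
    rw [h1, Pi.sub_apply, Pi.pow_apply, h2, h3, Pi.sub_apply, h4, Pi.smul_apply, h5,
      factorF_eq, smul_eq_mul] at h6
    rw [chord, h6]
    ring
  set u : Set.Ioi (0 : ℝ) := ⟨2, by simp⟩
  set t : Set.Ioi (0 : ℝ) := ⟨1, by simp⟩
  have hu : (u : ℝ) = 2 := rfl
  have ht : (t : ℝ) = 1 := rfl
  set sn : ℕ → Set.Ioi (0 : ℝ) := fun n => ⟨1 / (n + 2), Set.mem_Ioi.2 (by positivity)⟩
  have hsnr : ∀ n, (sn n : ℝ) = 1 / (n + 2) := fun n => rfl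
  have hsn1 : ∀ n, sn n < t := fun n => Subtype.coe_lt_coe.1 (by
    rw [hsnr, ht, div_lt_one (by positivity)]
    have : (0 : ℝ) ≤ n := Nat.cast_nonneg n
    linarith)
  have htu : t < u := Subtype.coe_lt_coe.1 (by rw [ht, hu]; norm_num)
  have hsn : Tendsto (fun n => (sn n : ℝ)) atTop (𝓝 0) := by
    have := (tendsto_const_div_atTop_nhds_zero_nat (1 : ℝ)).comp (tendsto_add_atTop_nat 2)
    refine this.congr fun n => ?_
    simp [hsnr]
  have hlim : Tendsto (fun n => ∫ ω, |Y (sn n) ω| ∂P) atTop (𝓝 0) := by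
    refine squeeze_zero (fun n => integral_nonneg fun ω => abs_nonneg _)
      (fun n => integral_abs_le_sqrt (hY.memLp (sn n))) ?_
    simp_rw [hY.integral_sq]
    simpa using hsn.sqrt
  obtain ⟨ns, hns, hae⟩ := exists_subseq_tendsto_zero (fun n => hY.integrable (sn n)) hlim
  have hall : ∀ᵐ ω ∂P, ∀ n, _ := ae_all_iff.2 fun n => hvar (sn n) t u (hsn1 n) htu
  -- At `s → 0`, `t = 1`, `u = 2`, with `y = Y_2`, the two formulas read `(1 + θ y/2 + τ y²/4)/(2 +
  -- τ) = 1 - ρ y/2 - y²/4`; substituting `y² = 2 - ρ y` leaves `(θ + ρ) y = 0`.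
  have hz : ∀ᵐ ω ∂P, (θ + ρ) * Y u ω = 0 := by
    filter_upwards [hae, hall, hρ u] with ω h1 h2 h3
    have hs' := hsn.comp hns.tendsto_atTop
    have hp : Tendsto (fun k => ((sn (ns k) : ℝ), Y (sn (ns k)) ω)) atTop (𝓝 ((0 : ℝ), (0 : ℝ))) :=
      hs'.prodMk_nhds h1
    have c1 : ContinuousAt (fun p : ℝ × ℝ => ((u : ℝ) - t) * (t - p.1) *
        (quadK η θ σ τ γ (delta p.1 u p.2 (Y u ω)) (deltaTilde p.1 u p.2 (Y u ω))
          / denom σ τ γ p.1 u)) (0, 0) := by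
      unfold quadK delta deltaTilde denom
      have d1 : (u : ℝ) - ((0 : ℝ), (0 : ℝ)).1 ≠ 0 := by rw [hu]; norm_num
      have d2 : (u : ℝ) * (1 + ((0 : ℝ), (0 : ℝ)).1 * σ) + τ - ((0 : ℝ), (0 : ℝ)).1 * γ ≠ 0 := by
        rw [hu]; simp only [zero_mul]; linarith
      fun_prop (disch := assumption)
    have c2 : ContinuousAt (fun p : ℝ × ℝ => (t : ℝ) - ρ * chord p.1 t u p.2 (Y u ω)
        - chord p.1 t u p.2 (Y u ω) ^ 2) (0, 0) := by
      unfold chord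
      have d1 : (u : ℝ) - ((0 : ℝ), (0 : ℝ)).1 ≠ 0 := by rw [hu]; norm_num
      fun_prop (disch := assumption)
    have l1 := c1.tendsto.comp hp
    have l2 := c2.tendsto.comp hp
    have l3 := tendsto_nhds_unique (l1.congr fun k => h2 (ns k)) l2
    have d2 : 2 + τ ≠ 0 := by linarith
    simp only [quadK, delta, deltaTilde, denom, chord, hu, ht] at l3
    rw [hu] at h3
    norm_num at l3
    rw [div_eq_iff d2] at l3
    generalize Y u ω = y at *
    have h4 : y ^ 2 = 2 - ρ * y := h3
    have h5 : (θ + ρ) * y * (2 : ℝ) = 0 := by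
      ring_nf at l3 h4 ⊢
      nlinarith
    linarith
  by_contra hne
  have hne' : θ + ρ ≠ 0 := fun h0 => hne (by linarith)
  have h0 : ∫ ω, Y u ω ^ 2 ∂P = 0 := by
    rw [← integral_zero Ω ℝ (μ := P)]
    apply integral_congr_ae
    filter_upwards [hz] with ω hω
    rcases mul_eq_zero.1 hω with h | h
    · exact absurd h hne'
    · rw [h]; norm_num
  rw [hY.integral_sq, hu] at h0
  norm_num at h0

/-- If the conditional variances of a `q`-Meixner process are also given by a quadratic form with
other parameters, then either this form has `σ = η = 0`, or the process is two-valued. -/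
theorem meixner_dichotomy [IsProbabilityMeasure P] (hY : IsQuadraticHarness P 𝓖 Y 0 θ' 0 τ' γ')
    (hτ : 0 ≤ τ) (hD : ∀ s u : Set.Ioi (0 : ℝ), s < u → denom σ τ γ s u ≠ 0)
    (h : ∀ s u : Set.Ioi (0 : ℝ), s < u → ∀ᵐ ω ∂P,
      quadK η θ σ τ γ (delta s u (Y s ω) (Y u ω)) (deltaTilde s u (Y s ω) (Y u ω))
          / denom σ τ γ s u
        = quadK 0 θ' 0 τ' γ' (delta s u (Y s ω) (Y u ω)) (deltaTilde s u (Y s ω) (Y u ω))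
          / denom 0 τ' γ' s u) :
    (σ = 0 → η = 0) ∧ (σ ≠ 0 → ∀ t : Set.Ioi (0 : ℝ), ∀ᵐ ω ∂P, Y t ω ^ 2 = t + θ * Y t ω) := by
  have hq := hY.ae_quadratic_eq hD h
  refine ⟨fun hσ => ?_, fun hσ => ?_⟩
  · by_contra hη
    set u : Set.Ioi (0 : ℝ) := ⟨1, by simp⟩
    have h0 : ∫ ω, Y u ω ^ 2 ∂P = 0 := by
      rw [← integral_zero Ω ℝ (μ := P)]
      apply integral_congr_ae
      filter_upwards [hq u] with ω hω
      rw [hσ] at hω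
      have : η * Y u ω = 0 := by linarith
      rcases mul_eq_zero.1 this with h | h
      · exact absurd h hη
      · rw [h]; norm_num
    rw [hY.integral_sq] at h0
    exact one_ne_zero h0
  · have hρ : ∀ t : Set.Ioi (0 : ℝ), ∀ᵐ ω ∂P, Y t ω ^ 2 = t - η / σ * Y t ω := fun t => by
      filter_upwards [hq t] with ω hω
      have h1 : Y t ω ^ 2 = (σ * t - η * Y t ω) / σ := by
        rw [eq_div_iff hσ]; linarith
      rw [h1]; field_simp
    have hθ := hY.eq_neg_of_ae_sq_eq hτ h hρ
    intro t
    filter_upwards [hρ t] with ω hω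
    rw [hω, hθ]; ring

end IsQuadraticHarness

end Limits

/-! ### Identities for almost every conditional law -/

section Disintegration

variable {E F : Type*} [MeasurableSpace E] [MeasurableSpace F]

/-- The sets with vanishing integral form a λ-system; an algebra generating the σ-field suffices.
Together with countable generation this lets one null set of `z` serve all Borel sets. -/
theorem setIntegral_eq_zero_of_generateFrom {μ : Measure E} {f : E → ℝ} (hf : Integrable f μ)
    {g : E → F} (hg : Measurable g) {𝒜 : Set (Set F)} (h𝒜 : IsSetAlgebra 𝒜)
    (hgen : ‹MeasurableSpace F› = MeasurableSpace.generateFrom 𝒜)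
    (h : ∀ B ∈ 𝒜, ∫ x in g ⁻¹' B, f x ∂μ = 0) (B : Set F) (hB : MeasurableSet B) :
    ∫ x in g ⁻¹' B, f x ∂μ = 0 := by
  induction B, hB using MeasurableSpace.induction_on_inter hgen
    h𝒜.isSetRing.isSetSemiring.isPiSystem with
  | empty => simp
  | basic t ht => exact h t ht
  | compl t ht ih =>
    have h1 := h _ h𝒜.univ_mem
    rw [Set.preimage_univ, setIntegral_univ] at h1
    rw [Set.preimage_compl, setIntegral_compl (hg ht) hf, h1, ih, sub_zero]
  | iUnion t hd ht ih =>
    rw [Set.preimage_iUnion, integral_iUnion (fun i => hg (ht i))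
      (fun i j hij => (hd hij).preimage g) hf.integrableOn]
    simp [ih]

/-- A function all of whose integrals over `S × g⁻¹ B` vanish has vanishing integrals over the sets
`g⁻¹ B` for almost all conditional measures. -/
theorem ae_setIntegral_eq_zero [MeasurableSpace.CountablyGenerated F] {ρ : Measure (ℝ × E)}
    [IsProbabilityMeasure ρ] {ν : Kernel ℝ E} [IsMarkovKernel ν] [hν : ρ.IsCondKernel ν]
    {f : E → ℝ} (hf : Integrable (fun p : ℝ × E => f p.2) ρ) {g : E → F} (hg : Measurable g)
    (h : ∀ S, MeasurableSet S → ∀ B, MeasurableSet B →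
      ∫ p in S ×ˢ (g ⁻¹' B), f p.2 ∂ρ = 0) :
    ∀ᵐ z ∂ρ.fst, Integrable f (ν z) ∧
      ∀ B, MeasurableSet B → ∫ x in g ⁻¹' B, f x ∂ν z = 0 := by
  have hd : ρ.fst ⊗ₘ ν = ρ := ρ.disintegrate ν
  have hf' : Integrable (fun p : ℝ × E => f p.2) (ρ.fst ⊗ₘ ν) := by rwa [hd]
  have h1 := ((Measure.integrable_compProd_iff hf'.aestronglyMeasurable).1 hf').1
  set 𝒜 : Set (Set F) := generateSetAlgebra (MeasurableSpace.countableGeneratingSet F) with h𝒜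
  have hc : 𝒜.Countable :=
    countable_generateSetAlgebra MeasurableSpace.countable_countableGeneratingSet
  have hgen : ‹MeasurableSpace F› = MeasurableSpace.generateFrom 𝒜 := by
    rw [h𝒜, generateFrom_generateSetAlgebra_eq,
      MeasurableSpace.generateFrom_countableGeneratingSet]
  have hm : ∀ B ∈ 𝒜, MeasurableSet B := fun B hB => by
    rw [hgen]; exact MeasurableSpace.measurableSet_generateFrom hB
  have h2 : ∀ B ∈ 𝒜, ∀ᵐ z ∂ρ.fst, ∫ x in g ⁻¹' B, f x ∂ν z = 0 := by
    intro B hB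
    have hI : Integrable (fun z => ∫ x in g ⁻¹' B, f x ∂ν z) ρ.fst := by
      have h3 : Integrable ((Set.univ ×ˢ (g ⁻¹' B)).indicator fun p : ℝ × E => f p.2)
          (ρ.fst ⊗ₘ ν) := hf'.indicator (MeasurableSet.univ.prod (hg (hm B hB)))
      have h4 := h3.integral_compProd
      refine (h4.congr (Eventually.of_forall fun z => ?_))
      simp only [Kernel.prodMkLeft_apply]
      rw [← integral_indicator (hg (hm B hB))]
      congr with x
      by_cases hx : x ∈ g ⁻¹' B <;> simp [Set.indicator, hx]
    -- For fixed `B` the fibre integral is a function of `z` whose integrals over all measurable `S`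
    -- vanish.
    refine hI.ae_eq_zero_of_forall_setIntegral_eq_zero fun S hS _ => ?_
    rw [← Measure.setIntegral_compProd hS (hg (hm B hB)) (f := fun p : ℝ × E => f p.2)
      hf'.integrableOn, hd]
    exact h S hS B (hm B hB)
  filter_upwards [h1, (ae_ball_iff hc).2 h2] with z hz1 hz2
  exact ⟨hz1, setIntegral_eq_zero_of_generateFrom hz1 hg isSetAlgebra_generateSetAlgebra hgen hz2⟩

theorem ae_comp_eq_zero_of_forall_setIntegral {μ : Measure E} {G : F → ℝ} (hG : Measurable G)
    {g : E → F} (hg : Measurable g) (hI : Integrable (fun x => G (g x)) μ)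
    (h : ∀ B, MeasurableSet B → ∫ x in g ⁻¹' B, G (g x) ∂μ = 0) : ∀ᵐ x ∂μ, G (g x) = 0 := by
  have h1 : Integrable G (μ.map g) :=
    (integrable_map_measure hG.aestronglyMeasurable hg.aemeasurable).2 hI
  have h2 : G =ᵐ[μ.map g] 0 := h1.ae_eq_zero_of_forall_setIntegral_eq_zero fun B hB _ => by
    rw [setIntegral_map hB hG.aestronglyMeasurable hg.aemeasurable, h B hB]
  exact ae_of_ae_map hg.aemeasurable h2

end Disintegration

/-! ### How the variance form changes under the bridge transformation -/

section Algebra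

/-- The first parameter of the transformed bridge. -/
noncomputable def bridgeEta (η θ τ γ V z : ℝ) : ℝ :=
  (η - θ / V - z * (2 * τ / V ^ 2 + (1 - γ) / V)) / bridgeKappa θ τ V z

/-- The second parameter of the transformed bridge. -/
noncomputable def bridgeTheta (θ τ V z : ℝ) : ℝ := (θ + 2 * τ * (z / V)) / bridgeKappa θ τ V z

/-- The third parameter of the transformed bridge. -/
noncomputable def bridgeSigma (σ τ γ V : ℝ) : ℝ := (σ + τ / V ^ 2 + (1 - γ) / V) / (1 + τ / V)

/-- The fourth parameter of the transformed bridge. -/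
noncomputable def bridgeTau (τ V : ℝ) : ℝ := V * τ / (V + τ)

/-- The fifth parameter of the transformed bridge. -/
noncomputable def bridgeGamma (τ γ V : ℝ) : ℝ := 1 - (2 * τ / V + (1 - γ)) / (1 + τ / V)

theorem bridgeKappa_sq {θ τ V z : ℝ} (h : 0 < bridgeKappa θ τ V z) :
    bridgeKappa θ τ V z ^ 2 = (1 + τ / V) * (1 + θ * (z / V) + τ * (z ^ 2 / V ^ 2)) :=
  Real.sq_sqrt (Real.sqrt_pos.1 h).le

variable {η θ σ τ γ V z s t u a b m : ℝ}

/-- The Möbius time change with the factor `1 + t/V` sends straight lines to straight lines, and the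
term in `z` is itself linear in time; so deviations from chords only scale. -/
theorem bridge_sub_chord {c : ℝ} (hV : 0 < V) (hs : 0 < s) (ht : 0 < t) (hu : 0 < u)
    (hsu : s < u) :
    c * ((1 + t / V) * m - t / V * z) - chord s t u (c * ((1 + s / V) * a - s / V * z))
        (c * ((1 + u / V) * b - u / V * z))
      = c * (1 + t / V)
        * (m - chord (s / (1 + s / V)) (t / (1 + t / V)) (u / (1 + u / V)) a b) := by
  have h1 : V + s ≠ 0 := by positivity
  have h2 : V + t ≠ 0 := by positivity
  have h3 : V + u ≠ 0 := by positivity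
  have h4 : u - s ≠ 0 := by linarith
  have e : ∀ x y : ℝ, 0 < x → 0 < y → x / (1 + x / V) - y / (1 + y / V)
      = V ^ 2 * (x - y) / ((V + x) * (V + y)) := by
    intro x y hx hy
    have : V + x ≠ 0 := by positivity
    have : V + y ≠ 0 := by positivity
    field_simp
    ring
  rw [chord, chord, e u t hu ht, e u s hu hs, e t s ht hs]
  field_simp
  ring

theorem bridge_deltaTilde {c : ℝ} (hc : c ≠ 0) (hV : 0 < V) (hs : 0 < s) (hu : 0 < u)
    (hsu : s < u) :
    deltaTilde (s / (1 + s / V)) (u / (1 + u / V)) a b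
      = deltaTilde s u (c * ((1 + s / V) * a - s / V * z)) (c * ((1 + u / V) * b - u / V * z))
        / c := by
  have h1 : V + s ≠ 0 := by positivity
  have h3 : V + u ≠ 0 := by positivity
  have h4 : u - s ≠ 0 := by linarith
  have e : u / (1 + u / V) - s / (1 + s / V) = V ^ 2 * (u - s) / ((V + u) * (V + s)) := by
    field_simp
    ring
  rw [deltaTilde, deltaTilde, e]
  field_simp
  ring

theorem bridge_delta {c : ℝ} (hc : c ≠ 0) (hV : 0 < V) (hs : 0 < s) (hu : 0 < u)
    (hsu : s < u) :
    delta (s / (1 + s / V)) (u / (1 + u / V)) a b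
      = z / V + (delta s u (c * ((1 + s / V) * a - s / V * z)) (c * ((1 + u / V) * b - u / V * z))
        - deltaTilde s u (c * ((1 + s / V) * a - s / V * z)) (c * ((1 + u / V) * b - u / V * z)) / V)
        / c := by
  have h1 : V + s ≠ 0 := by positivity
  have h3 : V + u ≠ 0 := by positivity
  have h4 : u - s ≠ 0 := by linarith
  have e : u / (1 + u / V) - s / (1 + s / V) = V ^ 2 * (u - s) / ((V + u) * (V + s)) := by
    field_simp
    ring
  rw [delta, delta, deltaTilde, e]
  field_simp
  ring

/-- The form is expanded about slope `z/V` and intercept `0`. Its value there is `κ²/(1 + τ/V)`, and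
dividing by it restores the constant term `1`; this fixes the choice of `κ`. -/
theorem bridge_quadK (hV : 0 < V) (hτ : 0 ≤ τ) (hκ : 0 < bridgeKappa θ τ V z) (d d' : ℝ) :
    quadK η θ σ τ γ (z / V + (d - d' / V) / ((1 + τ / V) / bridgeKappa θ τ V z))
        (d' / ((1 + τ / V) / bridgeKappa θ τ V z))
      = (1 + θ * (z / V) + τ * (z ^ 2 / V ^ 2)) * quadK (bridgeEta η θ τ γ V z)
        (bridgeTheta θ τ V z) (bridgeSigma σ τ γ V) (bridgeTau τ V) (bridgeGamma τ γ V) d d' := by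
  have hk := bridgeKappa_sq hκ
  have hτV : 1 + τ / V ≠ 0 := by positivity
  have hVτ : V + τ ≠ 0 := by positivity
  unfold bridgeEta bridgeTheta
  generalize bridgeKappa θ τ V z = κ at *
  have hk0 : 1 + θ * (z / V) + τ * (z ^ 2 / V ^ 2) = κ ^ 2 / (1 + τ / V) := by
    rw [eq_div_iff hτV, hk]; ring
  have e : 1 + θ * (z / V) + τ * (z / V) ^ 2 = κ ^ 2 / (1 + τ / V) := by
    rw [← hk0]; ring
  rw [hk0]
  have hexp : quadK η θ σ τ γ (z / V + (d - d' / V) / ((1 + τ / V) / κ)) (d' / ((1 + τ / V) / κ))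
      = (1 + θ * (z / V) + τ * (z / V) ^ 2)
        + κ / (1 + τ / V) * ((η - θ / V - z * (2 * τ / V ^ 2 + (1 - γ) / V)) * d'
          + (θ + 2 * τ * (z / V)) * d)
        + (κ / (1 + τ / V)) ^ 2 * ((σ + τ / V ^ 2 + (1 - γ) / V) * d' ^ 2 + τ * d ^ 2
          - (2 * τ / V + (1 - γ)) * (d * d')) := by
    rw [quadK]
    field_simp
    ring
  rw [hexp, e, quadK, bridgeSigma, bridgeTau, bridgeGamma]
  have e2 : V * τ / (V + τ) = τ / (1 + τ / V) := by field_simp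
  rw [e2]
  field_simp
  ring

theorem bridge_denom (hV : 0 < V) (hτ : 0 ≤ τ) (hs : 0 < s) (hu : 0 < u) :
    (1 + τ / V) * denom (bridgeSigma σ τ γ V) (bridgeTau τ V) (bridgeGamma τ γ V) s u
      = (1 + s / V) * (1 + u / V) * denom σ τ γ (s / (1 + s / V)) (u / (1 + u / V)) := by
  have h1 : V + s ≠ 0 := by positivity
  have h3 : V + u ≠ 0 := by positivity
  have hVτ : V + τ ≠ 0 := by positivity
  rw [denom, denom, bridgeSigma, bridgeTau, bridgeGamma]
  field_simp
  ring

theorem bridge_factorF (hV : 0 < V) (hτ : 0 ≤ τ) (hκ : 0 < bridgeKappa θ τ V z) (hs : 0 < s)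
    (ht : 0 < t) (hu : 0 < u) :
    ((1 + τ / V) / bridgeKappa θ τ V z * (1 + t / V)) ^ 2
        * (factorF σ τ γ (t / (1 + t / V)) (s / (1 + s / V)) (u / (1 + u / V))
          * (1 + θ * (z / V) + τ * (z ^ 2 / V ^ 2)))
      = factorF (bridgeSigma σ τ γ V) (bridgeTau τ V) (bridgeGamma τ γ V) t s u := by
  have hk := bridgeKappa_sq hκ
  have hτV : 1 + τ / V ≠ 0 := by positivity
  have h1 : 1 + s / V ≠ 0 := by positivity
  have h2 : 1 + t / V ≠ 0 := by positivity
  have h3 : 1 + u / V ≠ 0 := by positivity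
  generalize bridgeKappa θ τ V z = κ at *
  have hk0 : 1 + θ * (z / V) + τ * (z ^ 2 / V ^ 2) = κ ^ 2 / (1 + τ / V) := by
    rw [eq_div_iff hτV, hk]; ring
  have hD : denom (bridgeSigma σ τ γ V) (bridgeTau τ V) (bridgeGamma τ γ V) s u
      = (1 + s / V) * (1 + u / V) / (1 + τ / V)
        * denom σ τ γ (s / (1 + s / V)) (u / (1 + u / V)) := by
    have := bridge_denom (σ := σ) (γ := γ) hV hτ hs hu
    rw [div_mul_eq_mul_div, eq_div_iff hτV, ← this]; ring
  have e : ∀ x y : ℝ, 0 < x → 0 < y → x / (1 + x / V) - y / (1 + y / V)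
      = (x - y) / ((1 + x / V) * (1 + y / V)) := by
    intro x y hx hy
    have : 1 + x / V ≠ 0 := by positivity
    have : 1 + y / V ≠ 0 := by positivity
    rw [div_sub_div _ _ ‹_› ‹_›]
    congr 1
    ring
  rw [factorF_eq, factorF_eq, hk0, hD, e u t hu ht, e t s ht hs]
  generalize denom σ τ γ (s / (1 + s / V)) (u / (1 + u / V)) = D
  generalize 1 + s / V = A at *
  generalize 1 + t / V = B at *
  generalize 1 + u / V = C at *
  generalize 1 + τ / V = T at *
  -- If the common denominator vanishes, both sides are zero by the convention for division.
  rcases eq_or_ne D 0 with rfl | hD0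
  · simp
  · field_simp

end Algebra

/-! ### Conditional variances of the bridges -/

section Bridge

variable {Ω : Type*} {mΩ : MeasurableSpace Ω} {P : Measure Ω}
  {𝓕 : Set.Ioi (0 : ℝ) → Set.Ioi (0 : ℝ) → MeasurableSpace Ω}
  {Z : Set.Ioi (0 : ℝ) → Ω → ℝ} {η θ σ τ γ V : ℝ}

/-- The squared deviation from the chord minus the conditional variance, along a path. -/
noncomputable def varianceDefect (σ τ γ η θ : ℝ) {T : Set ℝ} (s t u : T) (x : T → ℝ) : ℝ :=
  (x t - chord s t u (x s) (x u)) ^ 2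
    - factorF σ τ γ t s u * quadK η θ σ τ γ (delta s u (x s) (x u)) (deltaTilde s u (x s) (x u))

theorem measurable_varianceDefect {T : Set ℝ} (s t u : T) :
    Measurable (varianceDefect σ τ γ η θ s t u) := by
  unfold varianceDefect quadK delta deltaTilde chord
  fun_prop

namespace IsQuadraticHarness

theorem measurable_joint (hZ : IsQuadraticHarness P 𝓕 Z η θ σ τ γ) (hV : 0 < V) :
    Measurable fun ω => (Z ⟨V, hV⟩ ω, fun t : Set.Ioo 0 V => Z ⟨t, t.2.1⟩ ω) :=
  (hZ.measurable _).prodMk (measurable_pi_lambda _ fun _ => hZ.measurable _)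

theorem jointLaw_fst (hZ : IsQuadraticHarness P 𝓕 Z η θ σ τ γ) (hV : 0 < V) :
    (jointLaw P Z V hV).fst = P.map (Z ⟨V, hV⟩) := by
  rw [Measure.fst, jointLaw, Measure.map_map measurable_fst (hZ.measurable_joint hV)]
  rfl

theorem isProbabilityMeasure_jointLaw [IsProbabilityMeasure P]
    (hZ : IsQuadraticHarness P 𝓕 Z η θ σ τ γ) (hV : 0 < V) :
    IsProbabilityMeasure (jointLaw P Z V hV) :=
  Measure.isProbabilityMeasure_map (hZ.measurable_joint hV).aemeasurable

/-- A statement about the value and the path that holds for almost all bridges holds for the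
process. -/
theorem ae_of_ae_bridge (hZ : IsQuadraticHarness P 𝓕 Z η θ σ τ γ) (hV : 0 < V)
    {ν : Kernel ℝ (Set.Ioo 0 V → ℝ)} (hν : (jointLaw P Z V hV).IsCondKernel ν)
    {p : ℝ × (Set.Ioo 0 V → ℝ) → Prop}
    (hp : MeasurableSet {y | p y})
    (h : ∀ᵐ z ∂P.map (Z ⟨V, hV⟩), ∀ᵐ x ∂ν z, p (z, x)) :
    ∀ᵐ ω ∂P, p (Z ⟨V, hV⟩ ω, fun t : Set.Ioo 0 V => Z ⟨t, t.2.1⟩ ω) := by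
  rw [← hZ.jointLaw_fst hV] at h
  have h1 := Measure.ae_compProd_of_ae_ae hp h
  rw [(jointLaw P Z V hV).disintegrate ν] at h1
  exact ae_of_ae_map (hZ.measurable_joint hV).aemeasurable h1

variable {ν : Kernel ℝ (Set.Ioo 0 V → ℝ)} [IsMarkovKernel ν]

/-- The conditional variances of the bridges. -/
theorem ae_setIntegral_varianceDefect [IsProbabilityMeasure P]
    (hZ : IsQuadraticHarness P 𝓕 Z η θ σ τ γ) (hV : 0 < V)
    (hν : (jointLaw P Z V hV).IsCondKernel ν) {s t u : Set.Ioo 0 V} (hst : s < t) (htu : t < u) :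
    ∀ᵐ z ∂P.map (Z ⟨V, hV⟩), Integrable (varianceDefect σ τ γ η θ s t u) (ν z) ∧
      ∀ B : Set (ℝ × ℝ), MeasurableSet B →
        ∫ x in (fun x : Set.Ioo 0 V → ℝ => (x s, x u)) ⁻¹' B,
          varianceDefect σ τ γ η θ s t u x ∂ν z = 0 := by
  have := hZ.isProbabilityMeasure_jointLaw hV
  have hm := measurable_varianceDefect (η := η) (θ := θ) (σ := σ) (τ := τ) (γ := γ) s t u
  have hj := hZ.measurable_joint hV
  have hg : Measurable fun x : Set.Ioo 0 V → ℝ => (x s, x u) := by fun_prop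
  set s' : Set.Ioi (0 : ℝ) := ⟨s, s.2.1⟩ with hs'
  set t' : Set.Ioi (0 : ℝ) := ⟨t, t.2.1⟩ with ht'
  set u' : Set.Ioi (0 : ℝ) := ⟨u, u.2.1⟩ with hu'
  have hst' : s' < t' := hst
  have htu' : t' < u' := htu
  have hsu' := hst'.trans htu'
  have i1 : Integrable (fun ω => (Z t' ω - chord s' t' u' (Z s' ω) (Z u' ω)) ^ 2) P :=
    (hZ.memLp_chord s' t' u' t').integrable_sq
  have i2 : Integrable (fun ω => factorF σ τ γ t' s' u' * quadK η θ σ τ γ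
      (delta s' u' (Z s' ω) (Z u' ω)) (deltaTilde s' u' (Z s' ω) (Z u' ω))) P :=
    (hZ.integrable_quadK s' u' η θ σ τ γ).const_mul _
  have hI : Integrable (fun p : ℝ × (Set.Ioo 0 V → ℝ) => varianceDefect σ τ γ η θ s t u p.2)
      (jointLaw P Z V hV) :=
    (integrable_map_measure (hm.comp measurable_snd).aestronglyMeasurable hj.aemeasurable).2
      (i1.sub i2)
  rw [← hZ.jointLaw_fst hV]
  refine ae_setIntegral_eq_zero hI hg fun S hS B hB => ?_
  rw [jointLaw, setIntegral_map (f := fun p : ℝ × (Set.Ioo 0 V → ℝ) =>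
    varianceDefect σ τ γ η θ s t u p.2) (hS.prod (hg hB))
    (hm.comp measurable_snd).aestronglyMeasurable hj.aemeasurable,
    ← integral_indicator (hj (hS.prod (hg hB)))]
  -- The event involves `Z_V` as well as `Z_s` and `Z_u`. It still lies in `𝓕 s u` because `V` is
  -- beyond `u`; this is where the two-sided σ-fields matter.
  set W : Set Ω := Z ⟨V, hV⟩ ⁻¹' S ∩ (fun ω => (Z s' ω, Z u' ω)) ⁻¹' B
  have hW : MeasurableSet[𝓕 s' u'] W := by
    have h1 : Measurable[𝓕 s' u'] (Z ⟨V, hV⟩) :=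
      hZ.adapted s' u' _ hsu' (Or.inr (Subtype.coe_le_coe.1 u.2.2.le))
    have h2 : Measurable[𝓕 s' u'] (Z s') := hZ.adapted s' u' _ hsu' (Or.inl le_rfl)
    have h3 : Measurable[𝓕 s' u'] (Z u') := hZ.adapted s' u' _ hsu' (Or.inr le_rfl)
    exact (h1 hS).inter ((h2.prodMk h3) hB)
  have hh : Measurable[𝓕 s' u'] (W.indicator fun _ => (1 : ℝ)) :=
    (measurable_const : Measurable[𝓕 s' u'] fun _ => (1 : ℝ)).indicator hW
  have hC : ∀ ω, |W.indicator (fun _ => (1 : ℝ)) ω| ≤ 1 := fun ω => by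
    by_cases h : ω ∈ W <;> simp [h]
  have hW0 : MeasurableSet W := hZ.le s' u' hsu' _ hW
  have key := hZ.integral_mul_sub_chord_sq hst' htu' hh hC
  have e : ∀ ω, Set.indicator ((fun ω => (Z ⟨V, hV⟩ ω, fun t : Set.Ioo 0 V => Z ⟨t, t.2.1⟩ ω)) ⁻¹'
      S ×ˢ ((fun x : Set.Ioo 0 V → ℝ => (x s, x u)) ⁻¹' B))
      (fun ω => varianceDefect σ τ γ η θ s t u (fun t : Set.Ioo 0 V => Z ⟨t, t.2.1⟩ ω)) ω
      = W.indicator (fun _ => (1 : ℝ)) ω * (Z t' ω - chord s' t' u' (Z s' ω) (Z u' ω)) ^ 2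
        - W.indicator (fun _ => (1 : ℝ)) ω * (factorF σ τ γ t' s' u' * quadK η θ σ τ γ
      (delta s' u' (Z s' ω) (Z u' ω)) (deltaTilde s' u' (Z s' ω) (Z u' ω))) := by
    intro ω
    change W.indicator _ ω = _
    by_cases h : ω ∈ W
    · simp only [Set.indicator_of_mem h, one_mul]; rfl
    · simp only [Set.indicator_of_notMem h, zero_mul, sub_zero]
  simp_rw [e]
  have hbdd := fun {f : Ω → ℝ} (hf : Integrable f P) =>
    integrable_bdd_mul (measurable_const.indicator hW0) hC hf
  rw [integral_sub (hbdd i1) (hbdd i2), key, ← integral_const_mul, sub_eq_zero]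
  congr with ω
  ring

end IsQuadraticHarness

theorem bridgeTransform_sub_chord (hV : 0 < V) (z : ℝ) (s t u : Set.Ioi (0 : ℝ)) (hsu : s < u)
    (x : Set.Ioo 0 V → ℝ) :
    bridgeTransform θ τ V hV z t x
        - chord s t u (bridgeTransform θ τ V hV z s x) (bridgeTransform θ τ V hV z u x)
      = (1 + τ / V) / bridgeKappa θ τ V z * (1 + t / V)
        * (x (bridgeTime V hV t) - chord (bridgeTime V hV s) (bridgeTime V hV t)
          (bridgeTime V hV u) (x (bridgeTime V hV s)) (x (bridgeTime V hV u))) :=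
  bridge_sub_chord hV s.2 t.2 u.2 hsu

/-- The conditional variances of the transformed bridges. -/
theorem varianceDefect_bridge (hV : 0 < V) (hτ : 0 ≤ τ) {z : ℝ} (hκ : 0 < bridgeKappa θ τ V z)
    (s t u : Set.Ioi (0 : ℝ)) (hsu : s < u) (x : Set.Ioo 0 V → ℝ) :
    ((1 + τ / V) / bridgeKappa θ τ V z * (1 + t / V)) ^ 2 *
        varianceDefect σ τ γ η θ (bridgeTime V hV s) (bridgeTime V hV t) (bridgeTime V hV u) x
      = varianceDefect (bridgeSigma σ τ γ V) (bridgeTau τ V) (bridgeGamma τ γ V)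
        (bridgeEta η θ τ γ V z) (bridgeTheta θ τ V z) s t u
        (fun r => bridgeTransform θ τ V hV z r x) := by
  have hc : (1 + τ / V) / bridgeKappa θ τ V z ≠ 0 := by positivity
  have h1 := bridge_deltaTilde (z := z) (a := x (bridgeTime V hV s)) (b := x (bridgeTime V hV u))
    hc hV s.2 u.2 hsu
  have h2 := bridge_delta (z := z) (a := x (bridgeTime V hV s)) (b := x (bridgeTime V hV u))
    hc hV s.2 u.2 hsu
  have h3 := bridge_factorF (σ := σ) (γ := γ) hV hτ hκ s.2 t.2 u.2
  rw [varianceDefect, varianceDefect, bridgeTransform_sub_chord hV z s t u hsu x, ← h3, mul_pow,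
    mul_sub]
  congr 1
  · ring
  · have h4 := bridge_quadK (η := η) (σ := σ) (γ := γ) hV hτ hκ
      (delta s u (bridgeTransform θ τ V hV z s x) (bridgeTransform θ τ V hV z u x))
      (deltaTilde s u (bridgeTransform θ τ V hV z s x) (bridgeTransform θ τ V hV z u x))
    have h1' : deltaTilde (bridgeTime V hV s) (bridgeTime V hV u) (x (bridgeTime V hV s))
      (x (bridgeTime V hV u)) = _ := h1
    have h2' : delta (bridgeTime V hV s) (bridgeTime V hV u) (x (bridgeTime V hV s))
      (x (bridgeTime V hV u)) = _ := h2
    rw [h1', h2']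
    change _ * (_ * quadK η θ σ τ γ (z / V + (delta s u (bridgeTransform θ τ V hV z s x)
      (bridgeTransform θ τ V hV z u x) - deltaTilde s u (bridgeTransform θ τ V hV z s x)
      (bridgeTransform θ τ V hV z u x) / V) / _) (deltaTilde s u (bridgeTransform θ τ V hV z s x)
      (bridgeTransform θ τ V hV z u x) / _)) = _
    rw [h4, mul_assoc _ _ (quadK _ _ _ _ _ _ _), mul_assoc _ _ (quadK _ _ _ _ _ _ _)]
    congr 2

theorem bridgeTransform_eq_zero (hV : 0 < V) {z : ℝ} (hκ : bridgeKappa θ τ V z = 0)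
    (t : Set.Ioi (0 : ℝ)) (x : Set.Ioo 0 V → ℝ) : bridgeTransform θ τ V hV z t x = 0 := by
  rw [bridgeTransform, hκ, div_zero, zero_mul]

/-- If `κ` were zero, division by zero would make the transformed process identically zero, against
`E Y_1² = 1`. So positivity of `κ` is contained in the harness assumption. -/
theorem bridgeKappa_pos {hV : 0 < V} {z : ℝ} {μ : Measure (Set.Ioo 0 V → ℝ)}
    {𝓖 : Set.Ioi (0 : ℝ) → Set.Ioi (0 : ℝ) → MeasurableSpace (Set.Ioo 0 V → ℝ)}
    {η' θ' σ' τ' γ' : ℝ}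
    (hY : IsQuadraticHarness μ 𝓖 (bridgeTransform θ τ V hV z) η' θ' σ' τ' γ') :
    0 < bridgeKappa θ τ V z := by
  rcases (Real.sqrt_nonneg _ : 0 ≤ bridgeKappa θ τ V z).eq_or_lt with h | h
  · have := hY.integral_sq ⟨1, Set.mem_Ioi.2 one_pos⟩
    simp [bridgeTransform_eq_zero hV h.symm] at this
  · exact h

/-- If two quadratic forms both give the conditional variance, they agree. -/
theorem IsQuadraticHarness.ae_quadK_div_denom_eq {Y : Set.Ioi (0 : ℝ) → Ω → ℝ}
    {𝓖 : Set.Ioi (0 : ℝ) → Set.Ioi (0 : ℝ) → MeasurableSpace Ω} {η' θ' σ' τ' γ' : ℝ}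
    [IsProbabilityMeasure P] (hY : IsQuadraticHarness P 𝓖 Y η' θ' σ' τ' γ')
    {s t u : Set.Ioi (0 : ℝ)} (hst : s < t) (htu : t < u)
    (h : ∀ B : Set (ℝ × ℝ), MeasurableSet B → ∫ ω in (fun ω => (Y s ω, Y u ω)) ⁻¹' B,
      varianceDefect σ τ γ η θ s t u (fun r => Y r ω) ∂P = 0) :
    ∀ᵐ ω ∂P,
      quadK η θ σ τ γ (delta s u (Y s ω) (Y u ω)) (deltaTilde s u (Y s ω) (Y u ω))
          / denom σ τ γ s u
        = quadK η' θ' σ' τ' γ' (delta s u (Y s ω) (Y u ω)) (deltaTilde s u (Y s ω) (Y u ω))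
          / denom σ' τ' γ' s u := by
  have hsu := hst.trans htu
  have i1 : Integrable (fun ω => (Y t ω - chord s t u (Y s ω) (Y u ω)) ^ 2) P :=
    (hY.memLp_chord s t u t).integrable_sq
  have i2 := fun η θ σ τ γ : ℝ =>
    (hY.integrable_quadK s u η θ σ τ γ).const_mul (factorF σ τ γ t s u)
  have hg : Measurable fun ω => (Y s ω, Y u ω) := (hY.measurable s).prodMk (hY.measurable u)
  have hae := ae_comp_eq_zero_of_forall_setIntegral (μ := P)
    (G := fun p : ℝ × ℝ => factorF σ τ γ t s u * quadK η θ σ τ γ (delta s u p.1 p.2)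
        (deltaTilde s u p.1 p.2)
      - factorF σ' τ' γ' t s u * quadK η' θ' σ' τ' γ' (delta s u p.1 p.2)
        (deltaTilde s u p.1 p.2)) (by unfold quadK delta deltaTilde; fun_prop) hg
    ((i2 η θ σ τ γ).sub (i2 η' θ' σ' τ' γ')) (fun B hB => by
      have h1 := h B hB
      unfold varianceDefect at h1
      rw [integral_sub i1.integrableOn (i2 η θ σ τ γ).integrableOn] at h1
      rw [integral_sub (i2 η θ σ τ γ).integrableOn (i2 η' θ' σ' τ' γ').integrableOn]
      set W : Set Ω := (fun ω => (Y s ω, Y u ω)) ⁻¹' B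
      have hW : MeasurableSet[𝓖 s u] W :=
        ((hY.adapted s u _ hsu (Or.inl le_rfl)).prodMk (hY.adapted s u _ hsu (Or.inr le_rfl))) hB
      have hW0 : MeasurableSet W := hY.le s u hsu _ hW
      have hh : Measurable[𝓖 s u] (W.indicator fun _ => (1 : ℝ)) :=
        (measurable_const : Measurable[𝓖 s u] fun _ => (1 : ℝ)).indicator hW
      have hC : ∀ ω, |W.indicator (fun _ => (1 : ℝ)) ω| ≤ 1 := fun ω => by
        by_cases h : ω ∈ W <;> simp [h]
      have key := hY.integral_mul_sub_chord_sq hst htu hh hC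
      have e : ∀ f : Ω → ℝ, ∫ ω, W.indicator (fun _ => (1 : ℝ)) ω * f ω ∂P = ∫ ω in W, f ω ∂P := by
        intro f
        rw [← integral_indicator hW0]
        congr with ω
        by_cases h : ω ∈ W <;> simp [h]
      rw [e, e, ← integral_const_mul] at key
      linarith)
  have h1 : (s : ℝ) < t := hst
  have h2 : (t : ℝ) < u := htu
  have hne : ((u : ℝ) - t) * (t - s) ≠ 0 :=
    (mul_pos (sub_pos.2 h2) (sub_pos.2 h1)).ne'
  filter_upwards [hae] with ω hω
  rw [factorF_eq, factorF_eq] at hω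
  have e : ((u : ℝ) - t) * (t - s) * (quadK η θ σ τ γ (delta s u (Y s ω) (Y u ω))
      (deltaTilde s u (Y s ω) (Y u ω)) / denom σ τ γ s u) = ((u : ℝ) - t) * (t - s) *
      (quadK η' θ' σ' τ' γ' (delta s u (Y s ω) (Y u ω)) (deltaTilde s u (Y s ω) (Y u ω))
          / denom σ' τ' γ' s u) := by
    have := sub_eq_zero.1 hω
    linear_combination this
  exact mul_left_cancel₀ hne e

end Bridge

/-! ### Determination of the parameters -/

section Parameters

variable {Ω : Type*} {mΩ : MeasurableSpace Ω} {P : Measure Ω} [IsProbabilityMeasure P]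
  {𝓕 : Set.Ioi (0 : ℝ) → Set.Ioi (0 : ℝ) → MeasurableSpace Ω}
  {Z : Set.Ioi (0 : ℝ) → Ω → ℝ} {η θ σ τ γ V : ℝ}

namespace IsQuadraticHarness

theorem bridge_denom_ne_zero (hZ : IsQuadraticHarness P 𝓕 Z η θ σ τ γ) (hV : 0 < V)
    {s u : ℝ} (hs : 0 < s) (hsu : s < u) :
    denom (bridgeSigma σ τ γ V) (bridgeTau τ V) (bridgeGamma τ γ V) s u ≠ 0 := by
  have hτ := hZ.tau_nonneg
  have hu := hs.trans hsu
  intro h0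
  have h1 := bridge_denom (σ := σ) (γ := γ) hV hτ hs hu
  rw [h0, mul_zero] at h1
  have hlt : s / (1 + s / V) < u / (1 + u / V) := by
    rw [div_lt_div_iff₀ (by positivity) (by positivity)]
    have : s * (u / V) = u * (s / V) := by ring
    linarith
  have h2 : denom σ τ γ (s / (1 + s / V)) (u / (1 + u / V)) ≠ 0 :=
    hZ.denom_ne_zero (s := ⟨s / (1 + s / V), Set.mem_Ioi.2 (by positivity)⟩)
      (u := ⟨u / (1 + u / V), Set.mem_Ioi.2 (by positivity)⟩) hlt
  have h3 : (1 + s / V) * (1 + u / V) ≠ 0 := by positivity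
  exact (mul_ne_zero h3 h2) h1.symm

variable {ν : Kernel ℝ (Set.Ioo 0 V → ℝ)}

/-- Whenever a transformed bridge is a quadratic harness, its conditional variances are also given
by the parameters computed from those of the original process. -/
theorem ae_bridge_condVar [IsMarkovKernel ν]
    (hZ : IsQuadraticHarness P 𝓕 Z η θ σ τ γ) (hV : 0 < V)
    (hν : (jointLaw P Z V hV).IsCondKernel ν) :
    ∀ᵐ z ∂P.map (Z ⟨V, hV⟩), ∀ 𝓖 η' θ' σ' τ' γ',
      IsQuadraticHarness (ν z) 𝓖 (bridgeTransform θ τ V hV z) η' θ' σ' τ' γ' →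
      ∀ s u : Set.Ioi (0 : ℝ), s < u → ∀ᵐ x ∂ν z,
        quadK (bridgeEta η θ τ γ V z) (bridgeTheta θ τ V z) (bridgeSigma σ τ γ V) (bridgeTau τ V)
            (bridgeGamma τ γ V)
            (delta s u (bridgeTransform θ τ V hV z s x) (bridgeTransform θ τ V hV z u x))
            (deltaTilde s u (bridgeTransform θ τ V hV z s x) (bridgeTransform θ τ V hV z u x))
          / denom (bridgeSigma σ τ γ V) (bridgeTau τ V) (bridgeGamma τ γ V) s u
        = quadK η' θ' σ' τ' γ'
            (delta s u (bridgeTransform θ τ V hV z s x) (bridgeTransform θ τ V hV z u x))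
            (deltaTilde s u (bridgeTransform θ τ V hV z s x) (bridgeTransform θ τ V hV z u x))
          / denom σ' τ' γ' s u := by
  have hτ := hZ.tau_nonneg
  have hmono : ∀ s u : Set.Ioi (0 : ℝ), s < u → bridgeTime V hV s < bridgeTime V hV u := by
    intro s u hsu
    have hs : (0 : ℝ) < s := s.2
    have hu : (0 : ℝ) < u := u.2
    have hlt : (s : ℝ) < u := hsu
    refine Subtype.coe_lt_coe.1 ?_
    change (s : ℝ) / (1 + s / V) < u / (1 + u / V)
    rw [div_lt_div_iff₀ (by positivity) (by positivity)]
    have : (s : ℝ) * (u / V) = u * (s / V) := by ring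
    linarith
  -- The exceptional set of `z` may depend on the times, so only rational end points are treated at
  -- once; the intermediate time is the midpoint, which suffices because the form does not involve
  -- `t`.
  have hrat : ∀ p q : ℚ, ∀ᵐ z ∂P.map (Z ⟨V, hV⟩), ∀ (hp : (0 : ℝ) < p) (hpq : (p : ℝ) < q),
      ∀ B : Set (ℝ × ℝ), MeasurableSet B →
        ∫ x in (fun x : Set.Ioo 0 V → ℝ => (x (bridgeTime V hV ⟨p, hp⟩),
          x (bridgeTime V hV ⟨q, hp.trans hpq⟩))) ⁻¹' B,
          varianceDefect σ τ γ η θ (bridgeTime V hV ⟨p, hp⟩)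
            (bridgeTime V hV ⟨(p + q) / 2, Set.mem_Ioi.2 (by linarith)⟩)
            (bridgeTime V hV ⟨q, hp.trans hpq⟩) x ∂ν z = 0 := by
    intro p q
    by_cases h : (0 : ℝ) < p ∧ (p : ℝ) < q
    · obtain ⟨hp, hpq⟩ := h
      have := hZ.ae_setIntegral_varianceDefect hV hν
        (hmono ⟨p, hp⟩ ⟨(p + q) / 2, Set.mem_Ioi.2 (by linarith)⟩
          (Subtype.mk_lt_mk.2 (by linarith)))
        (hmono ⟨(p + q) / 2, Set.mem_Ioi.2 (by linarith)⟩ ⟨q, hp.trans hpq⟩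
          (Subtype.mk_lt_mk.2 (by linarith)))
      filter_upwards [this] with z hz _ _
      exact hz.2
    · exact Eventually.of_forall fun z hp hpq => absurd ⟨hp, hpq⟩ h
  filter_upwards [ae_all_iff.2 fun p => ae_all_iff.2 (hrat p)] with z hz 𝓖 η' θ' σ' τ' γ' hY s u hsu
  have hκ := bridgeKappa_pos hY
  set c : ℝ := (1 + τ / V) / bridgeKappa θ τ V z with hc
  have key := hY.ae_eq_zero_of_rat (Ψ := fun s u a b =>
      quadK (bridgeEta η θ τ γ V z) (bridgeTheta θ τ V z) (bridgeSigma σ τ γ V) (bridgeTau τ V)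
            (bridgeGamma τ γ V) (delta s u a b) (deltaTilde s u a b)
          / denom (bridgeSigma σ τ γ V) (bridgeTau τ V) (bridgeGamma τ γ V) s u
        - quadK η' θ' σ' τ' γ' (delta s u a b) (deltaTilde s u a b) / denom σ' τ' γ' s u)
    (fun s u a b hs hsu => by
      have d1 := hZ.bridge_denom_ne_zero hV hs hsu
      have d2 : denom σ' τ' γ' s u ≠ 0 :=
        hY.denom_ne_zero (s := ⟨s, hs⟩) (u := ⟨u, hs.trans hsu⟩) hsu
      have d3 : u - s ≠ 0 := by linarith
      unfold denom at d1 d2 ⊢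
      unfold quadK delta deltaTilde
      fun_prop (disch := assumption))
    (fun s u hsu hsq huq => by
      obtain ⟨p, hp⟩ := hsq
      obtain ⟨q, hq⟩ := huq
      obtain ⟨s, hs⟩ := s
      obtain ⟨u, hu⟩ := u
      simp only at hp hq
      subst hp hq
      have hpq : (p : ℝ) < q := hsu
      have hs' : (0 : ℝ) < p := hs
      set t : Set.Ioi (0 : ℝ) := ⟨((p : ℝ) + q) / 2, Set.mem_Ioi.2 (by linarith)⟩
      have hst : (⟨p, hs⟩ : Set.Ioi (0 : ℝ)) < t := Subtype.mk_lt_mk.2 (by linarith)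
      have htu : t < (⟨q, hu⟩ : Set.Ioi (0 : ℝ)) := Subtype.mk_lt_mk.2 (by linarith)
      have h1 := hY.ae_quadK_div_denom_eq (η := bridgeEta η θ τ γ V z) (θ := bridgeTheta θ τ V z)
        (σ := bridgeSigma σ τ γ V) (τ := bridgeTau τ V) (γ := bridgeGamma τ γ V) hst htu
        (fun B hB => by
          simp_rw [← varianceDefect_bridge hV hτ hκ _ t _ hsu, integral_const_mul]
          rw [mul_eq_zero]
          right
          -- At fixed times the transformation is affine in each coordinate, so an event in the
          -- transformed values is an event in the values of the bridge.
          have hm : Measurable fun y : ℝ × ℝ => (c * ((1 + (p : ℝ) / V) * y.1 - p / V * z),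
              c * ((1 + (q : ℝ) / V) * y.2 - q / V * z)) := by fun_prop
          exact hz p q hs hpq _ (hm hB))
      filter_upwards [h1] with x hx
      exact sub_eq_zero.2 hx) hsu
  filter_upwards [key] with x hx
  exact sub_eq_zero.1 hx

/-- The value at a later time is not a function of the past. -/
theorem not_ae_eq_past (hX : IsQuadraticHarness P 𝓕 Z η θ σ τ γ) {s t : Set.Ioi (0 : ℝ)}
    (hst : s < t) {G : Ω → ℝ} (hG : IsPast 𝓕 s G) : ¬ ∀ᵐ ω ∂P, Z t ω = G ω := by
  intro h
  -- If `Z_t` were `G`, its increment `d` would be known at time `s`; testing the martingale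
  -- property against the bounded `d/(1 + d²)` would force `d = 0`.
  have hp : IsPast 𝓕 s fun ω => (G ω - Z s ω) / (1 + (G ω - Z s ω) ^ 2) := by
    intro u hu
    have h1 : Measurable[𝓕 s u] G := hG u hu
    have h2 : Measurable[𝓕 s u] (Z s) := hX.adapted s u s hu (Or.inl le_rfl)
    exact (h1.sub h2).div (((h1.sub h2).pow_const 2).const_add 1)
  have h0 := hX.integral_past_mul_sub hst hp (C := 1) (fun ω => by
    generalize G ω - Z s ω = d
    rw [abs_div, abs_of_pos (by positivity : 0 < 1 + d ^ 2), div_le_one (by positivity)]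
    nlinarith [sq_nonneg (|d| - 1), sq_abs d, abs_nonneg d])
  have h1 : ∫ ω, (Z t ω - Z s ω) ^ 2 / (1 + (Z t ω - Z s ω) ^ 2) ∂P = 0 := by
    rw [← h0]
    apply integral_congr_ae
    filter_upwards [h] with ω hω
    rw [← hω]
    ring
  have hm := hX.measurable_sub s t
  have hi : Integrable (fun ω => (Z t ω - Z s ω) ^ 2 / (1 + (Z t ω - Z s ω) ^ 2)) P := by
    refine (hX.memLp_sub s t).integrable_sq.mono
      (((hm.pow_const 2).div ((hm.pow_const 2).const_add 1)).aestronglyMeasurable)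
      (Eventually.of_forall fun ω => ?_)
    generalize Z t ω - Z s ω = d
    rw [Real.norm_of_nonneg (by positivity), Real.norm_of_nonneg (by positivity)]
    exact div_le_self (by positivity) (by nlinarith [sq_nonneg d])
  have h2 := (integral_eq_zero_iff_of_nonneg (fun ω => by positivity) hi).1 h1
  have h3 : ∫ ω, (Z t ω - Z s ω) ^ 2 ∂P = 0 := by
    rw [← integral_zero Ω ℝ (μ := P)]
    apply integral_congr_ae
    filter_upwards [h2] with ω hω
    generalize Z t ω - Z s ω = d at *
    rcases div_eq_zero_iff.1 hω with h | h
    · exact h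
    · nlinarith [sq_nonneg d]
  rw [hX.integral_sub_sq, abs_eq_zero, sub_eq_zero] at h3
  exact (Subtype.coe_lt_coe.2 hst).ne' h3

/-- The bridges are not all two-valued. -/
theorem not_ae_bridge_sq_eq (hZ : IsQuadraticHarness P 𝓕 Z η θ σ τ γ) (hV : 0 < V)
    (hν : (jointLaw P Z V hV).IsCondKernel ν) :
    ¬ ∀ᵐ z ∂P.map (Z ⟨V, hV⟩), 0 < bridgeKappa θ τ V z ∧ ∀ t : Set.Ioi (0 : ℝ), ∀ᵐ x ∂ν z,
      bridgeTransform θ τ V hV z t x ^ 2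
        = t + bridgeTheta θ τ V z * bridgeTransform θ τ V hV z t x := by
  intro h
  have hτ := hZ.tau_nonneg
  set A : ℝ → ℝ := fun t => (1 + τ / V) * t + τ
  have hA : ∀ t, 0 < t → 0 < A t := fun t ht => by simp only [A]; positivity
  -- In terms of `y`, the bridge value divided by its time, the two-valued relation becomes `A_t (y
  -- - z/V)² = 1 + θ y + τ y²`, whose right-hand side is free of `z`.
  have hquad : ∀ z, 0 < bridgeKappa θ τ V z → ∀ (t : Set.Ioi (0 : ℝ)) (x : Set.Ioo 0 V → ℝ),
      bridgeTransform θ τ V hV z t x ^ 2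
        = t + bridgeTheta θ τ V z * bridgeTransform θ τ V hV z t x →
      A t * (x (bridgeTime V hV t) * (1 / t + 1 / V) - z / V) ^ 2
        = 1 + θ * (x (bridgeTime V hV t) * (1 / t + 1 / V))
          + τ * (x (bridgeTime V hV t) * (1 / t + 1 / V)) ^ 2 := by
    intro z hκ t x hx
    have ht : (0 : ℝ) < t := t.2
    have hk := bridgeKappa_sq hκ
    have hτV : 1 + τ / V ≠ 0 := by positivity
    set y := x (bridgeTime V hV t) * (1 / t + 1 / V) with hy
    have e : bridgeTransform θ τ V hV z t x
        = (1 + τ / V) / bridgeKappa θ τ V z * (t * (y - z / V)) := by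
      rw [bridgeTransform, hy]
      field_simp
    rw [e, bridgeTheta] at hx
    generalize bridgeKappa θ τ V z = κ at *
    generalize hv : z / V = v at *
    have hk' : κ ^ 2 = (1 + τ / V) * (1 + θ * v + τ * v ^ 2) := by rw [hk, ← hv]; ring
    generalize y = y at *
    simp only [A]
    generalize 1 + τ / V = T at *
    generalize (t : ℝ) = t at *
    have h1 : T * t * (T * t * (y - v) ^ 2)
        = T * t * ((1 + θ * v + τ * v ^ 2) + (θ + 2 * τ * v) * (y - v)) := by
      field_simp at hx
      linear_combination t * hx + t * hk'
    have h2 := mul_left_cancel₀ (mul_ne_zero hτV ht.ne') h1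
    linear_combination h2
  set t₁ : Set.Ioi (0 : ℝ) := ⟨1, Set.mem_Ioi.2 one_pos⟩
  set t₂ : Set.Ioi (0 : ℝ) := ⟨2, Set.mem_Ioi.2 two_pos⟩
  -- Multiplying the relation at time `1` by `A 2`, that at time `2` by `A 1` and subtracting
  -- removes the square of `z/V`; the linear equation left is solved for `z`.
  set G : ℝ × ℝ → ℝ := fun y =>
    V * ((A 2 * (A 1 * (y.1 * (1 / 1 + 1 / V)) ^ 2 - (1 + θ * (y.1 * (1 / 1 + 1 / V))
        + τ * (y.1 * (1 / 1 + 1 / V)) ^ 2))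
      - A 1 * (A 2 * (y.2 * (1 / 2 + 1 / V)) ^ 2 - (1 + θ * (y.2 * (1 / 2 + 1 / V))
        + τ * (y.2 * (1 / 2 + 1 / V)) ^ 2)))
      / (2 * A 1 * A 2 * (y.1 * (1 / 1 + 1 / V) - y.2 * (1 / 2 + 1 / V))))
  have hG : Measurable G := by fun_prop
  have hae : ∀ᵐ z ∂P.map (Z ⟨V, hV⟩), ∀ᵐ x ∂ν z,
      z = G (x (bridgeTime V hV t₁), x (bridgeTime V hV t₂)) := by
    filter_upwards [h] with z hz
    filter_upwards [hz.2 t₁, hz.2 t₂] with x h1 h2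
    have q1 := hquad z hz.1 t₁ x h1
    have q2 := hquad z hz.1 t₂ x h2
    have hk0 : 1 + θ * (z / V) + τ * (z / V) ^ 2 ≠ 0 := by
      intro h0
      have hk := bridgeKappa_sq hz.1
      rw [← div_pow, h0, mul_zero] at hk
      exact (pow_pos hz.1 2).ne' hk
    change A 1 * (x (bridgeTime V hV t₁) * (1 / 1 + 1 / V) - z / V) ^ 2
          = 1 + θ * (x (bridgeTime V hV t₁) * (1 / 1 + 1 / V))
          + τ * (x (bridgeTime V hV t₁) * (1 / 1 + 1 / V)) ^ 2 at q1
    change A 2 * (x (bridgeTime V hV t₂) * (1 / 2 + 1 / V) - z / V) ^ 2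
          = 1 + θ * (x (bridgeTime V hV t₂) * (1 / 2 + 1 / V))
          + τ * (x (bridgeTime V hV t₂) * (1 / 2 + 1 / V)) ^ 2 at q2
    simp only [G]
    have hA1 := hA 1 one_pos
    have hA2 := hA 2 two_pos
    have hA12 : A 2 - A 1 ≠ 0 := by
      have : A 2 - A 1 = 1 + τ / V := by simp only [A]; ring
      rw [this]; positivity
    clear_value A
    generalize x (bridgeTime V hV t₁) * (1 / 1 + 1 / V) = a at *
    generalize x (bridgeTime V hV t₂) * (1 / 2 + 1 / V) = b at *
    have hzv : z = V * (z / V) := by field_simp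
    generalize z / V = v at *
    -- If `a = b`, then `A 1 ≠ A 2` forces both to equal `z/V`, so that `1 + θ z/V + τ z²/V² = 0`,
    -- against `κ > 0`.
    have hne : a - b ≠ 0 := by
      intro hab
      have hab' : a = b := sub_eq_zero.1 hab
      subst hab'
      have h3 : (A 2 - A 1) * (a - v) ^ 2 = 0 := by linear_combination q2 - q1
      have h4 : a - v = 0 := by
        rcases mul_eq_zero.1 h3 with h | h
        · exact absurd h hA12
        · exact pow_eq_zero_iff two_ne_zero |>.1 h
      rw [h4] at q1
      have h5 : a = v := sub_eq_zero.1 h4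
      rw [h5] at q1
      apply hk0
      linear_combination -q1
    rw [hzv]
    congr 1
    rw [eq_div_iff (by positivity)]
    linear_combination A 1 * q2 - A 2 * q1
  have hm : MeasurableSet {y : ℝ × (Set.Ioo 0 V → ℝ) |
      y.1 = G (y.2 (bridgeTime V hV t₁), y.2 (bridgeTime V hV t₂))} :=
    measurableSet_eq_fun measurable_fst (by fun_prop)
  have hP := hZ.ae_of_ae_bridge hV hν hm hae
  set s₁ : Set.Ioi (0 : ℝ) := ⟨bridgeTime V hV t₁, (bridgeTime V hV t₁).2.1⟩
  set s₂ : Set.Ioi (0 : ℝ) := ⟨bridgeTime V hV t₂, (bridgeTime V hV t₂).2.1⟩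
  have h12 : s₁ ≤ s₂ := by
    refine Subtype.coe_le_coe.1 ?_
    change (1 : ℝ) / (1 + 1 / V) ≤ 2 / (1 + 2 / V)
    rw [div_le_div_iff₀ (by positivity) (by positivity)]
    have : 1 * (2 / V) = 2 * (1 / V) := by ring
    linarith
  have hs2 : s₂ < ⟨V, hV⟩ := Subtype.coe_lt_coe.1 (bridgeTime V hV t₂).2.2
  refine hZ.not_ae_eq_past hs2 (G := fun ω => G (Z s₁ ω, Z s₂ ω)) ?_ hP
  intro u hu
  exact hG.comp ((hZ.adapted s₂ u s₁ hu (Or.inl h12)).prodMk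
    (hZ.adapted s₂ u s₂ hu (Or.inl le_rfl)))

/-- An affine function of the process vanishes only if its coefficients do. -/
theorem eq_zero_of_ae_affine (hZ : IsQuadraticHarness P 𝓕 Z η θ σ τ γ) (t : Set.Ioi (0 : ℝ))
    {a b : ℝ} (h : ∀ᵐ ω ∂P, a - Z t ω * b = 0) : a = 0 ∧ b = 0 := by
  have h1 : ∫ ω, (a - Z t ω * b) ∂P = 0 := by
    rw [← integral_zero Ω ℝ (μ := P)]
    exact integral_congr_ae h
  rw [integral_sub (integrable_const _) ((hZ.integrable t).mul_const b), integral_mul_const,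
    hZ.mean] at h1
  have ha : a = 0 := by simpa using h1
  refine ⟨ha, ?_⟩
  have h2 : ∫ ω, Z t ω ^ 2 * b ^ 2 ∂P = 0 := by
    rw [← integral_zero Ω ℝ (μ := P)]
    apply integral_congr_ae
    filter_upwards [h] with ω hω
    rw [ha] at hω
    rw [← mul_pow, show Z t ω * b = 0 by linarith]
    norm_num
  rw [integral_mul_const, hZ.integral_sq] at h2
  rcases mul_eq_zero.1 h2 with h | h
  · exact absurd h (Set.mem_Ioi.1 t.2).ne'
  · exact pow_eq_zero_iff two_ne_zero |>.1 h

/-- The parameters of a quadratic harness whose bridges transform into `q`-Meixner processes. -/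
theorem parameters_of_isQMeixner [IsMarkovKernel ν]
    (hZ : IsQuadraticHarness P 𝓕 Z η θ σ τ γ) (hV : 0 < V)
    (hν : (jointLaw P Z V hV).IsCondKernel ν)
    (hY : ∀ᵐ z ∂(P.map (Z ⟨V, hV⟩)), IsQMeixner (ν z) (bridgeTransform θ τ V hV z)) :
    η = θ / V ∧ σ = τ / V ^ 2 ∧ γ = 1 + 2 * τ / V := by
  have hτ := hZ.tau_nonneg
  have hτY : 0 ≤ bridgeTau τ V := by unfold bridgeTau; positivity
  have hd : ∀ᵐ z ∂(P.map (Z ⟨V, hV⟩)), 0 < bridgeKappa θ τ V z ∧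
      (bridgeSigma σ τ γ V = 0 → bridgeEta η θ τ γ V z = 0) ∧
      (bridgeSigma σ τ γ V ≠ 0 → ∀ t : Set.Ioi (0 : ℝ), ∀ᵐ x ∂ν z,
        bridgeTransform θ τ V hV z t x ^ 2
          = t + bridgeTheta θ τ V z * bridgeTransform θ τ V hV z t x) := by
    filter_upwards [hY, hZ.ae_bridge_condVar hV hν] with z hz hc
    obtain ⟨𝓖, θ', τ', q, -, -, hz⟩ := hz
    exact ⟨bridgeKappa_pos hz, hz.meixner_dichotomy hτY
      (fun s u hsu => hZ.bridge_denom_ne_zero hV s.2 hsu) (hc _ _ _ _ _ _ hz)⟩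
  -- `bridgeSigma` does not depend on `z`: if it were nonzero, almost all bridges would be
  -- two-valued simultaneously.
  have hσ : bridgeSigma σ τ γ V = 0 := by
    by_contra hne
    apply hZ.not_ae_bridge_sq_eq hV hν
    filter_upwards [hd] with z hz
    exact ⟨hz.1, hz.2.2 hne⟩
  have hη : ∀ᵐ ω ∂P, (η - θ / V) - Z ⟨V, hV⟩ ω * (2 * τ / V ^ 2 + (1 - γ) / V) = 0 := by
    refine ae_of_ae_map (p := fun z => (η - θ / V) - z * (2 * τ / V ^ 2 + (1 - γ) / V) = 0)
      (hZ.measurable ⟨V, hV⟩).aemeasurable ?_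
    filter_upwards [hd] with z hz
    rcases div_eq_zero_iff.1 (hz.2.1 hσ) with h | h
    · exact h
    · exact absurd h hz.1.ne'
  obtain ⟨h1, h2⟩ := hZ.eq_zero_of_ae_affine _ hη
  have h3 : σ + τ / V ^ 2 + (1 - γ) / V = 0 := by
    rcases div_eq_zero_iff.1 hσ with h | h
    · exact h
    · exact absurd h (by positivity)
  refine ⟨by linarith, by linear_combination h3 - h2, ?_⟩
  have h4 : 2 * τ / V + (1 - γ) = V * (2 * τ / V ^ 2 + (1 - γ) / V) := by field_simp
  rw [h2] at h4
  linarith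

/-- A quadratic harness is a quadratic harness for its natural σ-fields. -/
theorem to_naturalFamily {Y : Set.Ioi (0 : ℝ) → Ω → ℝ}
    {𝓖 : Set.Ioi (0 : ℝ) → Set.Ioi (0 : ℝ) → MeasurableSpace Ω} {η' θ' σ' τ' γ' : ℝ}
    (hY : IsQuadraticHarness P 𝓖 Y η' θ' σ' τ' γ')
    (h : ∀ s u : Set.Ioi (0 : ℝ), s < u → ∀ᵐ ω ∂P,
      quadK η θ σ τ γ (delta s u (Y s ω) (Y u ω)) (deltaTilde s u (Y s ω) (Y u ω))
          / denom σ τ γ s u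
        = quadK η' θ' σ' τ' γ' (delta s u (Y s ω) (Y u ω)) (deltaTilde s u (Y s ω) (Y u ω))
          / denom σ' τ' γ' s u) :
    IsQuadraticHarness P (naturalFamily Y) Y η θ σ τ γ := by
  -- The natural σ-fields are smaller, and the conditional moments depend on `Y_s` and `Y_u` only,
  -- so the tower property transfers them. The parameters may be replaced at the same time, as the
  -- two variance forms agree almost surely.
  have hle : ∀ s t : Set.Ioi (0 : ℝ), s < t → naturalFamily Y s t ≤ 𝓖 s t :=
    fun s t hst => iSup₂_le fun r hr => (hY.adapted s t r hst hr).comap_le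
  have hle' : ∀ s t : Set.Ioi (0 : ℝ), s < t → naturalFamily Y s t ≤ mΩ :=
    fun s t hst => (hle s t hst).trans (hY.le s t hst)
  have had : ∀ s t u : Set.Ioi (0 : ℝ), s < t → (u ≤ s ∨ t ≤ u) →
      Measurable[naturalFamily Y s t] (Y u) := fun s t u _ hu =>
    measurable_iff_comap_le.2 (le_iSup₂ (f := fun (r : Set.Ioi (0 : ℝ)) (_ : r ≤ s ∨ t ≤ r) =>
      MeasurableSpace.comap (Y r) inferInstance) u hu)
  have hcond : ∀ s t u : Set.Ioi (0 : ℝ), s < t → t < u →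
      P[Y t | naturalFamily Y s u] =ᵐ[P] fun ω =>
        ((u : ℝ) - t) / ((u : ℝ) - s) * Y s ω + ((t : ℝ) - s) / ((u : ℝ) - s) * Y u ω := by
    intro s t u hst htu
    have hsu := hst.trans htu
    have h1 := condExp_condExp_of_le (μ := P) (f := Y t) (hle s u hsu) (hY.le s u hsu)
    have h2 := condExp_congr_ae (m := naturalFamily Y s u) (hY.harness s t u hst htu)
    refine h1.symm.trans (h2.trans ?_)
    rw [condExp_of_stronglyMeasurable (hle' s u hsu)]
    · exact (((had s u s hsu (Or.inl le_rfl)).const_mul _).add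
        ((had s u u hsu (Or.inr le_rfl)).const_mul _)).stronglyMeasurable
    · exact ((hY.integrable s).const_mul _).add ((hY.integrable u).const_mul _)
  refine ⟨hle', ?_, had, hY.memLp, hY.mean, hY.cov, hcond, ?_⟩
  · intro r s t u hrs hst htu
    exact iSup₂_le fun v hv => (had s t v hst
      (hv.imp (fun h => h.trans hrs) (fun h => htu.trans h))).comap_le
  · intro s t u hst htu
    have hsu := hst.trans htu
    have e1 : (Y t - P[Y t | naturalFamily Y s u]) ^ 2
        =ᵐ[P] (Y t - P[Y t | 𝓖 s u]) ^ 2 := by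
      filter_upwards [hcond s t u hst htu, hY.harness s t u hst htu] with ω h1 h2
      simp only [Pi.pow_apply, Pi.sub_apply, h1, h2]
    have e2 := condExp_congr_ae (m := naturalFamily Y s u) e1
    have e3 := condExp_condExp_of_le (μ := P) (f := (Y t - P[Y t | 𝓖 s u]) ^ 2) (hle s u hsu)
      (hY.le s u hsu)
    have e4 : P[(Y t - P[Y t | 𝓖 s u]) ^ 2 | 𝓖 s u] =ᵐ[P] fun ω => factorF σ τ γ t s u *
        quadK η θ σ τ γ (delta s u (Y s ω) (Y u ω)) (deltaTilde s u (Y s ω) (Y u ω)) := by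
      filter_upwards [hY.condVar s t u hst htu, h s u hsu] with ω h1 h2
      change P[(Y t - P[Y t | 𝓖 s u]) ^ 2 | 𝓖 s u] ω = _ at h1
      rw [h1, factorF_eq, factorF_eq]
      linear_combination (-(((u : ℝ) - t) * (t - s))) * h2
    refine e2.trans (e3.symm.trans ((condExp_congr_ae e4).trans ?_))
    rw [condExp_of_stronglyMeasurable (hle' s u hsu)]
    · have hs := had s u s hsu (Or.inl le_rfl)
      have hu := had s u u hsu (Or.inr le_rfl)
      have hm : Measurable fun p : ℝ × ℝ => factorF σ τ γ t s u * quadK η θ σ τ γ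
          (delta s u p.1 p.2) (deltaTilde s u p.1 p.2) := by
        unfold quadK delta deltaTilde; fun_prop
      exact (hm.comp (hs.prodMk hu)).stronglyMeasurable
    · exact (hY.integrable_quadK s u η θ σ τ γ).const_mul _

/-- The transformed bridges have `η = σ = 0` and `γ = 1`. -/
theorem ae_bridge_isQuadraticHarness [IsMarkovKernel ν]
    (hZ : IsQuadraticHarness P 𝓕 Z η θ σ τ γ) (hV : 0 < V)
    (hν : (jointLaw P Z V hV).IsCondKernel ν)
    (hY : ∀ᵐ z ∂(P.map (Z ⟨V, hV⟩)), IsQMeixner (ν z) (bridgeTransform θ τ V hV z)) :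
    ∀ᵐ z ∂(P.map (Z ⟨V, hV⟩)), 0 < bridgeKappa θ τ V z ∧
      IsQuadraticHarness (ν z) (naturalFamily (bridgeTransform θ τ V hV z))
        (bridgeTransform θ τ V hV z) 0 (bridgeTheta θ τ V z) 0 (bridgeTau τ V) 1 := by
  obtain ⟨hη, hσ, hγ⟩ := hZ.parameters_of_isQMeixner hV hν hY
  filter_upwards [hY, hZ.ae_bridge_condVar hV hν] with z hz hc
  obtain ⟨𝓖, θ', τ', q, -, -, hz⟩ := hz
  have e1 : bridgeEta η θ τ γ V z = 0 := by
    rw [bridgeEta, hη, hγ]; field_simp; ring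
  have e2 : bridgeSigma σ τ γ V = 0 := by
    rw [bridgeSigma, hσ, hγ]; field_simp; ring
  have e3 : bridgeGamma τ γ V = 1 := by
    rw [bridgeGamma, hγ]; ring
  have := hz.to_naturalFamily (hc _ _ _ _ _ _ hz)
  rw [e1, e2, e3] at this
  exact ⟨bridgeKappa_pos hz, this⟩

end IsQuadraticHarness

/-- The discriminant is multiplied by a positive number: `θ² - 4 τ = κ² (θ_Y² - 4 τ_Y)`. -/
theorem sign_bridgeTheta_sq_sub (hV : 0 < V) (hτ : 0 ≤ τ) {z : ℝ}
    (hκ : 0 < bridgeKappa θ τ V z) :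
    SignType.sign (bridgeTheta θ τ V z ^ 2 - 4 * bridgeTau τ V)
      = SignType.sign (θ ^ 2 - 4 * τ) := by
  have hk := bridgeKappa_sq hκ
  have hVτ : V + τ ≠ 0 := by positivity
  have e : θ ^ 2 - 4 * τ
      = (bridgeTheta θ τ V z ^ 2 - 4 * bridgeTau τ V) * bridgeKappa θ τ V z ^ 2 := by
    rw [bridgeTheta, div_pow, sub_mul, div_mul_cancel₀ _ (pow_pos hκ 2).ne', hk, bridgeTau]
    field_simp
    ring
  rw [e, sign_mul, sign_pos (pow_pos hκ 2), mul_one]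

end Parameters

end QHarness

/-! ### The trichotomy -/

open QHarness in
theorem propositionP {Ω : Type*} [MeasurableSpace Ω] (P : Measure Ω) [IsProbabilityMeasure P]
    (𝓕 : Set.Ioi (0 : ℝ) → Set.Ioi (0 : ℝ) → MeasurableSpace Ω)
    (Z : Set.Ioi (0 : ℝ) → Ω → ℝ) (η θ σ τ γ : ℝ)
    (hZ : IsQuadraticHarness P 𝓕 Z η θ σ τ γ)
    (V : ℝ) (hV : 0 < V)
    (ν : Kernel ℝ (Set.Ioo 0 V → ℝ)) [IsMarkovKernel ν]
    (hν : (jointLaw P Z V hV).IsCondKernel ν)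
    (hY : ∀ᵐ z ∂(P.map (Z ⟨V, hV⟩)), IsQMeixner (ν z) (bridgeTransform θ τ V hV z)) :
    -- at least one of the three cases occurs
    (WienerCase η θ σ τ γ ∨ PoissonCase η θ σ τ γ V ∨ MaximalCase η θ σ τ γ V) ∧
    -- at most one of the three cases occurs
    ¬ (WienerCase η θ σ τ γ ∧ PoissonCase η θ σ τ γ V) ∧
    ¬ (WienerCase η θ σ τ γ ∧ MaximalCase η θ σ τ γ V) ∧
    ¬ (PoissonCase η θ σ τ γ V ∧ MaximalCase η θ σ τ γ V) ∧
    -- in the first case the transformed bridge is a Wiener process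
    (WienerCase η θ σ τ γ → ∀ᵐ z ∂(P.map (Z ⟨V, hV⟩)),
      IsPreBrownianReal (extendZero (bridgeTransform θ τ V hV z)) (ν z)) ∧
    -- in the second case it is a standardized Poisson process with intensity depending on `z`
    (PoissonCase η θ σ τ γ V → ∀ᵐ z ∂(P.map (Z ⟨V, hV⟩)),
      0 < 1 + η * z ∧
      IsPoissonProcess (ν z) (Real.toNNReal ((1 + η * z) / θ ^ 2))
        (fun t X => √(1 + η * z) / θ * extendZero (bridgeTransform θ τ V hV z) t X
          + (1 + η * z) / θ ^ 2 * (t : ℝ))) ∧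
    -- in the third case it is a Meixner process, with `θ_Y² - 4 τ_Y` of the sign of `θ² - 4 τ`
    (MaximalCase η θ σ τ γ V → ∀ᵐ z ∂(P.map (Z ⟨V, hV⟩)),
      0 < bridgeKappa θ τ V z ∧
      IsQuadraticHarness (ν z) (naturalFamily (bridgeTransform θ τ V hV z))
        (bridgeTransform θ τ V hV z)
        0 ((θ + 2 * τ * (z / V)) / bridgeKappa θ τ V z) 0 (V * τ / (V + τ)) 1 ∧
      SignType.sign (((θ + 2 * τ * (z / V)) / bridgeKappa θ τ V z) ^ 2 - 4 * (V * τ / (V + τ)))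
        = SignType.sign (θ ^ 2 - 4 * τ)) := by
  have hτ := hZ.tau_nonneg
  obtain ⟨hη, hσ, hγ⟩ := hZ.parameters_of_isQMeixner hV hν hY
  have hQ := hZ.ae_bridge_isQuadraticHarness hV hν hY
  refine ⟨?_, ?_, ?_, ?_, ?_, ?_, ?_⟩
  -- With `η = θ/V`, `σ = τ/V²` and `γ = 1 + 2τ/V`, only `τ` and `θ` remain free: the cases are `τ =
  -- θ = 0`, `τ = 0 ≠ θ` and `τ > 0`.
  · rcases hτ.eq_or_lt with h0 | h0
    · have h0' : τ = 0 := h0.symm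
      subst h0'
      rcases eq_or_ne θ 0 with hθ | hθ
      · left
        subst hθ
        exact ⟨by simpa using hγ, by simpa using hσ, rfl, by simpa using hη, rfl⟩
      · right; left
        refine ⟨by simpa using hγ, by simpa using hσ, rfl, ?_, ?_⟩
        · rw [hη, div_mul_eq_mul_div]
          exact div_pos (mul_self_pos.2 hθ) hV
        · rw [hη]; field_simp
    · right; right
      have hsq : √(σ * τ) = τ / V := by
        rw [hσ, show τ / V ^ 2 * τ = (τ / V) ^ 2 by ring, Real.sqrt_sq (by positivity)]
      have hsσ : √σ = √τ / V := by
        rw [hσ, Real.sqrt_div h0.le, Real.sqrt_sq hV.le]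
      refine ⟨by rw [hσ]; positivity, h0, by rw [hsq, hγ]; ring, ?_, ?_, ?_⟩
      · rw [hγ]
        have : 0 < 2 * τ / V := by positivity
        linarith
      · rw [hη, hsσ]; ring
      · rw [hσ, show τ / (τ / V ^ 2) = V ^ 2 by field_simp, Real.sqrt_sq hV.le]
  · rintro ⟨⟨-, -, -, h, -⟩, -, -, -, h', -⟩
    rw [h, zero_mul] at h'
    exact lt_irrefl _ h'
  · rintro ⟨⟨-, h, -⟩, h', -⟩
    exact h'.ne' h
  · rintro ⟨⟨-, h, -⟩, h', -⟩
    exact h'.ne' h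
  · rintro ⟨-, -, hτ0, -, hθ⟩
    filter_upwards [hQ] with z hz
    have e1 : bridgeTheta θ τ V z = 0 := by rw [bridgeTheta, hτ0, hθ]; simp
    have e2 : bridgeTau τ V = 0 := by rw [bridgeTau, hτ0]; simp
    have := hz.2
    rw [e1, e2] at this
    exact this.isPreBrownianReal
  · rintro ⟨-, -, hτ0, hηθ, -⟩
    have hθ : θ ≠ 0 := by rintro rfl; simp at hηθ
    filter_upwards [hQ] with z hz
    -- For `τ = 0` and `η = θ/V`, `κ² = 1 + η z`. The jump size of the transformed bridge is then
    -- `θ/κ`, hence its intensity is `κ²/θ²`.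
    have e0 : bridgeKappa θ τ V z = √(1 + η * z) := by
      rw [bridgeKappa, hτ0, hη]
      congr 1
      ring
    have hpos : 0 < 1 + η * z := by
      have := hz.1
      rw [e0] at this
      exact Real.sqrt_pos.1 this
    have e1 : bridgeTheta θ τ V z = θ / √(1 + η * z) := by rw [bridgeTheta, e0, hτ0]; simp
    have e2 : bridgeTau τ V = 0 := by rw [bridgeTau, hτ0]; simp
    have hs := Real.sqrt_pos.2 hpos
    have hbridge := hz.2
    rw [e1, e2] at hbridge
    have h2 := hbridge.isPoissonProcess (div_ne_zero hθ hs.ne')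
    rw [one_div_div, div_pow, one_div_div, Real.sq_sqrt hpos.le] at h2
    exact ⟨hpos, h2⟩
  · intro _
    filter_upwards [hQ] with z hz
    exact ⟨hz.1, hz.2, sign_bridgeTheta_sq_sub hV hτ hz.1⟩
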